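/- Let $n\ge 1$, let $\mathrm{U}(n+1)$ act on the unit sphere $S^{2n+1}\subset\mathbb{C}^{n+1}$ by matrix multiplication, and let $o=(1,0,\dots,0)$. The action is transitive, and the stabilizer of $o$ is $\mathrm{U}(n)$, embedded by $A\mapsto\left(\begin{smallmatrix}1&0\\0&A\end{smallmatrix}\right)$, so that $S^{2n+1}=\mathrm{U}(n+1)/\mathrm{U}(n)$. Let $FS^{2n+1}$ be the bundle of positively oriented orthonormal frames of the round sphere (for either orientation), and let $\lambda:\mathrm{Spin}(2n+1)\to\mathrm{SO}(2n+1)$ be the double covering. A spin structure on $S^{2n+1}$ is a principal $\mathrm{Spin}(2n+1)$-bundle $P\to S^{2n+1}$ with a two-sheeted covering $\Lambda:P\to FS^{2n+1}$ over $S^{2n+1}$ such that $\Lambda(p\cdot s)=\Lambda(p)\cdot\lambda(s)$. It is called $\mathrm{U}(n+1)$-invariant if $\mathrm{U}(n+1)$ acts on $P$ by principal bundle automorphisms $\tilde\mu_g$ with $\Lambda\circ\tilde\mu_g=d\mu_g\circ\Lambda$, where $d\mu_g$ is the map of $FS^{2n+1}$ given by the differential of the action $\mu_g$ of $g$ on $S^{2n+1}$.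 Then: 1. $S^{2n+1}$ has a spin structure, and no spin structure on $S^{2n+1}$ is $\mathrm{U}(n+1)$-invariant. 2. The isotropy representation $\sigma:\mathrm{U}(n)\to\mathrm{GL}(T_oS^{2n+1})$, $\sigma(A)=(d\mu_A)_o$, is isomorphic, as a real representation, to $\mu_n^{\mathbb{R}}\oplus 1$, where $\mu_n^{\mathbb{R}}$ is the standard representation of $\mathrm{U}(n)$ on $\mathbb{C}^n$ regarded as a real representation, and $1$ is the trivial representation on $\mathbb{R}$. 3. $\pi_1(\mathrm{U}(n))\cong\mathbb{Z}$ and $\pi_1(\mathrm{SO}(2n+1))\cong\mathbb{Z}/2$. In every positively oriented orthonormal basis of $T_oS^{2n+1}$, $\sigma$ is a continuous homomorphism $\mathrm{U}(n)\to\mathrm{SO}(2n+1)$, and $\sigma_*:\pi_1(\mathrm{U}(n))\to\pi_1(\mathrm{SO}(2n+1))$ sends every generator of $\pi_1(\mathrm{U}(n))$ to the generator of $\pi_1(\mathrm{SO}(2n+1))$. -/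

import Mathlib

open scoped Manifold ContDiff RealInnerProductSpace
open Metric Module

universe u

noncomputable section

/-! ### The spin group and its covering of the special orthogonal group -/

/-- The negative definite form `x ↦ -(x₁² + ⋯ + x_m²)` on `ℝ^m`: its Clifford algebra is generated by
`e₁, …, e_m` with the relations `e_i e_j + e_j e_i = -2 δ_ij`. -/
abbrev cliffordForm (m : ℕ) : QuadraticForm ℝ (Fin m → ℝ) :=
  QuadraticMap.weightedSumSquares ℝ (fun _ : Fin m => (-1 : ℝ))

/-- The group `Spin(m)`, inside the Clifford algebra of `ℝ^m`. -/
abbrev Spin (m : ℕ) : Type := spinGroup (cliffordForm m)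

/-- `Spin(m)` carries the subspace topology from the Clifford algebra, which is a finite-dimensional
real vector space with its canonical topology. -/
instance Spin.instTopologicalSpace (m : ℕ) : TopologicalSpace (Spin m) :=
  TopologicalSpace.induced Subtype.val (moduleTopology ℝ (CliffordAlgebra (cliffordForm m)))

/-- The vector `λ(s) v = s v s⁻¹` of `ℝ^m`, for `s` in `Spin(m)` and `v` in `ℝ^m`. -/
def spinVec {m : ℕ} (s : Spin m) (v : Fin m → ℝ) : Fin m → ℝ :=
  Function.invFun (CliffordAlgebra.ι (cliffordForm m))
    ((s : CliffordAlgebra (cliffordForm m)) * CliffordAlgebra.ι (cliffordForm m) v *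
      ((s⁻¹ : Spin m) : CliffordAlgebra (cliffordForm m)))

/-- The conjugate `s v s⁻¹` is indeed a vector, so that `spinVec` is given by its formula. -/
theorem ι_spinVec {m : ℕ} (s : Spin m) (v : Fin m → ℝ) :
    CliffordAlgebra.ι (cliffordForm m) (spinVec s v) =
      (s : CliffordAlgebra (cliffordForm m)) * CliffordAlgebra.ι (cliffordForm m) v *
        ((s⁻¹ : Spin m) : CliffordAlgebra (cliffordForm m)) := by
  have : Invertible (2 : ℝ) := invertibleOfNonzero two_ne_zero
  have h := spinGroup.conjAct_smul_ι_mem_range_ι (Q := cliffordForm m)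
    (x := spinGroup.toUnits s) s.2 v
  exact Function.invFun_eq h

/-- The matrix of `λ(s)`, where `λ : Spin(m) → SO(m)` is the double covering. -/
def spinCover {m : ℕ} (s : Spin m) : Matrix (Fin m) (Fin m) ℝ :=
  Matrix.of fun i j => spinVec s (Pi.single j 1) i

/-! ### Oriented orthonormal frames of the round sphere -/

section Sphere

variable {E : Type*} [NormedAddCommGroup E] [InnerProductSpace ℝ E] {m : ℕ}
  [Fact (finrank ℝ E = m + 1)]

/-- The differential at `x` of the inclusion of the unit sphere of `E` in `E`. -/
def inclDeriv (x : sphere (0 : E) 1) : TangentSpace (𝓡 m) x →L[ℝ] E :=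
  mvfderiv (𝓡 m) ((↑) : sphere (0 : E) 1 → E) x

/-- The tuple `v` is an orthonormal basis of `T_x S` for the metric induced from `E`, positively
oriented for the orientation of the sphere as the boundary of the ball: the basis of `E` which
consists of the outer normal `x` followed by `v` is positive. -/
def IsOrientedFrame (o : Orientation ℝ E (Fin (m + 1))) (x : sphere (0 : E) 1)
    (v : Fin m → TangentSpace (𝓡 m) x) : Prop :=
  Orthonormal ℝ (fun i => inclDeriv x (v i)) ∧
    0 < o.volumeForm (Fin.cons (x : E) fun i => inclDeriv x (v i))

/-- The bundle `FS` of positively oriented orthonormal frames of the unit sphere `S` of `E`. -/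
structure FrameBundle (o : Orientation ℝ E (Fin (m + 1))) where
  /-- the base point of the frame -/
  pt : sphere (0 : E) 1
  /-- the vectors of the frame -/
  vec : Fin m → TangentSpace (𝓡 m) pt
  isFrame : IsOrientedFrame o pt vec

namespace FrameBundle

variable {o : Orientation ℝ E (Fin (m + 1))}

/-- The vectors of a frame, seen in `E`. -/
def toAmbient (F : FrameBundle o) (i : Fin m) : E := inclDeriv F.pt (F.vec i)

/-- The frame bundle is topologized as a subspace of `S × E^m`. -/
instance : TopologicalSpace (FrameBundle o) :=
  TopologicalSpace.induced (fun F => (F.pt, F.toAmbient)) inferInstance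

/-- `F'` is the frame `F · A = (∑ i, A i 1 v_i, …, ∑ i, A i m v_i)`, where `F = (v_1, …, v_m)`:
the right action of `SO(m)` on frames. -/
def IsRotationBy (F : FrameBundle o) (A : Matrix (Fin m) (Fin m) ℝ) (F' : FrameBundle o) : Prop :=
  F'.pt = F.pt ∧ ∀ j, F'.toAmbient j = ∑ i, A i j • F.toAmbient i

/-- `F'` is the image `(f(x), (df v_1, …, df v_m))` of the frame `F = (x, (v_1, …, v_m))` under the map
of frame bundles induced by `f : S → S`. -/
def IsImageUnder (F : FrameBundle o) (f : sphere (0 : E) 1 → sphere (0 : E) 1)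
    (F' : FrameBundle o) : Prop :=
  F'.pt = f F.pt ∧
    ∀ i, F'.toAmbient i = inclDeriv (f F.pt) (mfderiv (𝓡 m) (𝓡 m) f F.pt (F.vec i))

end FrameBundle

/-! ### Spin structures and their invariance -/

/-- A spin structure `(P, Λ)` on the unit sphere `S` of the oriented Euclidean space `E`. -/
structure SpinStructure (o : Orientation ℝ E (Fin (m + 1))) where
  /-- the total space -/
  P : Type u
  [topP : TopologicalSpace P]
  /-- the right action of `Spin(m)` on the total space -/
  act : P → Spin m → P
  act_one : ∀ p, act p 1 = p
  act_mul : ∀ p s t, act p (s * t) = act (act p s) t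
  continuous_act : Continuous fun q : P × Spin m => act q.1 q.2
  /-- the map to the frame bundle -/
  Λ : P → FrameBundle o
  /-- `Λ` is a covering -/
  isCoveringMap : IsCoveringMap Λ
  /-- the covering `Λ` has two sheets -/
  two_sheets : ∀ F, (Λ ⁻¹' {F}).ncard = 2
  /-- `P` is a principal `Spin(m)`-bundle over `S`: it has equivariant local trivializations -/
  principal : ∀ x : sphere (0 : E) 1, ∃ e : Bundle.Trivialization (Spin m) (fun p => (Λ p).pt),
    x ∈ e.baseSet ∧ ∀ p s, (Λ p).pt ∈ e.baseSet → (e (act p s)).2 = (e p).2 * s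
  /-- `Λ` intertwines the two right actions: `Λ (p · s) = Λ p · λ(s)` -/
  compat : ∀ p s, (Λ p).IsRotationBy (spinCover s) (Λ (act p s))

attribute [instance] SpinStructure.topP

/-- The spin structure `(P, Λ)` is `G`-invariant: the group `G` acts on `P` by automorphisms `φ g` of
the principal `Spin(m)`-bundle that cover the action of `G` on the frame bundle by differentials,
`Λ ∘ φ g = dμ_g ∘ Λ`. (Continuity in `g` is not required; to deny invariance in this sense also
excludes every continuous action of this kind.) -/
def SpinStructure.IsInvariant {o : Orientation ℝ E (Fin (m + 1))} (S : SpinStructure.{u} o)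
    (G : Type*) [Group G] [MulAction G (sphere (0 : E) 1)] : Prop :=
  ∃ φ : G → (S.P ≃ₜ S.P),
    (∀ p, φ 1 p = p) ∧ (∀ g h p, φ (g * h) p = φ g (φ h p)) ∧
    (∀ g p s, φ g (S.act p s) = S.act (φ g p) s) ∧
    ∀ g p, (S.Λ p).IsImageUnder (fun x => g • x) (S.Λ (φ g p))

end Sphere

/-! ### The action of `U(n+1)` on `S^{2n+1}` -/

/-- The unitary group `U(k)`. -/
abbrev U (k : ℕ) : Type := Matrix.unitaryGroup (Fin k) ℂ

/-- The special orthogonal group `SO(k)`. -/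
abbrev SO (k : ℕ) : Type := Matrix.specialOrthogonalGroup (Fin k) ℝ

/-- The space `ℂ^k` with its Hermitian norm, also regarded as a real Euclidean space. -/
abbrev CSpace (k : ℕ) : Type := EuclideanSpace ℂ (Fin k)

instance CSpace.factFinrank (n : ℕ) : Fact (finrank ℝ (CSpace (n + 1)) = 2 * n + 1 + 1) := by
  refine ⟨?_⟩
  have h : finrank ℝ (CSpace (n + 1)) = finrank ℝ (Fin (n + 1) → ℂ) :=
    (WithLp.linearEquiv 2 ℝ (Fin (n + 1) → ℂ)).finrank_eq
  rw [h, finrank_pi_fintype]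
  simp [Complex.finrank_real_complex]
  ring

/-- The unit sphere `S^{2n+1}` in `ℂ^{n+1}`. -/
abbrev CSphere (n : ℕ) : Type := sphere (0 : CSpace (n + 1)) 1

theorem norm_unitary_mulVec {k : ℕ} (g : U k) (x : CSpace k) :
    ‖(WithLp.toLp 2 ((g : Matrix (Fin k) (Fin k) ℂ).mulVec x.ofLp) : CSpace k)‖ = ‖x‖ := by
  have h : inner ℂ (WithLp.toLp 2 (g.1.mulVec x.ofLp) : CSpace k)
      (WithLp.toLp 2 (g.1.mulVec x.ofLp)) = inner ℂ x x := by
    simp only [EuclideanSpace.inner_eq_star_dotProduct]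
    rw [Matrix.star_mulVec, dotProduct_comm, ← Matrix.dotProduct_mulVec, Matrix.mulVec_mulVec,
      ← Matrix.star_eq_conjTranspose, Matrix.UnitaryGroup.star_mul_self, Matrix.one_mulVec,
      dotProduct_comm]
  rw [inner_self_eq_norm_sq_to_K, inner_self_eq_norm_sq_to_K] at h
  have h' : ‖(WithLp.toLp 2 (g.1.mulVec x.ofLp) : CSpace k)‖ ^ 2 = ‖x‖ ^ 2 := by
    exact_mod_cast h
  exact (sq_eq_sq₀ (norm_nonneg _) (norm_nonneg _)).1 h'

/-- `U(n+1)` acts on `S^{2n+1}` by multiplication of column vectors by matrices. -/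
instance CSphere.instMulAction (n : ℕ) : MulAction (U (n + 1)) (CSphere n) where
  smul g x := ⟨WithLp.toLp 2 ((g : Matrix (Fin (n + 1)) (Fin (n + 1)) ℂ).mulVec x.1.ofLp), by
    rw [mem_sphere_zero_iff_norm, norm_unitary_mulVec, norm_eq_of_mem_sphere]⟩
  one_smul x := by
    apply Subtype.ext
    change WithLp.toLp 2 ((1 : Matrix (Fin (n + 1)) (Fin (n + 1)) ℂ).mulVec x.1.ofLp) = x.1
    rw [Matrix.one_mulVec]
  mul_smul g h x := by
    apply Subtype.ext
    change WithLp.toLp 2 ((g.1 * h.1).mulVec x.1.ofLp) =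
      WithLp.toLp 2 (g.1.mulVec (h.1.mulVec x.1.ofLp))
    rw [Matrix.mulVec_mulVec]

/-- The base point `(1, 0, …, 0)` of `S^{2n+1}`. -/
def basePt (n : ℕ) : CSphere n :=
  ⟨EuclideanSpace.single 0 1, by simp⟩

/-- The block matrix with blocks `1` and `A`. -/
def blockMatrix {n : ℕ} (A : Matrix (Fin n) (Fin n) ℂ) : Matrix (Fin (n + 1)) (Fin (n + 1)) ℂ :=
  Matrix.of (Fin.cons (Fin.cons 1 0) fun i => Fin.cons 0 (A i))

theorem blockMatrix_one (n : ℕ) : blockMatrix (1 : Matrix (Fin n) (Fin n) ℂ) = 1 := by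
  ext i j
  refine Fin.cases ?_ (fun i => ?_) i <;> refine Fin.cases ?_ (fun j => ?_) j <;>
    simp [blockMatrix, Matrix.one_apply, Fin.succ_ne_zero, (Fin.succ_ne_zero _).symm]

theorem blockMatrix_mul {n : ℕ} (A B : Matrix (Fin n) (Fin n) ℂ) :
    blockMatrix (A * B) = blockMatrix A * blockMatrix B := by
  ext i j
  refine Fin.cases ?_ (fun i => ?_) i <;> refine Fin.cases ?_ (fun j => ?_) j <;>
    simp [blockMatrix, Matrix.mul_apply, Fin.sum_univ_succ]

theorem blockMatrix_star {n : ℕ} (A : Matrix (Fin n) (Fin n) ℂ) :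
    blockMatrix (star A) = star (blockMatrix A) := by
  ext i j
  refine Fin.cases ?_ (fun i => ?_) i <;> refine Fin.cases ?_ (fun j => ?_) j <;>
    simp [blockMatrix, Matrix.star_apply]

/-- The embedding of `U(n)` in `U(n+1)` as the block matrices with blocks `1` and `A`. -/
def blockEmb (n : ℕ) : U n →* U (n + 1) where
  toFun A := ⟨blockMatrix A.1, by
    rw [Matrix.mem_unitaryGroup_iff', ← blockMatrix_star, ← blockMatrix_mul,
      Matrix.UnitaryGroup.star_mul_self, blockMatrix_one]⟩
  map_one' := Subtype.ext (blockMatrix_one n)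
  map_mul' A B := Subtype.ext (blockMatrix_mul A.1 B.1)

theorem blockEmb_smul_basePt {n : ℕ} (A : U n) : blockEmb n A • basePt n = basePt n := by
  apply Subtype.ext
  change WithLp.toLp 2 ((blockMatrix A.1).mulVec (EuclideanSpace.single 0 1 : CSpace (n + 1)).ofLp) =
    EuclideanSpace.single 0 1
  ext i
  refine Fin.cases ?_ (fun i => ?_) i <;>
    simp [blockMatrix]

/-- The isotropy representation `σ` of `U(n)`, the stabilizer of the base point `o` of `S^{2n+1}`:
`σ(A)` is the differential at `o` of the action of `A`, an endomorphism of `T_o S^{2n+1}`. -/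
def isotropy (n : ℕ) (A : U n) :
    TangentSpace (𝓡 (2 * n + 1)) (basePt n) →L[ℝ] TangentSpace (𝓡 (2 * n + 1)) (basePt n) :=
  Eq.rec (motive := fun y _ =>
      TangentSpace (𝓡 (2 * n + 1)) (basePt n) →L[ℝ] TangentSpace (𝓡 (2 * n + 1)) y)
    (mfderiv (𝓡 (2 * n + 1)) (𝓡 (2 * n + 1)) (fun x : CSphere n => blockEmb n A • x) (basePt n))
    (blockEmb_smul_basePt A)

end

noncomputable section

open Topology unitInterval

/-! ### Loops and group actions -/

/-! Existence. In a positive orthonormal basis of the ambient space, an oriented frame of the sphere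
together with its base point is a rotation, so the frame bundle is `SO(2n+2)`, the base point being
the first column (`frameHomeomorph`). The covering of `SO(2n+2)` by `Spin(2n+2)` is then a spin
structure, with `Spin(2n+1)` acting by right multiplication (`nonempty_spinStructure`). This
requires the double covering itself: its kernel is `{1, -1}`, because an even element that commutes
with all vectors is annihilated by all contractions and hence is a scalar
(`spin_eq_one_or_neg_one`); surjectivity and compactness follow by induction along the spheres.

Noninvariance. An involution of `U(n)` that multiplies one unit vector by `-1` fixes the base point.
If it acted on `P`, it would move a point `p` over the base point to `p · s` with `λ(s) = σ(A)`, a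
half turn in a real plane. Both lifts of a half turn square to `-1`
(`mul_self_ne_one_of_spinHom_eq`), whereas the involution forces `s * s = 1`. This is the concrete
form of the obstruction that `σ` does not lift to `Spin(2n+1)`.

Isotropy. Inside `ℂ^(n+1)` the tangent space at `o` consists of the vectors whose first coordinate
is imaginary, and `A` acts there by the block matrix of `1` and `A`. This gives the splitting
directly (`tangentCoordinates`).

Fundamental groups. Spheres of dimension at least two are simply connected, and the groups act on
them with continuous local rotors. Hence a loop can be pushed into the stabilizer, and the block
embeddings are surjective on fundamental groups (`mapOfEq_unitBlock_surjective`). For `U(n)` this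
descends to the circle `U(1)`, and the determinant shows that nothing is lost. For `SO(m)`, `m ≥ 3`,
it descends to `SO(2)`: the class of a full turn generates, equals its inverse by a conjugation
(`sq_loopClass_planeRotLoop`), and is not trivial because it lifts to a path from `1` to `-1` in the
spin group (`loopClass_planeRotLoop_ne_one`). Finally `σ` turns multiplication by `z` on a complex
line into the rotation by `z` of a real plane (`isotropyHom_lineRotHom`), so it takes the circle
generating the first group to the full turn. -/

theorem Path.Homotopic.of_continuous {X : Type*} [TopologicalSpace X] {x y : X} {p q : Path x y}
    (F : I × I → X) (hF : Continuous F) (h0 : ∀ t, F (0, t) = p t) (h1 : ∀ t, F (1, t) = q t)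
    (hx : ∀ s, F (s, 0) = x) (hy : ∀ s, F (s, 1) = y) : p.Homotopic q :=
  ⟨{ toFun := F
     continuous_toFun := hF
     map_zero_left := h0
     map_one_left := h1
     prop' := by
      rintro s t (rfl | rfl)
      · simp [hx]
      · simp [hy] }⟩

/-- A mollified path misses the two endpoints slightly; adding the linear interpolation of the two
errors restores them. -/
theorem exists_contDiff_norm_sub_lt {E : Type*} [NormedAddCommGroup E] [NormedSpace ℝ E]
    [FiniteDimensional ℝ E] {x y : E} (γ : Path x y) {ε : ℝ} (hε : 0 < ε) :
    ∃ q : ℝ → E, ContDiff ℝ 1 q ∧ q 0 = x ∧ q 1 = y ∧ ∀ t : I, ‖q t - γ t‖ < ε := by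
  have hu : UniformContinuous (Set.IccExtend (zero_le_one' ℝ) γ) :=
    (CompactSpace.uniformContinuous_of_continuous γ.continuous).comp
      (LipschitzWith.projIcc (zero_le_one' ℝ)).uniformContinuous
  -- One third of `ε` goes to the mollification and one third to each endpoint correction.
  obtain ⟨g, hg, hd⟩ := hu.exists_contDiff_dist_le (ε := ε / 3) (by positivity)
  have hd' (t : I) : ‖g t - γ t‖ < ε / 3 := by
    have := hd t
    rwa [Set.IccExtend_of_mem _ _ t.2, dist_eq_norm] at this
  have h0 : ‖x - g 0‖ < ε / 3 := by
    have := hd' 0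
    rwa [γ.source, norm_sub_rev] at this
  have h1 : ‖y - g 1‖ < ε / 3 := by
    have := hd' 1
    rwa [γ.target, norm_sub_rev] at this
  refine ⟨fun t => g t + ((1 - t) • (x - g 0) + t • (y - g 1)), ?_, by simp, by simp, fun t => ?_⟩
  · have := hg.of_le (m := 1) (by exact_mod_cast le_top)
    fun_prop
  · have ht0 := t.2.1
    have ht1 := t.2.2
    have e : g t + ((1 - (t : ℝ)) • (x - g 0) + (t : ℝ) • (y - g 1)) - γ t =
      (g t - γ t) + ((1 - (t : ℝ)) • (x - g 0) + (t : ℝ) • (y - g 1)) := by abel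
    rw [e]
    calc _ ≤ ‖g t - γ t‖ + (‖(1 - (t : ℝ)) • (x - g 0)‖ + ‖(t : ℝ) • (y - g 1)‖) :=
          (norm_add_le _ _).trans (by gcongr; exact norm_add_le _ _)
      _ = ‖g t - γ t‖ + ((1 - (t : ℝ)) * ‖x - g 0‖ + t * ‖y - g 1‖) := by
          rw [norm_smul, norm_smul, Real.norm_of_nonneg ht0, Real.norm_of_nonneg (by linarith)]
      _ ≤ ‖g t - γ t‖ + (1 * ‖x - g 0‖ + 1 * ‖y - g 1‖) := by gcongr; linarith
      _ < ε := by linarith [hd' t]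

/-! ### Loops on spheres of dimension at least two -/

section SimplyConnectedSphere

variable {E : Type*} [NormedAddCommGroup E] [InnerProductSpace ℝ E]

/-- Stereographic projection from `v` identifies the complement with a vector space. -/
theorem simplyConnectedSpace_sphere_compl (v : sphere (0 : E) 1) :
    SimplyConnectedSpace ({v}ᶜ : Set (sphere (0 : E) 1)) := by
  have hv : ‖(v : E)‖ = 1 := norm_eq_of_mem_sphere v
  have e := (stereographic hv).toHomeomorphSourceTarget
  have hc : ContractibleSpace (stereographic hv).target := by
    rw [stereographic_target]
    exact (Homeomorph.Set.univ _).contractibleSpace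
  have h2 : SimplyConnectedSpace (stereographic hv).source :=
    e.toHomotopyEquiv.simplyConnectedSpace
  exact h2

/-- Radial projection of a nonzero vector to the unit sphere. -/
def toUnitSphere (x : E) (hx : x ≠ 0) : sphere (0 : E) 1 :=
  ⟨‖x‖⁻¹ • x, by simp [norm_smul, norm_ne_zero_iff.2 hx]⟩

theorem toUnitSphere_eq {v : E} (hv : v ≠ 0) {x : sphere (0 : E) 1} (h : v = x) :
    toUnitSphere v hv = x := by
  subst h
  apply Subtype.ext
  simp [toUnitSphere]

theorem Continuous.toUnitSphere {X : Type*} [TopologicalSpace X] {f : X → E} (hf : Continuous f)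
    (h : ∀ x, f x ≠ 0) : Continuous fun x => toUnitSphere (f x) (h x) := by
  refine Continuous.subtype_mk ?_ _
  exact (hf.norm.inv₀ fun x => norm_ne_zero_iff.2 (h x)).smul hf

/-- A continuous loop may fill the sphere. It is replaced by the radial projection of a nearby `C¹`
loop, which misses a point for reasons of dimension and so contracts in the complement of that
point. -/
theorem sphere_path_homotopic_refl [FiniteDimensional ℝ E] (hE : 3 ≤ finrank ℝ E)
    {x : sphere (0 : E) 1} (γ : Path x x) : γ.Homotopic (Path.refl x) := by
  obtain ⟨q, hq, hq0, hq1, hqγ⟩ := exists_contDiff_norm_sub_lt (γ.map continuous_subtype_val)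
    one_pos
  replace hqγ : ∀ t : I, ‖q t - γ t‖ < 1 := hqγ
  -- The error is less than `1 = ‖γ t‖`, so the segment from `γ t` to `q t` avoids the origin and
  -- can be projected radially.
  have hne (s : ℝ) (hs0 : 0 ≤ s) (hs1 : s ≤ 1) (t : I) :
      ((γ t : sphere (0 : E) 1) : E) + s • (q t - γ t) ≠ 0 := by
    intro h
    have h1 : ‖((γ t : sphere (0 : E) 1) : E)‖ = 1 := norm_eq_of_mem_sphere _
    rw [eq_neg_of_add_eq_zero_left h, norm_neg, norm_smul, Real.norm_of_nonneg hs0] at h1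
    nlinarith [hqγ t, norm_nonneg (q t - γ t)]
  have hqne (t : I) : q t ≠ 0 := by simpa using hne 1 zero_le_one le_rfl t
  let γ' : Path x x :=
    { toFun := fun t => toUnitSphere (q t) (hqne t)
      continuous_toFun := (hq.continuous.comp continuous_subtype_val).toUnitSphere hqne
      source' := by
        exact toUnitSphere_eq _ (by simpa)
      target' := by
        exact toUnitSphere_eq _ (by simpa) }
  have hγ' : γ.Homotopic γ' := by
    refine Path.Homotopic.of_continuous
      (fun st => toUnitSphere _ (hne st.1 st.1.2.1 st.1.2.2 st.2)) ?_ ?_ ?_ ?_ ?_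
    · apply Continuous.toUnitSphere
      have := hq.continuous
      fun_prop
    · intro t
      exact toUnitSphere_eq _ (by simp)
    · intro t
      change _ = toUnitSphere (q t) (hqne t)
      congr 1
      simp
    · intro s
      exact toUnitSphere_eq _ (by simp [hq0])
    · intro s
      exact toUnitSphere_eq _ (by simp [hq1])
  -- The cone over the curve is a `C¹` image of a plane, and `E` has dimension at least three. A
  -- vector outside the cone has its direction off the projected loop.
  have hd : Dense (Set.range fun p : ℝ × ℝ => p.1 • q p.2)ᶜ := by
    apply ContDiff.dense_compl_range_of_finrank_lt_finrank
    · fun_prop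
    · simp
      omega
  obtain ⟨v, hv⟩ := hd.nonempty
  have hv0 : v ≠ 0 := by
    rintro rfl
    exact hv ⟨(0, 0), by simp⟩
  have hmiss (t : I) : γ' t ∈ ({toUnitSphere v hv0}ᶜ : Set (sphere (0 : E) 1)) := by
    intro h
    have h' : ‖q t‖⁻¹ • q t = ‖v‖⁻¹ • v := congrArg Subtype.val h
    refine hv ⟨(‖v‖ * ‖q t‖⁻¹, t), ?_⟩
    simp only
    rw [mul_smul, h', smul_smul, mul_inv_cancel₀ (norm_ne_zero_iff.2 hv0), one_smul]
  have := simplyConnectedSpace_sphere_compl (toUnitSphere v hv0)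
  have hx := hmiss 0
  rw [γ'.source] at hx
  let δ : Path (⟨x, hx⟩ : ({toUnitSphere v hv0}ᶜ : Set (sphere (0 : E) 1))) ⟨x, hx⟩ :=
    { toFun := fun t => ⟨γ' t, hmiss t⟩
      continuous_toFun := by fun_prop
      source' := Subtype.ext γ'.source
      target' := Subtype.ext γ'.target }
  have hδ := (SimplyConnectedSpace.paths_homotopic δ (Path.refl _)).map
    (⟨Subtype.val, continuous_subtype_val⟩ : C(_, sphere (0 : E) 1))
  exact hγ'.trans hδ

end SimplyConnectedSphere

/-! ### Pushing loops of a group into a stabilizer -/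

section Deformation

variable {G X : Type*} [Group G] [TopologicalSpace G] [IsTopologicalGroup G] [PseudoMetricSpace X]
  [MulAction G X]

/-- Homotopy lifting for the orbit map of a group action with local rotors `R x y`: a loop
in the group whose orbit loop is null-homotopic is homotopic to a loop in the stabilizer. -/
theorem exists_homotopic_stabilizer_loop {δ : ℝ} (hδ : 0 < δ) (R : X → X → G)
    (hRc : ContinuousOn (fun p : X × X => R p.1 p.2) {p | dist p.1 p.2 < δ})
    (hR1 : ∀ x, R x x = 1) (hR : ∀ x y, dist x y < δ → R x y • x = y)
    {x₀ : X} (γ : Path (1 : G) 1) (c : Path x₀ x₀) (hc : ∀ t, c t = γ t • x₀)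
    (hnull : c.Homotopic (Path.refl x₀)) :
    ∃ γ' : Path (1 : G) 1, γ.Homotopic γ' ∧ ∀ t, γ' t • x₀ = x₀ := by
  obtain ⟨H⟩ := hnull
  have hu : UniformContinuous H := CompactSpace.uniformContinuous_of_continuous H.continuous
  obtain ⟨η, hη, hH⟩ := Metric.uniformContinuous_iff.1 hu δ hδ
  -- With mesh `1 / (n + 1)`, corresponding points of consecutive rows of the null-homotopy are less
  -- than `δ` apart, where the rotors are defined and continuous.
  obtain ⟨n, hn⟩ := exists_nat_one_div_lt hη
  have hmem (i : ℕ) (hi : i ≤ n + 1) : (i : ℝ) / (n + 1) ∈ I := by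
    refine ⟨by positivity, ?_⟩
    rw [div_le_one (by positivity)]
    exact_mod_cast hi
  -- Induction over the rows: a loop homotopic to `γ` lies over the row `i / (n + 1)` of `H`. The
  -- next loop is its product with the rotors from one row to the next.
  have key (i : ℕ) (hi : i ≤ n + 1) : ∃ γ' : Path (1 : G) 1, γ.Homotopic γ' ∧
      ∀ t, γ' t • x₀ = H (⟨(i : ℝ) / (n + 1), hmem i hi⟩, t) := by
    induction i with
    | zero =>
      refine ⟨γ, Path.Homotopic.refl γ, fun t => ?_⟩
      rw [← hc t]
      refine (H.apply_zero t).symm.trans ?_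
      congr 2
      exact Subtype.ext (by simp)
    | succ i ih =>
      obtain ⟨γ', hγ', h'⟩ := ih (by omega)
      set a : I := ⟨(i : ℝ) / (n + 1), hmem i (by omega)⟩ with ha
      set b : I := ⟨((i + 1 : ℕ) : ℝ) / (n + 1), hmem (i + 1) hi⟩ with hb
      have hab : (b : ℝ) - a = 1 / (n + 1) := by
        simp only [ha, hb]
        push_cast
        ring
      let u : I → I := fun s => ⟨a + s * (b - a), by
        constructor
        · nlinarith [s.2.1, a.2.1, hab, show (0 : ℝ) < 1 / (n + 1) by positivity]
        · nlinarith [s.2.2, b.2.2, hab, show (0 : ℝ) < 1 / (n + 1) by positivity]⟩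
      have hu0 : u 0 = a := Subtype.ext (by simp [u])
      have hu1 : u 1 = b := Subtype.ext (by simp [u])
      have hcu : Continuous u := by fun_prop
      have hd (s t : I) : dist (H (a, t)) (H (u s, t)) < δ := by
        apply hH
        rw [Prod.dist_eq, dist_self, max_lt_iff]
        refine ⟨?_, hη⟩
        rw [Subtype.dist_eq, Real.dist_eq]
        have : (a : ℝ) - (u s : ℝ) = -(s * (1 / (n + 1))) := by
          simp only [u]
          rw [hab]
          ring
        rw [this, abs_neg, abs_of_nonneg (mul_nonneg s.2.1 (by positivity))]
        calc (s : ℝ) * (1 / (n + 1)) ≤ 1 * (1 / (n + 1)) := by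
              gcongr
              exact s.2.2
          _ < η := by rw [one_mul]; exact hn
      have hF : Continuous fun st : I × I => R (H (a, st.2)) (H (u st.1, st.2)) * γ' st.2 := by
        refine Continuous.mul ?_ (by fun_prop)
        have := hRc.comp_continuous (f := fun st : I × I => (H (a, st.2), H (u st.1, st.2)))
          (by fun_prop) (fun st => hd st.1 st.2)
        exact this
      -- At the endpoints `H` stays at `x₀`, so the rotors are `1` there and the homotopy is one of
      -- based loops.
      have hend (s : I) : H (s, 0) = x₀ ∧ H (s, 1) = x₀ := by
        constructor
        · simp
        · simp
      let γ'' : Path (1 : G) 1 :=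
        { toFun := fun t => R (H (a, t)) (H (b, t)) * γ' t
          continuous_toFun := by
            have := hF.comp (Continuous.prodMk_right (1 : I))
            simpa [Function.comp_def, hu1] using this
          source' := by simp [hend, hR1]
          target' := by simp [hend, hR1] }
      refine ⟨γ'', hγ'.trans (Path.Homotopic.of_continuous _ hF ?_ ?_ ?_ ?_), fun t => ?_⟩
      · intro t
        simp [hu0, hR1]
      · intro t
        simp [hu1, γ'']
      · intro s
        simp [hend, hR1]
      · intro s
        simp [hend, hR1]
      · have := hd 1 t
        rw [hu1] at this
        change (R (H (a, t)) (H (b, t)) * γ' t) • x₀ = H (b, t)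
        rw [mul_smul, h', hR _ _ this]
  obtain ⟨γ', hγ', h'⟩ := key (n + 1) le_rfl
  refine ⟨γ', hγ', fun t => ?_⟩
  rw [h']
  have : (⟨((n + 1 : ℕ) : ℝ) / (n + 1), hmem (n + 1) le_rfl⟩ : I) = 1 := by
    apply Subtype.ext
    push_cast
    exact div_self (by positivity)
  rw [this]
  exact H.apply_one t

end Deformation
end

noncomputable section

open Matrix

/-! ### Rotors: explicit unitary matrices that take one unit vector to another -/

section Rotor

variable {𝕜 : Type*} [RCLike 𝕜] {ι : Type*} [Fintype ι] [DecidableEq ι]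

/-- The complex reflection `1 - c⁻¹ a aᴴ`. -/
def unitaryReflection (a : ι → 𝕜) (c : 𝕜) : Matrix ι ι 𝕜 :=
  1 - c⁻¹ • vecMulVec a (star a)

theorem unitaryReflection_mulVec (a : ι → 𝕜) (c : 𝕜) (w : ι → 𝕜) :
    unitaryReflection a c *ᵥ w = w - (c⁻¹ * (star a ⬝ᵥ w)) • a := by
  simp [unitaryReflection, sub_mulVec, smul_mulVec, vecMulVec_mulVec, smul_smul]

/-- On the line of `a` the matrix is multiplication by `1 - (c + star c) / c = -star c / c`, of
modulus one; on the orthogonal complement it is the identity. -/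
theorem unitaryReflection_mem (a : ι → 𝕜) {c : 𝕜} (hc : c ≠ 0)
    (h : c + star c = star a ⬝ᵥ a) : unitaryReflection a c ∈ unitaryGroup ι 𝕜 := by
  have hc' : star c ≠ 0 := star_ne_zero.2 hc
  rw [mem_unitaryGroup_iff, unitaryReflection, star_sub, star_one, star_smul,
    star_eq_conjTranspose (vecMulVec _ _), conjTranspose_vecMulVec, star_star, sub_mul, one_mul, mul_sub, mul_one,
    smul_mul_smul, vecMulVec_mul_vecMulVec, vecMulVec_smul, smul_smul, ← h]
  have e : c⁻¹ * star c⁻¹ * (c + star c) = c⁻¹ + star c⁻¹ := by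
    rw [star_inv₀]
    field_simp
    ring
  rw [e, add_smul]
  abel

theorem det_unitaryReflection (a : ι → 𝕜) (c : 𝕜) :
    (unitaryReflection a c).det = 1 - c⁻¹ * (star a ⬝ᵥ a) := by
  have : unitaryReflection a c =
      1 + replicateCol Unit (-c⁻¹ • a) * replicateRow Unit (star a) := by
    rw [← vecMulVec_eq, unitaryReflection, smul_vecMulVec, neg_smul, sub_eq_add_neg]
  rw [this, det_one_add_replicateCol_mul_replicateRow, dotProduct_smul]
  simp [sub_eq_add_neg]

/-- A unitary matrix which takes the unit vector `x` to the unit vector `y`, and depends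
continuously on the two vectors where `⟪y, x⟫ ≠ -1`. -/
def rotor (x y : ι → 𝕜) : Matrix ι ι 𝕜 :=
  unitaryReflection (x + y) (1 + star y ⬝ᵥ x) * unitaryReflection x (1 / 2)

theorem unitaryReflection_half_mem {x : ι → 𝕜} (hx : star x ⬝ᵥ x = 1) :
    unitaryReflection x (1 / 2) ∈ unitaryGroup ι 𝕜 := by
  refine unitaryReflection_mem _ (by norm_num) ?_
  rw [hx, star_div₀, star_one, star_ofNat]
  exact add_halves 1

omit [DecidableEq ι] in
theorem rotor_aux {x y : ι → 𝕜} (hx : star x ⬝ᵥ x = 1) (hy : star y ⬝ᵥ y = 1) :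
    star (x + y) ⬝ᵥ (x + y) = (1 + star y ⬝ᵥ x) + star (1 + star y ⬝ᵥ x) := by
  have : star (star y ⬝ᵥ x) = star x ⬝ᵥ y := by
    rw [star_dotProduct, star_star]
  rw [star_add, add_dotProduct, dotProduct_add, dotProduct_add, hx, hy, star_add, star_one, this]
  ring

theorem rotor_mem {x y : ι → 𝕜} (hx : star x ⬝ᵥ x = 1) (hy : star y ⬝ᵥ y = 1)
    (h : 1 + star y ⬝ᵥ x ≠ 0) : rotor x y ∈ unitaryGroup ι 𝕜 :=
  mul_mem (unitaryReflection_mem _ h (rotor_aux hx hy).symm) (unitaryReflection_half_mem hx)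

theorem unitaryReflection_half_mulVec_self {x : ι → 𝕜} (hx : star x ⬝ᵥ x = 1) :
    unitaryReflection x (1 / 2) *ᵥ x = -x := by
  rw [unitaryReflection_mulVec, hx]
  norm_num
  rw [two_smul]
  abel

/-- The first reflection takes `x` to `-x`. The scalar `1 + star y ⬝ᵥ x` is the product of `x + y`
with `x`, so the second one takes `x` to `x - (x + y) = -y`, hence `-x` to `y`. -/
theorem rotor_mulVec {x y : ι → 𝕜} (hx : star x ⬝ᵥ x = 1)
    (h : 1 + star y ⬝ᵥ x ≠ 0) : rotor x y *ᵥ x = y := by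
  rw [rotor, ← mulVec_mulVec, unitaryReflection_half_mulVec_self hx, mulVec_neg,
    unitaryReflection_mulVec, star_add, add_dotProduct, hx, inv_mul_cancel₀ h]
  simp

/-- Both factors are then the same reflection, an involution. -/
theorem rotor_self {x : ι → 𝕜} (hx : star x ⬝ᵥ x = 1) : rotor x x = 1 := by
  have h1 : unitaryReflection (x + x) (1 + star x ⬝ᵥ x) = unitaryReflection x (1 / 2) := by
    rw [hx, unitaryReflection, unitaryReflection, star_add, ← two_smul 𝕜 x, ← two_smul 𝕜 (star x),
      smul_vecMulVec, vecMulVec_smul, smul_smul, smul_smul]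
    norm_num
  have h2 := mem_unitaryGroup_iff.1 (unitaryReflection_half_mem hx)
  have h3 : star (unitaryReflection x (1 / 2 : 𝕜)) = unitaryReflection x (1 / 2) := by
    rw [unitaryReflection, star_sub, star_one, star_smul, star_eq_conjTranspose,
      conjTranspose_vecMulVec, star_star, star_inv₀, star_div₀, star_one, star_ofNat]
  rw [rotor, h1]
  rwa [h3] at h2

/-- Over the reals both factors are hyperplane reflections, of determinant `-1`. -/
theorem det_rotor {x y : ι → ℝ} (hx : star x ⬝ᵥ x = 1) (hy : star y ⬝ᵥ y = 1)
    (h : 1 + star y ⬝ᵥ x ≠ 0) : (rotor x y).det = 1 := by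
  rw [rotor, det_mul, det_unitaryReflection, det_unitaryReflection, rotor_aux hx hy, hx]
  simp only [star_trivial] at h ⊢
  field_simp
  ring

theorem continuousOn_rotor :
    ContinuousOn (fun p : (ι → 𝕜) × (ι → 𝕜) => rotor p.1 p.2) {p | 1 + star p.2 ⬝ᵥ p.1 ≠ 0} := by
  unfold rotor unitaryReflection
  refine ContinuousOn.mul ?_ ?_
  · refine continuousOn_const.sub (ContinuousOn.smul (ContinuousOn.inv₀ ?_ fun p hp => hp) ?_)
    · simp only [dotProduct]
      fun_prop
    · fun_prop
  · fun_prop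

omit [DecidableEq ι] in
theorem star_dotProduct_self_eq_one {x : EuclideanSpace 𝕜 ι} (hx : ‖x‖ = 1) :
    star x.ofLp ⬝ᵥ x.ofLp = 1 := by
  have h := inner_self_eq_norm_sq_to_K (𝕜 := 𝕜) x
  rw [EuclideanSpace.inner_eq_star_dotProduct, hx, dotProduct_comm] at h
  simpa using h

omit [DecidableEq ι] in
theorem one_add_star_dotProduct_ne_zero {x y : EuclideanSpace 𝕜 ι} (hx : ‖x‖ = 1) (hy : ‖y‖ = 1)
    (h : dist x y < 1) : 1 + star y.ofLp ⬝ᵥ x.ofLp ≠ 0 := by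
  intro h0
  have h1 : inner 𝕜 y x = -1 := by
    rw [EuclideanSpace.inner_eq_star_dotProduct, dotProduct_comm]
    exact eq_neg_of_add_eq_zero_right h0
  have h2 := norm_sub_sq (𝕜 := 𝕜) y x
  rw [h1, hx, hy, ← dist_eq_norm, dist_comm] at h2
  simp at h2
  nlinarith [dist_nonneg (x := x) (y := y)]

end Rotor

instance SO.instIsTopologicalGroup (k : ℕ) : IsTopologicalGroup (SO k) where
  continuous_inv := by
    refine Continuous.subtype_mk (f := fun A : SO k => star A.1) ?_ _
    exact continuous_star.comp continuous_subtype_val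

end

noncomputable section

open Topology unitInterval Matrix

/-! ### Fundamental groups -/

section FundamentalGroup

variable {X Y Z : Type*} [TopologicalSpace X] [TopologicalSpace Y] [TopologicalSpace Z]

/-- The class of a loop in the fundamental group. -/
def loopClass {x : X} (γ : Path x x) : FundamentalGroup X x :=
  FundamentalGroup.fromPath (.mk γ)

theorem loopClass_surjective (x : X) : Function.Surjective (loopClass (x := x)) :=
  Path.Homotopic.Quotient.mk_surjective

theorem loopClass_eq_iff {x : X} {γ γ' : Path x x} :
    loopClass γ = loopClass γ' ↔ γ.Homotopic γ' :=
  Path.Homotopic.Quotient.eq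

theorem loopClass_symm {x : X} (γ : Path x x) : loopClass γ.symm = (loopClass γ)⁻¹ := rfl

theorem mapOfEq_loopClass (f : C(X, Y)) {x : X} {y : Y} (h : f x = y) (γ : Path x x) :
    FundamentalGroup.mapOfEq f h (loopClass γ) =
      loopClass ((γ.map f.continuous).cast h.symm h.symm) :=
  FundamentalGroup.mapOfEq_apply f h _

theorem mapOfEq_mapOfEq (f : C(X, Y)) (g : C(Y, Z)) {x : X} {y : Y} {z : Z} (hf : f x = y)
    (hg : g y = z) (h : (g.comp f) x = z) (p : FundamentalGroup X x) :
    FundamentalGroup.mapOfEq g hg (FundamentalGroup.mapOfEq f hf p) =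
      FundamentalGroup.mapOfEq (g.comp f) h p := by
  obtain ⟨γ, rfl⟩ := loopClass_surjective _ p
  simp only [mapOfEq_loopClass]
  rfl

theorem mapOfEq_eq_self (f : C(X, X)) (hf : ∀ x, f x = x) {x : X} (h : f x = x)
    (p : FundamentalGroup X x) : FundamentalGroup.mapOfEq f h p = p := by
  obtain ⟨γ, rfl⟩ := loopClass_surjective _ p
  rw [mapOfEq_loopClass]
  congr 1
  ext t
  exact hf _

theorem mapOfEq_congr {f g : C(X, Y)} (hfg : ∀ x, f x = g x) {x : X} {y : Y} (hf : f x = y)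
    (hg : g x = y) (p : FundamentalGroup X x) :
    FundamentalGroup.mapOfEq f hf p = FundamentalGroup.mapOfEq g hg p := by
  obtain rfl : f = g := ContinuousMap.ext hfg
  rfl

theorem mapOfEq_bijective_of_homeomorph (e : X ≃ₜ Y) {x : X} {y : Y} (h : e x = y) :
    Function.Bijective (FundamentalGroup.mapOfEq (e : C(X, Y)) h) := by
  have h' : (e.symm : C(Y, X)) y = x := by simp [← h]
  refine Function.bijective_iff_has_inverse.2
    ⟨FundamentalGroup.mapOfEq (e.symm : C(Y, X)) h', fun p => ?_, fun p => ?_⟩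
  · rw [mapOfEq_mapOfEq _ _ _ _ (by simp)]
    exact mapOfEq_eq_self _ (by simp) _ _
  · rw [mapOfEq_mapOfEq _ _ _ _ (by simp)]
    exact mapOfEq_eq_self _ (by simp) _ _

end FundamentalGroup

/-! ### Surjectivity from the fundamental group of a stabilizer -/

section Stabilizer

variable {H G X : Type*} [Group H] [TopologicalSpace H] [Group G] [TopologicalSpace G]
  [IsTopologicalGroup G] [PseudoMetricSpace X] [MulAction G X]

/-- The part of the homotopy sequence of `H → G → X` that is needed: the orbit loop of a loop in `G`
is null-homotopic, so the loop deforms into the stabilizer. That `j` is inducing makes the result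
continuous as a loop in `H`. -/
theorem mapOfEq_stabilizer_surjective {δ : ℝ} (hδ : 0 < δ) (R : X → X → G)
    (hRc : ContinuousOn (fun p : X × X => R p.1 p.2) {p | dist p.1 p.2 < δ})
    (hR1 : ∀ x, R x x = 1) (hR : ∀ x y, dist x y < δ → R x y • x = y) {x₀ : X}
    (hact : Continuous fun g : G => g • x₀) (hX : ∀ c : Path x₀ x₀, c.Homotopic (Path.refl x₀))
    (j : H →* G) (hj : IsInducing j) (hinj : Function.Injective j)
    (hrange : ∀ g : G, g • x₀ = x₀ → g ∈ Set.range j) :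
    Function.Surjective
      (FundamentalGroup.mapOfEq (⟨j, hj.continuous⟩ : C(H, G)) (map_one j)) := by
  intro p
  obtain ⟨γ, rfl⟩ := loopClass_surjective _ p
  let c : Path x₀ x₀ :=
    { toFun := fun t => γ t • x₀
      continuous_toFun := hact.comp γ.continuous
      source' := by simp
      target' := by simp }
  obtain ⟨γ', hγ', hst⟩ := exists_homotopic_stabilizer_loop hδ R hRc hR1 hR γ c (fun _ => rfl) (hX c)
  choose u hu using fun t => hrange (γ' t) (hst t)
  let η : Path (1 : H) 1 :=
    { toFun := u
      continuous_toFun := by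
        rw [hj.continuous_iff]
        have : j ∘ u = γ' := funext hu
        rw [this]
        exact γ'.continuous
      source' := hinj (by rw [hu, γ'.source, map_one])
      target' := hinj (by rw [hu, γ'.target, map_one]) }
  refine ⟨loopClass η, ?_⟩
  rw [mapOfEq_loopClass, loopClass_eq_iff.2 hγ']
  congr 1
  ext t
  exact hu t

end Stabilizer

/-! ### The circle -/

theorem Circle.coe_mul_star_self (z : Circle) : (z : ℂ) * star (z : ℂ) = 1 := by
  change (z : ℂ) * (starRingEnd ℂ) (z : ℂ) = 1
  rw [← Circle.coe_inv_eq_conj, ← Circle.coe_mul, mul_inv_cancel, Circle.coe_one]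

/-- A complex number of norm `1`, as an element of the circle. -/
def circleOfMulStar (z : ℂ) (h : z * star z = 1) : Circle :=
  ⟨z, mem_sphere_zero_iff_norm.2 (by
    have : ‖z‖ * ‖z‖ = 1 := by
      simpa using congrArg norm h
    nlinarith [norm_nonneg z])⟩

/-- The loop `t ↦ exp (2 π i t)`. -/
def circleLoop : Path (1 : Circle) 1 where
  toFun t := Circle.exp (2 * Real.pi * t)
  continuous_toFun := by fun_prop
  source' := by simp
  target' := by simp

/-- The lift of the loop that starts at `0` is `t ↦ 2πt`. -/
theorem monodromy_circleLoop (e e' : Circle.exp ⁻¹' {1}) (he : (e : ℝ) = 0)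
    (he' : (e' : ℝ) = 2 * Real.pi) :
    Circle.isCoveringMap_exp.monodromy (loopClass circleLoop) e = e' := by
  obtain ⟨e, h⟩ := e
  obtain ⟨e', h'⟩ := e'
  subst he he'
  let Γ : Path (0 : ℝ) (2 * Real.pi) :=
    { toFun := fun t => 2 * Real.pi * t
      continuous_toFun := by fun_prop
      source' := by simp
      target' := by simp }
  exact Circle.isCoveringMap_exp.monodromy_eq_of_map_eq (.mk Γ) rfl

/-- The fundamental group is the deck group `2πℤ` of `Circle.exp`, and the loop corresponds to the
endpoint `2π` of its lift. -/
theorem exists_circle_mulEquiv :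
    ∃ f : FundamentalGroup Circle 1 ≃* Multiplicative ℤ,
      f (loopClass circleLoop) = Multiplicative.ofAdd 1 := by
  let e : Circle.exp ⁻¹' {1} := ⟨0, by simp⟩
  let e' : Circle.exp ⁻¹' {1} := ⟨2 * Real.pi, by simp⟩
  let f₁ := Circle.isAddQuotientCoveringMap_exp.fundamentalGroupEquiv e
  have h2π : (2 * Real.pi) ≠ 0 := by positivity
  let a : AddSubgroup.zmultiples (2 * Real.pi) :=
    ⟨2 * Real.pi, AddSubgroup.mem_zmultiples _⟩
  have hf₁ : f₁ (loopClass circleLoop) = MulOpposite.op (Multiplicative.ofAdd a) := by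
    refine Circle.isAddQuotientCoveringMap_exp.fundamentalGroupToMulOpposite_apply_eq_Iff.2 ?_
    rw [monodromy_circleLoop e e' rfl rfl]
    change 2 * Real.pi + 0 = 2 * Real.pi
    simp
  let f₂ : ℤ ≃+ AddSubgroup.zmultiples (2 * Real.pi) :=
    AddEquiv.ofBijective
      ((zmultiplesHom (AddSubgroup.zmultiples (2 * Real.pi))) a) <| by
      constructor
      · intro m n hmn
        have := congrArg Subtype.val hmn
        simpa [a, h2π] using this
      · rintro ⟨x, n, rfl⟩
        exact ⟨n, Subtype.ext (by simp [a])⟩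
  have hf₂ : f₂.symm a = 1 := by
    rw [AddEquiv.symm_apply_eq]
    exact (one_zsmul a).symm
  -- The covering gives the opposite of the deck group, which is the same group by commutativity.
  have comm : ∀ x y : (Multiplicative (AddSubgroup.zmultiples (2 * Real.pi)))ᵐᵒᵖ,
      (x * y).unop = x.unop * y.unop := fun x y => mul_comm _ _
  let f₃ : (Multiplicative (AddSubgroup.zmultiples (2 * Real.pi)))ᵐᵒᵖ ≃*
      Multiplicative (AddSubgroup.zmultiples (2 * Real.pi)) :=
    { MulOpposite.opEquiv.symm with map_mul' := comm }
  refine ⟨(f₁.trans f₃).trans (AddEquiv.toMultiplicative f₂.symm), ?_⟩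
  change AddEquiv.toMultiplicative f₂.symm (f₃ (f₁ (loopClass circleLoop))) = _
  rw [hf₁]
  change Multiplicative.ofAdd (f₂.symm a) = _
  rw [hf₂]

theorem exists_zpow_circleLoop (p : FundamentalGroup Circle 1) :
    ∃ k : ℤ, p = loopClass circleLoop ^ k := by
  obtain ⟨f, hf⟩ := exists_circle_mulEquiv
  refine ⟨Multiplicative.toAdd (f p), f.injective ?_⟩
  rw [map_zpow, hf, ← ofAdd_zsmul]
  simp

/-! ### Block matrices -/

section Block

variable {R : Type*} [CommRing R] {k : ℕ}

/-- The block matrix with blocks `1` and `A`. -/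
def unitBlock (A : Matrix (Fin k) (Fin k) R) : Matrix (Fin (k + 1)) (Fin (k + 1)) R :=
  Matrix.of (Fin.cons (Fin.cons 1 0) fun i => Fin.cons 0 (A i))

@[simp] theorem unitBlock_zero_zero (A : Matrix (Fin k) (Fin k) R) : unitBlock A 0 0 = 1 := rfl
@[simp] theorem unitBlock_zero_succ (A : Matrix (Fin k) (Fin k) R) (j : Fin k) :
    unitBlock A 0 j.succ = 0 := rfl
@[simp] theorem unitBlock_succ_zero (A : Matrix (Fin k) (Fin k) R) (i : Fin k) :
    unitBlock A i.succ 0 = 0 := rfl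
@[simp] theorem unitBlock_succ_succ (A : Matrix (Fin k) (Fin k) R) (i j : Fin k) :
    unitBlock A i.succ j.succ = A i j := rfl

omit [CommRing R] in
theorem ext_fin_succ {M N : Matrix (Fin (k + 1)) (Fin (k + 1)) R} (h00 : M 0 0 = N 0 0)
    (h0 : ∀ j : Fin k, M 0 j.succ = N 0 j.succ) (h1 : ∀ i : Fin k, M i.succ 0 = N i.succ 0)
    (h : ∀ i j : Fin k, M i.succ j.succ = N i.succ j.succ) : M = N := by
  ext i j
  refine Fin.cases ?_ (fun i => ?_) i <;> refine Fin.cases ?_ (fun j => ?_) j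
  exacts [h00, h0 j, h1 i, h i j]

theorem unitBlock_one : unitBlock (1 : Matrix (Fin k) (Fin k) R) = 1 := by
  apply ext_fin_succ <;> simp [Matrix.one_apply, Fin.succ_ne_zero, (Fin.succ_ne_zero _).symm]

theorem unitBlock_mul (A B : Matrix (Fin k) (Fin k) R) :
    unitBlock (A * B) = unitBlock A * unitBlock B := by
  apply ext_fin_succ <;> simp [Matrix.mul_apply, Fin.sum_univ_succ]

theorem unitBlock_star [StarRing R] (A : Matrix (Fin k) (Fin k) R) :
    unitBlock (star A) = star (unitBlock A) := by
  apply ext_fin_succ <;> simp [Matrix.star_apply]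

theorem unitBlock_injective : Function.Injective (unitBlock (R := R) (k := k)) := by
  intro A B h
  ext i j
  exact congrFun (congrFun h i.succ) j.succ

theorem det_unitBlock (A : Matrix (Fin k) (Fin k) R) : (unitBlock A).det = A.det := by
  rw [det_succ_column_zero, Fin.sum_univ_succ]
  simp
  rfl

theorem unitBlock_mem_unitaryGroup [StarRing R] {A : Matrix (Fin k) (Fin k) R} :
    unitBlock A ∈ unitaryGroup (Fin (k + 1)) R ↔ A ∈ unitaryGroup (Fin k) R := by
  rw [mem_unitaryGroup_iff, mem_unitaryGroup_iff, ← unitBlock_star, ← unitBlock_mul,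
    ← unitBlock_one, unitBlock_injective.eq_iff]

theorem unitBlock_mulVec_cons (A : Matrix (Fin k) (Fin k) R) (a : R) (v : Fin k → R) :
    unitBlock A *ᵥ (Fin.cons a v : Fin (k + 1) → R) = Fin.cons a (A *ᵥ v) := by
  ext i
  refine Fin.cases ?_ (fun i => ?_) i <;> simp [mulVec, dotProduct, Fin.sum_univ_succ]

/-- The adjoint of a unitary matrix fixes the same vectors, so the first row is determined together
with the first column. -/
theorem exists_eq_unitBlock [StarRing R] {M : Matrix (Fin (k + 1)) (Fin (k + 1)) R}
    (hM : M ∈ unitaryGroup (Fin (k + 1)) R) (h : M *ᵥ Pi.single 0 1 = Pi.single 0 1) :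
    ∃ A, M = unitBlock A := by
  have hc (i) : M i 0 = (Pi.single 0 1 : Fin (k + 1) → R) i := by
    rw [← h, mulVec_single_one, col_apply]
  have h' : star M *ᵥ Pi.single 0 1 = Pi.single 0 1 := by
    conv_lhs => rw [← h]
    rw [mulVec_mulVec, mem_unitaryGroup_iff'.1 hM, one_mulVec]
  have hr (j) : M 0 j = star ((Pi.single 0 1 : Fin (k + 1) → R) j) := by
    rw [← h', mulVec_single_one, col_apply, star_apply, star_star]
  refine ⟨M.submatrix Fin.succ Fin.succ, ext_fin_succ ?_ ?_ ?_ ?_⟩ <;> simp [hc, hr]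

end Block
end

noncomputable section

open Topology unitInterval Matrix

/-! ### Block embeddings and fundamental groups, for unitary and orthogonal matrices at once -/

section BlockSurjective

variable {𝕜 : Type*} [RCLike 𝕜] {k : ℕ} {H G : Type*} [Group H] [TopologicalSpace H] [Group G]
  [TopologicalSpace G] [IsTopologicalGroup G]
  [MulAction G (sphere (0 : EuclideanSpace 𝕜 (Fin (k + 1))) 1)]

/-- The common argument for `U` and `SO`: `val` reads elements of `G` as matrices, `hrot` puts the
rotors in `G`, and `hrange` identifies the block matrices in `G` with `H`. -/
theorem mapOfEq_unitBlock_surjective (val : G →* Matrix (Fin (k + 1)) (Fin (k + 1)) 𝕜)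
    (hval : IsEmbedding val) (hU : ∀ g, val g ∈ unitaryGroup (Fin (k + 1)) 𝕜)
    (hrot : ∀ x y : Fin (k + 1) → 𝕜, star x ⬝ᵥ x = 1 → star y ⬝ᵥ y = 1 → 1 + star y ⬝ᵥ x ≠ 0 →
      ∃ g, val g = rotor x y)
    (hact : ∀ (g : G) (x : sphere (0 : EuclideanSpace 𝕜 (Fin (k + 1))) 1),
      (g • x).1.ofLp = val g *ᵥ x.1.ofLp)
    {x₀ : sphere (0 : EuclideanSpace 𝕜 (Fin (k + 1))) 1} (hx₀ : x₀.1.ofLp = Pi.single 0 1)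
    (hX : ∀ c : Path x₀ x₀, c.Homotopic (Path.refl x₀)) (j : H →* G) (hj : IsInducing j)
    (hinj : Function.Injective j) (hrange : ∀ g A, val g = unitBlock A → g ∈ Set.range j) :
    Function.Surjective
      (FundamentalGroup.mapOfEq (⟨j, hj.continuous⟩ : C(H, G)) (map_one j)) := by
  have hunit (x : sphere (0 : EuclideanSpace 𝕜 (Fin (k + 1))) 1) :
      star x.1.ofLp ⬝ᵥ x.1.ofLp = 1 := star_dotProduct_self_eq_one (norm_eq_of_mem_sphere x)
  have hne (x y : sphere (0 : EuclideanSpace 𝕜 (Fin (k + 1))) 1) (h : dist x y < 1) :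
      1 + star y.1.ofLp ⬝ᵥ x.1.ofLp ≠ 0 :=
    one_add_star_dotProduct_ne_zero (norm_eq_of_mem_sphere x) (norm_eq_of_mem_sphere y) h
  -- The rotors are used only for `dist x y < 1`; the value `1` elsewhere is a filler.
  have hex (x y : sphere (0 : EuclideanSpace 𝕜 (Fin (k + 1))) 1) :
      ∃ g : G, dist x y < 1 → val g = rotor x.1.ofLp y.1.ofLp := by
    by_cases h : dist x y < 1
    · obtain ⟨g, hg⟩ := hrot _ _ (hunit x) (hunit y) (hne x y h)
      exact ⟨g, fun _ => hg⟩
    · exact ⟨1, fun h' => absurd h' h⟩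
  choose R hR using hex
  refine mapOfEq_stabilizer_surjective one_pos R ?_ ?_ ?_ ?_ hX j hj hinj ?_
  · rw [hval.isInducing.continuousOn_iff]
    have h1 : ContinuousOn (fun p : sphere (0 : EuclideanSpace 𝕜 (Fin (k + 1))) 1 ×
        sphere (0 : EuclideanSpace 𝕜 (Fin (k + 1))) 1 => rotor p.1.1.ofLp p.2.1.ofLp)
        {p | dist p.1 p.2 < 1} := by
      refine continuousOn_rotor.comp
        (f := fun p : sphere (0 : EuclideanSpace 𝕜 (Fin (k + 1))) 1 ×
          sphere (0 : EuclideanSpace 𝕜 (Fin (k + 1))) 1 => (p.1.1.ofLp, p.2.1.ofLp)) ?_ ?_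
      · fun_prop
      · intro p hp
        exact hne p.1 p.2 hp
    exact h1.congr fun p hp => hR p.1 p.2 hp
  · intro x
    apply hval.injective
    rw [hR x x (by simp), rotor_self (hunit x), map_one]
  · intro x y h
    apply Subtype.ext
    apply (WithLp.equiv 2 _).injective
    change (R x y • x).1.ofLp = y.1.ofLp
    rw [hact, hR x y h, rotor_mulVec (hunit x) (hne x y h)]
  · refine Continuous.subtype_mk (f := fun g : G => (g • x₀).1) ?_ _
    have : (fun g : G => (g • x₀).1) = fun g => WithLp.toLp 2 (val g *ᵥ x₀.1.ofLp) := by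
      ext1 g
      rw [← hact]
    rw [this]
    have := hval.continuous
    fun_prop
  · intro g hg
    have h2 : val g *ᵥ Pi.single 0 1 = Pi.single 0 1 := by
      rw [← hx₀, ← hact, hg]
    obtain ⟨A, hA⟩ := exists_eq_unitBlock (hU g) h2
    exact hrange g A hA

end BlockSurjective

/-! ### The fundamental group of the unitary group -/

theorem unitaryGroup_isEmbedding_subtype (k : ℕ) :
    IsEmbedding ((unitaryGroup (Fin k) ℂ).subtype) := IsEmbedding.subtypeVal

theorem unitBlock_isInducing {R : Type*} [CommRing R] [TopologicalSpace R] {k : ℕ} :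
    IsInducing (unitBlock : Matrix (Fin k) (Fin k) R → _) := by
  have h1 : Continuous (unitBlock : Matrix (Fin k) (Fin k) R → _) := by
    refine continuous_matrix fun i j => ?_
    refine Fin.cases ?_ (fun i => ?_) i <;> refine Fin.cases ?_ (fun j => ?_) j
    · exact continuous_const
    · exact continuous_const
    · exact continuous_const
    · exact continuous_id.matrix_elem i j
  refine IsInducing.of_comp (g := fun M => M.submatrix Fin.succ Fin.succ) h1
    (continuous_id.matrix_submatrix _ _) ?_
  exact IsInducing.id

theorem blockEmb_isInducing (k : ℕ) : IsInducing (blockEmb k) := by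
  have h : IsInducing ((unitaryGroup (Fin (k + 1)) ℂ).subtype ∘ blockEmb k) :=
    unitBlock_isInducing.comp IsInducing.subtypeVal
  exact (IsInducing.subtypeVal.of_comp_iff).1 h

theorem blockEmb_injective (k : ℕ) : Function.Injective (blockEmb k) := by
  intro A B h
  exact Subtype.ext (unitBlock_injective (congrArg Subtype.val h))

theorem mem_range_blockEmb {k : ℕ} {g : U (k + 1)} {A : Matrix (Fin k) (Fin k) ℂ}
    (h : g.1 = unitBlock A) : g ∈ Set.range (blockEmb k) := by
  have hA : A ∈ unitaryGroup (Fin k) ℂ := unitBlock_mem_unitaryGroup.1 (h ▸ g.2)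
  exact ⟨⟨A, hA⟩, Subtype.ext h.symm⟩

theorem smul_ofLp {n : ℕ} (g : U (n + 1)) (x : CSphere n) : (g • x).1.ofLp = g.1 *ᵥ x.1.ofLp := rfl

/-- The condition `1 ≤ k` excludes the circle, the only sphere `S^(2k+1)` that is not simply
connected. -/
theorem mapOfEq_blockEmb_surjective {k : ℕ} (hk : 1 ≤ k) :
    Function.Surjective (FundamentalGroup.mapOfEq
      (⟨blockEmb k, (blockEmb_isInducing k).continuous⟩ : C(U k, U (k + 1)))
      (map_one (blockEmb k))) := by
  refine mapOfEq_unitBlock_surjective (unitaryGroup (Fin (k + 1)) ℂ).subtype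
    (unitaryGroup_isEmbedding_subtype _) (fun g => g.2) (fun x y hx hy h => ⟨⟨_, rotor_mem hx hy h⟩, rfl⟩)
    smul_ofLp (x₀ := basePt k) rfl ?_ _ (blockEmb_isInducing k) (blockEmb_injective k)
    (fun g A => mem_range_blockEmb)
  intro c
  refine sphere_path_homotopic_refl ?_ c
  rw [(CSpace.factFinrank k).out]
  omega

/-- The unitary matrix which multiplies the unit vector `w` by `z`, and fixes its complement. -/
def lineRot {k : ℕ} (w : Fin k → ℂ) (z : ℂ) : Matrix (Fin k) (Fin k) ℂ :=
  1 + (z - 1) • vecMulVec w (star w)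

/-- The matrix `vecMulVec w (star w)` is the projection to the line of `w`, hence idempotent. -/
theorem lineRot_mul {k : ℕ} {w : Fin k → ℂ} (hw : star w ⬝ᵥ w = 1) (z z' : ℂ) :
    lineRot w (z * z') = lineRot w z * lineRot w z' := by
  have h : vecMulVec w (star w) * vecMulVec w (star w) = vecMulVec w (star w) := by
    rw [vecMulVec_mul_vecMulVec, hw, one_smul]
  simp only [lineRot, mul_add, add_mul, one_mul, mul_one, smul_mul_smul, h]
  module

theorem lineRot_star {k : ℕ} (w : Fin k → ℂ) (z : ℂ) :
    star (lineRot w z) = lineRot w (star z) := by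
  rw [lineRot, star_add, star_one, star_smul, star_eq_conjTranspose, conjTranspose_vecMulVec,
    star_star, star_sub, star_one, lineRot]

theorem det_lineRot {k : ℕ} {w : Fin k → ℂ} (hw : star w ⬝ᵥ w = 1) (z : ℂ) :
    (lineRot w z).det = z := by
  -- At `z = 1` the inverse of `0` is `0`, and `inv_inv` still returns `1 - z`; no case distinction
  -- is needed.
  have : lineRot w z = unitaryReflection w (1 - z)⁻¹ := by
    rw [lineRot, unitaryReflection, inv_inv, sub_eq_add_neg 1 ((1 - z) • _), ← neg_smul, neg_sub]
  rw [this, det_unitaryReflection, hw]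
  simp

/-- The homomorphism `lineRot w` from the circle to the unitary group. -/
def lineRotHom {k : ℕ} (w : Fin k → ℂ) (hw : star w ⬝ᵥ w = 1) : Circle →* U k where
  toFun z := ⟨lineRot w z, by
    rw [mem_unitaryGroup_iff, lineRot_star, ← lineRot_mul hw, Circle.coe_mul_star_self]
    simp [lineRot]⟩
  map_one' := Subtype.ext (by simp [lineRot])
  map_mul' z z' := Subtype.ext (by simp [lineRot_mul hw])

theorem continuous_lineRotHom {k : ℕ} (w : Fin k → ℂ) (hw : star w ⬝ᵥ w = 1) :
    Continuous (lineRotHom w hw) := by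
  refine Continuous.subtype_mk (f := fun z : Circle => lineRot w z) ?_ _
  unfold lineRot
  fun_prop

theorem unitBlock_lineRot {k : ℕ} (w : Fin k → ℂ) (z : ℂ) :
    unitBlock (lineRot w z) = lineRot (Fin.cons 0 w) z := by
  apply ext_fin_succ <;>
    simp [lineRot, vecMulVec, Matrix.one_apply, Fin.succ_ne_zero, (Fin.succ_ne_zero _).symm]

theorem blockEmb_lineRotHom {k : ℕ} (w : Fin k → ℂ) (hw : star w ⬝ᵥ w = 1)
    (hw' : star (Fin.cons 0 w : Fin (k + 1) → ℂ) ⬝ᵥ (Fin.cons 0 w : Fin (k + 1) → ℂ) = 1)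
    (z : Circle) : blockEmb k (lineRotHom w hw z) = lineRotHom (Fin.cons 0 w) hw' z :=
  Subtype.ext (unitBlock_lineRot w z)

/-- Induction along the block embeddings from `U(1)`, which is the circle; extending `w` by a zero
coordinate is compatible with them. -/
theorem exists_mapOfEq_lineRotHom_surjective {n : ℕ} (hn : 1 ≤ n) :
    ∃ (w : Fin n → ℂ) (hw : star w ⬝ᵥ w = 1), Function.Surjective (FundamentalGroup.mapOfEq
      (⟨lineRotHom w hw, continuous_lineRotHom w hw⟩ : C(Circle, U n))
      (map_one (lineRotHom w hw))) := by
  induction n, hn using Nat.le_induction with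
  | base =>
    have hw : star (1 : Fin 1 → ℂ) ⬝ᵥ 1 = 1 := by simp
    refine ⟨1, hw, ?_⟩
    have hz (z : Circle) : (lineRotHom 1 hw z).1 0 0 = z := by
      simp [lineRotHom, lineRot, vecMulVec]
    have hbij : Function.Bijective (lineRotHom 1 hw) := by
      constructor
      · intro z z' h
        apply Circle.ext
        rw [← hz, ← hz, h]
      · intro g
        have h1 : g.1 0 0 * star (g.1 0 0) = 1 := by
          simpa [Matrix.mul_apply] using congrFun (congrFun (mem_unitaryGroup_iff.1 g.2) 0) 0
        refine ⟨circleOfMulStar (g.1 0 0) h1, ?_⟩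
        apply Subtype.ext
        ext i j
        rw [Subsingleton.elim i 0, Subsingleton.elim j 0]
        exact hz _
    let e : Circle ≃ₜ U 1 :=
      (continuous_lineRotHom 1 hw).homeoOfEquivCompactToT2 (f := Equiv.ofBijective _ hbij)
    exact (mapOfEq_bijective_of_homeomorph e (map_one (lineRotHom 1 hw))).2
  | succ k hk ih =>
    obtain ⟨w, hw, hs⟩ := ih
    have hw' : star (Fin.cons 0 w : Fin (k + 1) → ℂ) ⬝ᵥ (Fin.cons 0 w : Fin (k + 1) → ℂ) = 1 := by
      rw [← hw]
      simp [dotProduct, Fin.sum_univ_succ]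
    refine ⟨Fin.cons 0 w, hw', ?_⟩
    intro p
    obtain ⟨q, rfl⟩ := mapOfEq_blockEmb_surjective hk p
    obtain ⟨r, rfl⟩ := hs q
    refine ⟨r, ?_⟩
    rw [mapOfEq_mapOfEq _ _ _ _ (by simp)]
    exact mapOfEq_congr (fun z => (blockEmb_lineRotHom w hw hw' z).symm) _ _ r

/-- The determinant, as a map to the circle. -/
def detCircle (n : ℕ) : C(U n, Circle) where
  toFun A := circleOfMulStar A.1.det (Unitary.mem_iff.1 (det_of_mem_unitary A.2)).2
  continuous_toFun := by
    refine Continuous.subtype_mk ?_ _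
    exact (Continuous.matrix_det continuous_subtype_val)

/-- The determinant is a left inverse: `lineRot w z` has determinant `z`. -/
theorem mapOfEq_lineRotHom_injective {n : ℕ} (w : Fin n → ℂ) (hw : star w ⬝ᵥ w = 1) :
    Function.Injective (FundamentalGroup.mapOfEq
      (⟨lineRotHom w hw, continuous_lineRotHom w hw⟩ : C(Circle, U n))
      (map_one (lineRotHom w hw))) := by
  have h1 : detCircle n 1 = 1 := Circle.ext (det_one (n := Fin n) (R := ℂ))
  have h2 : ∀ z, ((detCircle n).comp
      ⟨lineRotHom w hw, continuous_lineRotHom w hw⟩) z = z :=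
    fun z => Circle.ext (det_lineRot hw z)
  apply Function.LeftInverse.injective (g := FundamentalGroup.mapOfEq (detCircle n) h1)
  intro p
  rw [mapOfEq_mapOfEq _ _ _ _ (h2 1)]
  exact mapOfEq_eq_self _ h2 _ p

theorem nonempty_fundamentalGroup_U_mulEquiv {n : ℕ} (hn : 1 ≤ n) :
    Nonempty (FundamentalGroup (U n) 1 ≃* Multiplicative ℤ) := by
  obtain ⟨w, hw, hs⟩ := exists_mapOfEq_lineRotHom_surjective hn
  obtain ⟨f, -⟩ := exists_circle_mulEquiv
  exact ⟨(MulEquiv.ofBijective _ ⟨mapOfEq_lineRotHom_injective w hw, hs⟩).symm.trans f⟩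
end

noncomputable section

open Topology unitInterval Matrix

/-! ### The fundamental group of the special orthogonal group: generators -/

/-- The vectors `u₁` and `u₂` are orthonormal for the dot product. -/
structure IsOrthonormalPair {ι : Type*} [Fintype ι] (u₁ u₂ : ι → ℝ) : Prop where
  fst : u₁ ⬝ᵥ u₁ = 1
  snd : u₂ ⬝ᵥ u₂ = 1
  ortho : u₁ ⬝ᵥ u₂ = 0

/-- The rotation by the complex number `z` in the plane spanned by `u₁` and `u₂`. -/
def planeRot {ι : Type*} [DecidableEq ι] (u₁ u₂ : ι → ℝ) (z : ℂ) : Matrix ι ι ℝ :=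
  1 + (z.re - 1) • (vecMulVec u₁ u₁ + vecMulVec u₂ u₂) +
    z.im • (vecMulVec u₂ u₁ - vecMulVec u₁ u₂)

section PlaneRot

variable {ι : Type*} [Fintype ι] [DecidableEq ι] {u₁ u₂ : ι → ℝ}

theorem planeRot_mul (h : IsOrthonormalPair u₁ u₂) (z z' : ℂ) :
    planeRot u₁ u₂ (z * z') = planeRot u₁ u₂ z * planeRot u₁ u₂ z' := by
  have h' : u₂ ⬝ᵥ u₁ = 0 := by rw [dotProduct_comm, h.ortho]
  simp only [planeRot, mul_add, add_mul, one_mul, mul_one, mul_sub, sub_mul, smul_mul_smul,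
    vecMulVec_mul_vecMulVec, h.fst, h.snd, h.ortho, h', one_smul, zero_smul, vecMulVec_zero,
    Complex.mul_re, Complex.mul_im, smul_add, smul_sub, smul_zero]
  module

omit [Fintype ι] in
theorem planeRot_one (u₁ u₂ : ι → ℝ) : planeRot u₁ u₂ 1 = 1 := by
  simp [planeRot]

theorem planeRot_star (u₁ u₂ : ι → ℝ) (z : ℂ) :
    star (planeRot u₁ u₂ z) = planeRot u₁ u₂ (star z) := by
  simp only [planeRot, star_add, star_sub, star_one, star_smul, star_eq_conjTranspose,
    conjTranspose_vecMulVec, star_trivial, Complex.star_def, Complex.conj_re, Complex.conj_im]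
  module

-- Reversing the orientation of the plane conjugates the angle.
omit [Fintype ι] in
theorem planeRot_neg_right (u₁ u₂ : ι → ℝ) (z : ℂ) :
    planeRot u₁ (-u₂) z = planeRot u₁ u₂ (star z) := by
  simp only [planeRot, neg_vecMulVec, vecMulVec_neg, Complex.star_def, Complex.conj_re,
    Complex.conj_im]
  module

theorem planeRot_mem (h : IsOrthonormalPair u₁ u₂) (z : Circle) :
    planeRot u₁ u₂ z ∈ specialOrthogonalGroup ι ℝ := by
  have hO (z : Circle) : planeRot u₁ u₂ z ∈ orthogonalGroup ι ℝ := by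
    rw [mem_orthogonalGroup_iff]
    change planeRot u₁ u₂ z * star (planeRot u₁ u₂ z) = 1
    rw [planeRot_star, ← planeRot_mul h, Circle.coe_mul_star_self, planeRot_one]
  rw [mem_specialOrthogonalGroup_iff]
  refine ⟨hO z, ?_⟩
  obtain ⟨t, rfl⟩ := Circle.exp_surjective z
  -- The rotation by half the angle is a square root within the orthogonal matrices, so the
  -- determinant is the square of `1` or `-1`.
  have h2 : planeRot u₁ u₂ (Circle.exp t) =
      planeRot u₁ u₂ (Circle.exp (t / 2)) * planeRot u₁ u₂ (Circle.exp (t / 2)) := by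
    rw [← planeRot_mul h, ← Circle.coe_mul, ← Circle.exp_add, add_halves]
  rw [h2, det_mul]
  exact (Unitary.mem_iff.1 (det_of_mem_unitary (hO _))).1

/-- The homomorphism `planeRot u₁ u₂` from the circle to the special orthogonal group. -/
def planeRotHom {m : ℕ} {u₁ u₂ : Fin m → ℝ} (h : IsOrthonormalPair u₁ u₂) : Circle →* SO m where
  toFun z := ⟨planeRot u₁ u₂ z, planeRot_mem h z⟩
  map_one' := Subtype.ext (by simp [planeRot_one])
  map_mul' z z' := Subtype.ext (by simp [planeRot_mul h])

theorem continuous_planeRotHom {m : ℕ} {u₁ u₂ : Fin m → ℝ} (h : IsOrthonormalPair u₁ u₂) :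
    Continuous (planeRotHom h) := by
  refine Continuous.subtype_mk (f := fun z : Circle => planeRot u₁ u₂ z) ?_ _
  unfold planeRot
  fun_prop

theorem mul_planeRot_mul_transpose (g : Matrix ι ι ℝ) (hg : g * gᵀ = 1) (u₁ u₂ : ι → ℝ) (z : ℂ) :
    g * planeRot u₁ u₂ z * gᵀ = planeRot (g *ᵥ u₁) (g *ᵥ u₂) z := by
  have h (a b : ι → ℝ) : g * vecMulVec a b * gᵀ = vecMulVec (g *ᵥ a) (g *ᵥ b) := by
    rw [mul_vecMulVec, vecMulVec_mul, vecMul_transpose]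
  simp only [planeRot, mul_add, add_mul, mul_sub, sub_mul, mul_smul_comm, smul_mul_assoc, h,
    mul_one, hg]

theorem planeRot_mulVec (u₁ u₂ : ι → ℝ) (z : ℂ) (w : ι → ℝ) :
    planeRot u₁ u₂ z *ᵥ w = w + (z.re - 1) • ((u₁ ⬝ᵥ w) • u₁ + (u₂ ⬝ᵥ w) • u₂) +
      z.im • ((u₁ ⬝ᵥ w) • u₂ - (u₂ ⬝ᵥ w) • u₁) := by
  simp [planeRot, add_mulVec, sub_mulVec, smul_mulVec, vecMulVec_mulVec]

end PlaneRot

/-- `SO(k+1)` acts on `S^k` by multiplication of column vectors by matrices. -/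
instance SO.instMulAction (k : ℕ) :
    MulAction (SO (k + 1)) (sphere (0 : EuclideanSpace ℝ (Fin (k + 1))) 1) where
  smul g x := ⟨WithLp.toLp 2 (g.1 *ᵥ x.1.ofLp), by
    have h1 : star x.1.ofLp ⬝ᵥ x.1.ofLp = 1 :=
      star_dotProduct_self_eq_one (norm_eq_of_mem_sphere x)
    rw [star_trivial] at h1
    have h2 : g.1ᵀ * g.1 = 1 := (mem_orthogonalGroup_iff' (Fin (k + 1)) ℝ).1
      (mem_specialOrthogonalGroup_iff.1 g.2).1
    have h3 : (g.1 *ᵥ x.1.ofLp) ⬝ᵥ (g.1 *ᵥ x.1.ofLp) = 1 := by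
      rw [dotProduct_mulVec, ← mulVec_transpose, mulVec_mulVec, h2, one_mulVec, h1]
    rw [mem_sphere_zero_iff_norm, EuclideanSpace.norm_eq, Real.sqrt_eq_one]
    refine Eq.trans ?_ h3
    simp [dotProduct, sq]⟩
  one_smul x := Subtype.ext (congrArg (WithLp.toLp 2) (one_mulVec x.1.ofLp))
  mul_smul g h x := Subtype.ext
    (congrArg (WithLp.toLp 2) (mulVec_mulVec x.1.ofLp g.1 h.1).symm)

theorem unitBlock_mem_specialOrthogonalGroup {k : ℕ} {A : Matrix (Fin k) (Fin k) ℝ} :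
    unitBlock A ∈ specialOrthogonalGroup (Fin (k + 1)) ℝ ↔ A ∈ specialOrthogonalGroup (Fin k) ℝ := by
  rw [mem_specialOrthogonalGroup_iff, mem_specialOrthogonalGroup_iff, det_unitBlock]
  exact and_congr_left' unitBlock_mem_unitaryGroup

/-- The embedding of `SO(k)` in `SO(k+1)` as the block matrices with blocks `1` and `A`. -/
def blockSO (k : ℕ) : SO k →* SO (k + 1) where
  toFun A := ⟨unitBlock A.1, unitBlock_mem_specialOrthogonalGroup.2 A.2⟩
  map_one' := Subtype.ext unitBlock_one
  map_mul' A B := Subtype.ext (unitBlock_mul A.1 B.1)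

theorem blockSO_isInducing (k : ℕ) : IsInducing (blockSO k) := by
  have h : IsInducing ((specialOrthogonalGroup (Fin (k + 1)) ℝ).subtype ∘ blockSO k) :=
    unitBlock_isInducing.comp IsInducing.subtypeVal
  exact (IsInducing.subtypeVal.of_comp_iff).1 h

theorem blockSO_injective (k : ℕ) : Function.Injective (blockSO k) := by
  intro A B h
  exact Subtype.ext (unitBlock_injective (congrArg Subtype.val h))

theorem mem_range_blockSO {k : ℕ} {g : SO (k + 1)} {A : Matrix (Fin k) (Fin k) ℝ}
    (h : g.1 = unitBlock A) : g ∈ Set.range (blockSO k) :=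
  ⟨⟨A, unitBlock_mem_specialOrthogonalGroup.1 (h ▸ g.2)⟩, Subtype.ext h.symm⟩

theorem rotor_mem_specialOrthogonalGroup {ι : Type*} [Fintype ι] [DecidableEq ι] {x y : ι → ℝ}
    (hx : star x ⬝ᵥ x = 1) (hy : star y ⬝ᵥ y = 1) (h : 1 + star y ⬝ᵥ x ≠ 0) :
    rotor x y ∈ specialOrthogonalGroup ι ℝ :=
  mem_specialOrthogonalGroup_iff.2 ⟨rotor_mem hx hy h, det_rotor hx hy h⟩

/-- The condition `2 ≤ k` makes `S^k` simply connected. -/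
theorem mapOfEq_blockSO_surjective {k : ℕ} (hk : 2 ≤ k) :
    Function.Surjective (FundamentalGroup.mapOfEq
      (⟨blockSO k, (blockSO_isInducing k).continuous⟩ : C(SO k, SO (k + 1)))
      (map_one (blockSO k))) := by
  refine mapOfEq_unitBlock_surjective (specialOrthogonalGroup (Fin (k + 1)) ℝ).subtype
    IsEmbedding.subtypeVal (fun g => (mem_specialOrthogonalGroup_iff.1 g.2).1)
    (fun x y hx hy h => ⟨⟨_, rotor_mem_specialOrthogonalGroup hx hy h⟩, rfl⟩)
    (fun g x => rfl) (x₀ := ⟨EuclideanSpace.single 0 1, by simp⟩) rfl ?_ _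
    (blockSO_isInducing k) (blockSO_injective k) (fun g A => mem_range_blockSO)
  intro c
  refine sphere_path_homotopic_refl ?_ c
  rw [finrank_euclideanSpace_fin]
  omega

theorem IsOrthonormalPair.cons {k : ℕ} {u₁ u₂ : Fin k → ℝ} (h : IsOrthonormalPair u₁ u₂) :
    IsOrthonormalPair (Fin.cons 0 u₁ : Fin (k + 1) → ℝ) (Fin.cons 0 u₂) where
  fst := by rw [← h.fst]; simp [dotProduct, Fin.sum_univ_succ]
  snd := by rw [← h.snd]; simp [dotProduct, Fin.sum_univ_succ]
  ortho := by
    refine Eq.trans ?_ h.ortho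
    simp [dotProduct, Fin.sum_univ_succ]

theorem unitBlock_planeRot {k : ℕ} (u₁ u₂ : Fin k → ℝ) (z : ℂ) :
    unitBlock (planeRot u₁ u₂ z) = planeRot (Fin.cons 0 u₁) (Fin.cons 0 u₂) z := by
  apply ext_fin_succ <;>
    simp [planeRot, vecMulVec, Matrix.one_apply, Fin.succ_ne_zero, (Fin.succ_ne_zero _).symm]

/-- Induction along the block embeddings from `SO(2)`, which is the circle. -/
theorem exists_mapOfEq_planeRotHom_surjective {m : ℕ} (hm : 2 ≤ m) :
    ∃ (u₁ u₂ : Fin m → ℝ) (h : IsOrthonormalPair u₁ u₂),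
      Function.Surjective (FundamentalGroup.mapOfEq
        (⟨planeRotHom h, continuous_planeRotHom h⟩ : C(Circle, SO m)) (map_one (planeRotHom h))) := by
  induction m, hm using Nat.le_induction with
  | base =>
    have h : IsOrthonormalPair (Pi.single 0 1 : Fin 2 → ℝ) (Pi.single 1 1) := by
      constructor <;> simp
    refine ⟨_, _, h, ?_⟩
    have hz (z : Circle) : (planeRotHom h z).1 = !![z.1.re, -z.1.im; z.1.im, z.1.re] := by
      ext i j
      fin_cases i <;> fin_cases j <;> simp [planeRotHom, planeRot, vecMulVec]
    have hbij : Function.Bijective (planeRotHom h) := by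
      constructor
      · intro z z' h'
        have h2 := congrArg Subtype.val h'
        rw [hz, hz] at h2
        apply Circle.ext
        apply Complex.ext
        · exact congrFun (congrFun h2 0) 0
        · exact congrFun (congrFun h2 1) 0
      · intro g
        obtain ⟨h1, h2, h3⟩ := mem_specialOrthogonalGroup_fin_two_iff.1 g.2
        refine ⟨circleOfMulStar ⟨g.1 0 0, g.1 1 0⟩ ?_, ?_⟩
        · apply Complex.ext
          · simp
            rw [← h3, h2]
            ring
          · simp
            ring
        · apply Subtype.ext
          rw [hz]
          ext i j
          change !![g.1 0 0, -g.1 1 0; g.1 1 0, g.1 0 0] i j = g.1 i j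
          fin_cases i <;> fin_cases j <;> simp [h1, h2]
    let e : Circle ≃ₜ SO 2 :=
      (continuous_planeRotHom h).homeoOfEquivCompactToT2 (f := Equiv.ofBijective _ hbij)
    exact (mapOfEq_bijective_of_homeomorph e (map_one (planeRotHom h))).2
  | succ k hk ih =>
    obtain ⟨u₁, u₂, h, hs⟩ := ih
    refine ⟨_, _, h.cons, ?_⟩
    intro p
    obtain ⟨q, rfl⟩ := mapOfEq_blockSO_surjective hk p
    obtain ⟨r, rfl⟩ := hs q
    refine ⟨r, ?_⟩
    rw [mapOfEq_mapOfEq _ _ _ _ (by simp)]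
    exact mapOfEq_congr (fun z : Circle => Subtype.ext (unitBlock_planeRot u₁ u₂ z).symm) _ _ r

/-- The rotations in a plane, as a loop. -/
def planeRotLoop {m : ℕ} {u₁ u₂ : Fin m → ℝ} (h : IsOrthonormalPair u₁ u₂) : Path (1 : SO m) 1 :=
  (circleLoop.map (continuous_planeRotHom h)).cast (map_one _).symm (map_one _).symm

/-- A third direction allows the plane to be turned over: conjugation by the half turn in the plane
of `u₂` and `u₃` fixes `u₁` and reverses `u₂`, so it inverts the loop, and this half turn is joined
to `1` by rotations. -/
theorem sq_loopClass_planeRotLoop {m : ℕ} {u₁ u₂ u₃ : Fin m → ℝ} (h : IsOrthonormalPair u₁ u₂)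
    (h' : IsOrthonormalPair u₂ u₃) (h13 : u₁ ⬝ᵥ u₃ = 0) :
    loopClass (planeRotLoop h) ^ 2 = 1 := by
  have hsymm : (planeRotLoop h).Homotopic (planeRotLoop h).symm := by
    refine Path.Homotopic.of_continuous (fun st => planeRotHom h' (Circle.exp (Real.pi * st.1)) *
      planeRotLoop h st.2 * (planeRotHom h' (Circle.exp (Real.pi * st.1)))⁻¹) ?_ ?_ ?_ ?_ ?_
    · have := continuous_planeRotHom h'
      fun_prop
    · intro t
      simp
    · intro t
      apply Subtype.ext
      have hg := (planeRotHom h' (Circle.exp (Real.pi * (1 : I)))).2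
      set g := planeRotHom h' (Circle.exp (Real.pi * (1 : I))) with hgdef
      have hgv : g.1 = planeRot u₂ u₃ (-1) := by
        simp [hgdef, planeRotHom]
      change g.1 * planeRot u₁ u₂ (Circle.exp (2 * Real.pi * t)) * g.1ᵀ =
        planeRot u₁ u₂ (Circle.exp (2 * Real.pi * (1 - t)))
      rw [mul_planeRot_mul_transpose _ ((mem_orthogonalGroup_iff (Fin m) ℝ).1
        (mem_specialOrthogonalGroup_iff.1 hg).1), hgv]
      have e1 : planeRot u₂ u₃ (-1) *ᵥ u₁ = u₁ := by
        rw [planeRot_mulVec, dotProduct_comm u₂, dotProduct_comm u₃, h.ortho, h13]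
        simp
      have e2 : planeRot u₂ u₃ (-1) *ᵥ u₂ = -u₂ := by
        rw [planeRot_mulVec, dotProduct_comm u₃, h'.fst, h'.ortho]
        simp
        module
      rw [e1, e2, planeRot_neg_right]
      congr 1
      have e3 : 2 * Real.pi * (1 - (t : ℝ)) = 2 * Real.pi - 2 * Real.pi * t := by ring
      rw [e3, Circle.exp_sub, Circle.exp_two_pi, one_div, Circle.coe_inv_eq_conj]
      rfl
    · intro s
      simp
    · intro s
      simp
  have := loopClass_eq_iff.2 hsymm
  rw [loopClass_symm] at this
  rw [sq]
  nth_rewrite 1 [this]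
  exact inv_mul_cancel _

/-- The fundamental group of `SO(m)` is generated by an element of order at most two. -/
theorem exists_planeRotLoop_generator {m : ℕ} (hm : 3 ≤ m) :
    ∃ (u₁ u₂ : Fin m → ℝ) (h : IsOrthonormalPair u₁ u₂), loopClass (planeRotLoop h) ^ 2 = 1 ∧
      ∀ p : FundamentalGroup (SO m) 1, p = 1 ∨ p = loopClass (planeRotLoop h) := by
  obtain ⟨k, rfl⟩ : ∃ k, m = k + 1 := ⟨m - 1, by omega⟩
  obtain ⟨u₁, u₂, h, hs⟩ := exists_mapOfEq_planeRotHom_surjective (m := k) (by omega)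
  have h2 : loopClass (planeRotLoop h.cons) ^ 2 = 1 := by
    -- The new coordinate vector is orthogonal to the plane, which lies in the other `k`
    -- coordinates.
    refine sq_loopClass_planeRotLoop (u₃ := Pi.single 0 1) h.cons ⟨h.cons.snd, by simp, by simp⟩ ?_
    simp
  refine ⟨_, _, h.cons, h2, fun p => ?_⟩
  obtain ⟨q, rfl⟩ := mapOfEq_blockSO_surjective (k := k) (by omega) p
  obtain ⟨r, rfl⟩ := hs q
  obtain ⟨i, rfl⟩ := exists_zpow_circleLoop r
  rw [mapOfEq_mapOfEq _ _ _ _ (by simp),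
    mapOfEq_congr (g := ⟨planeRotHom h.cons, continuous_planeRotHom h.cons⟩)
      (fun z => Subtype.ext (unitBlock_planeRot u₁ u₂ z)) _ (map_one (planeRotHom h.cons)),
    map_zpow, mapOfEq_loopClass]
  suffices hi : loopClass (planeRotLoop h.cons) ^ i = 1 ∨
      loopClass (planeRotLoop h.cons) ^ i = loopClass (planeRotLoop h.cons) from hi
  obtain ⟨j, rfl | rfl⟩ := Int.even_or_odd' i
  · left
    rw [_root_.zpow_mul]
    norm_cast
    rw [h2, _root_.one_zpow]
  · right
    rw [_root_.zpow_add, _root_.zpow_mul, zpow_one]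
    norm_cast
    rw [h2, _root_.one_zpow, one_mul]
end

noncomputable section

open Matrix CliffordAlgebra

/-! ### Vectors in the Clifford algebra -/

/-! ### Contractions, and the scalars as their common kernel -/

section Contraction

variable {M : Type*} [AddCommGroup M] [Module ℝ M] (Q : QuadraticForm ℝ M)

/-- Contraction is a graded commutator with a vector. Even elements that commute with all vectors
are thus annihilated by these contractions. -/
theorem contractLeft_polarBilin (v : M) (x : CliffordAlgebra Q) :
    contractLeft (Q.polarBilin v) x = ι Q v * x - involute x * ι Q v := by
  induction x using CliffordAlgebra.left_induction with
  | algebraMap r => simp [Algebra.commutes]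
  | add x y hx hy =>
    rw [map_add, hx, hy, map_add]
    noncomm_ring
  | ι_mul x w hx =>
    rw [contractLeft_ι_mul, hx, map_mul, involute_ι, mul_sub, ← mul_assoc (ι Q v),
      ← sub_eq_iff_eq_add.2 (ι_mul_ι_add_swap (Q := Q) v w).symm, sub_mul, Algebra.smul_def,
      QuadraticMap.polarBilin_apply_apply]
    noncomm_ring

/-- The Euler operator of the exterior algebra multiplies the elements of degree `n` by `n`. -/
theorem sum_ι_mul_contractLeft {κ : Type*} [Fintype κ] (b : Basis κ ℝ M) (n : ℕ)
    (x : ExteriorAlgebra ℝ M) (hx : x ∈ ⋀[ℝ]^n M) :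
    ∑ i, ExteriorAlgebra.ι ℝ (b i) * contractLeft (Q := 0) (b.coord i) x = n • x := by
  induction hx using Submodule.pow_induction_on_left' with
  | algebraMap r => simp
  | add x y i hx hy h h' => simp only [map_add, mul_add, Finset.sum_add_distrib, h, h', nsmul_add]
  | mem_mul w hw i x hx h =>
    obtain ⟨w, rfl⟩ := hw
    have e (i) : ExteriorAlgebra.ι ℝ (b i) * contractLeft (Q := 0) (b.coord i)
        (ExteriorAlgebra.ι ℝ w * x) = (b.repr w i • ExteriorAlgebra.ι ℝ (b i)) * x +
          ExteriorAlgebra.ι ℝ w *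
            (ExteriorAlgebra.ι ℝ (b i) * contractLeft (Q := 0) (b.coord i) x) := by
      have h1 : ExteriorAlgebra.ι ℝ (b i) * ExteriorAlgebra.ι ℝ w =
          -(ExteriorAlgebra.ι ℝ w * ExteriorAlgebra.ι ℝ (b i)) :=
        eq_neg_of_add_eq_zero_left (ExteriorAlgebra.ι_add_mul_swap _ _)
      have h2 : contractLeft (Q := 0) (b.coord i) (ExteriorAlgebra.ι ℝ w * x) =
          b.coord i w • x - ExteriorAlgebra.ι ℝ w * contractLeft (Q := 0) (b.coord i) x :=
        contractLeft_ι_mul _ _ _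
      rw [h2, mul_sub, ← mul_assoc, h1]
      simp [mul_assoc]
    rw [Finset.sum_congr rfl fun i _ => e i, Finset.sum_add_distrib, ← Finset.sum_mul,
      ← Finset.mul_sum, h]
    simp_rw [← map_smul]
    rw [← map_sum, b.sum_repr, succ_nsmul, mul_smul_comm, add_comm]

/-- The Euler operator is built from contractions, so it kills `x`; since it multiplies degree `j`
by `j`, only degree zero survives. -/
theorem exteriorAlgebra_eq_algebraMap_of_contractLeft_eq_zero [FiniteDimensional ℝ M]
    (x : ExteriorAlgebra ℝ M) (hx : ∀ d, contractLeft (Q := 0) d x = 0) :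
    ∃ r, x = algebraMap ℝ _ r := by
  classical
  let b := Module.finBasis ℝ M
  let 𝒜 : ℕ → Submodule ℝ (ExteriorAlgebra ℝ M) := fun n => ⋀[ℝ]^n M
  let N : ExteriorAlgebra ℝ M →ₗ[ℝ] ExteriorAlgebra ℝ M :=
    ∑ i, LinearMap.mulLeft ℝ (ExteriorAlgebra.ι ℝ (b i)) ∘ₗ contractLeft (Q := 0) (b.coord i)
  have hN (n : ℕ) (y) (hy : y ∈ 𝒜 n) : N y = n • y := by
    rw [← sum_ι_mul_contractLeft b n y hy]
    simp [N]
  have key (y : ExteriorAlgebra ℝ M) (j : ℕ) :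
      (DirectSum.decompose 𝒜 (N y) j : ExteriorAlgebra ℝ M) = j • (DirectSum.decompose 𝒜 y j : ExteriorAlgebra ℝ M) := by
    induction y using DirectSum.Decomposition.inductionOn 𝒜 with
    | zero => simp
    | homogeneous y =>
      rename_i i
      rw [hN i y y.2]
      by_cases hij : i = j
      · subst hij
        rw [DirectSum.decompose_of_mem_same 𝒜 y.2,
          DirectSum.decompose_of_mem_same 𝒜 ((𝒜 i).smul_of_tower_mem i y.2)]
      · rw [DirectSum.decompose_of_mem_ne 𝒜 y.2 hij,
          DirectSum.decompose_of_mem_ne 𝒜 ((𝒜 i).smul_of_tower_mem i y.2) hij, smul_zero]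
    | add y z hy hz => simp [DirectSum.decompose_add, hy, hz]
  have hNx : N x = 0 := by simp [N, hx]
  have h0 (j : ℕ) (hj : j ≠ 0) : (DirectSum.decompose 𝒜 x j : ExteriorAlgebra ℝ M) = 0 := by
    have := key x j
    rw [hNx, DirectSum.decompose_zero, DirectSum.zero_apply, Submodule.coe_zero,
      ← Nat.cast_smul_eq_nsmul ℝ] at this
    exact (smul_eq_zero.1 this.symm).resolve_left (Nat.cast_ne_zero.2 hj)
  have h1 : x ∈ 𝒜 0 := by
    rw [← DirectSum.sum_support_decompose 𝒜 x]
    refine Submodule.sum_mem _ fun j hj => ?_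
    by_cases hj0 : j = 0
    · subst hj0
      exact Submodule.coe_mem _
    · rw [h0 j hj0]
      exact Submodule.zero_mem _
  have h2 : x ∈ (1 : Submodule ℝ (ExteriorAlgebra ℝ M)) := by simpa [𝒜] using h1
  obtain ⟨r, hr⟩ := Submodule.mem_one.1 h2
  exact ⟨r, hr.symm⟩

/-- The linear equivalence with the exterior algebra commutes with contractions and fixes scalars.
-/
theorem eq_algebraMap_of_contractLeft_eq_zero [FiniteDimensional ℝ M] (x : CliffordAlgebra Q)
    (hx : ∀ d, contractLeft d x = 0) : ∃ r, x = algebraMap ℝ _ r := by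
  have : Invertible (2 : ℝ) := invertibleOfNonzero two_ne_zero
  obtain ⟨r, hr⟩ := exteriorAlgebra_eq_algebraMap_of_contractLeft_eq_zero (equivExterior Q x)
    fun d => by
      change contractLeft d (changeForm changeForm.associated_neg_proof x) = 0
      rw [← changeForm_contractLeft, hx, map_zero]
  refine ⟨r, (equivExterior Q).injective ?_⟩
  rw [hr]
  exact (changeForm_algebraMap changeForm.associated_neg_proof r).symm

theorem ι_injective : Function.Injective (ι Q) := by
  have : Invertible (2 : ℝ) := invertibleOfNonzero two_ne_zero
  intro v w h
  have h' := congrArg (equivExterior Q) h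
  have e (v : M) : equivExterior Q (ι Q v) = ExteriorAlgebra.ι ℝ v :=
    changeForm_ι changeForm.associated_neg_proof v
  rw [e, e] at h'
  exact (ExteriorAlgebra.ι_inj ℝ v w).1 h'

end Contraction

/-! ### The homomorphism from `Spin(m)` to `SO(m)` and its kernel -/

section Spin

variable {m : ℕ}

instance : Nontrivial (CliffordAlgebra (cliffordForm m)) :=
  have : Invertible (2 : ℝ) := invertibleOfNonzero two_ne_zero
  inferInstance

theorem cliffordForm_apply (v : Fin m → ℝ) : cliffordForm m v = -(v ⬝ᵥ v) := by
  simp [QuadraticMap.weightedSumSquares_apply, dotProduct]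

theorem polar_cliffordForm (v w : Fin m → ℝ) :
    QuadraticMap.polar (cliffordForm m) v w = -2 * (v ⬝ᵥ w) := by
  simp only [QuadraticMap.polar, cliffordForm_apply, add_dotProduct, dotProduct_add]
  rw [dotProduct_comm w v]
  ring

theorem ι_mul_self (v : Fin m → ℝ) :
    ι (cliffordForm m) v * ι (cliffordForm m) v = algebraMap ℝ _ (-(v ⬝ᵥ v)) := by
  rw [ι_sq_scalar, cliffordForm_apply]

theorem ι_mul_ι_swap (v w : Fin m → ℝ) :
    ι (cliffordForm m) v * ι (cliffordForm m) w =
      algebraMap ℝ _ (-2 * (v ⬝ᵥ w)) - ι (cliffordForm m) w * ι (cliffordForm m) v := by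
  rw [eq_sub_iff_add_eq, ι_mul_ι_add_swap, polar_cliffordForm]

/-- Every element of the Lipschitz group acts on the vectors by an orthogonal matrix, whose
determinant gives the parity of the element. -/
theorem exists_matrix_of_mem_lipschitzGroup {x : (CliffordAlgebra (cliffordForm m))ˣ}
    (hx : x ∈ lipschitzGroup (cliffordForm m)) :
    ∃ A ∈ orthogonalGroup (Fin m) ℝ,
      (∀ v, involute (x : CliffordAlgebra (cliffordForm m)) * ι (cliffordForm m) v =
        ι (cliffordForm m) (A *ᵥ v) * x) ∧
      involute (x : CliffordAlgebra (cliffordForm m)) = A.det • (x : CliffordAlgebra _) := by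
  unfold lipschitzGroup at hx
  induction hx using Subgroup.closure_induction with
  | mem x hx =>
    obtain ⟨a, ha⟩ := hx
    have ha0 : a ⬝ᵥ a ≠ 0 := by
      intro h0
      have h1 : (x : CliffordAlgebra (cliffordForm m)) * x = 0 := by
        rw [← ha, ι_mul_self, h0]
        simp
      exact (x * x).ne_zero (by simp at h1)
    have hc : (a ⬝ᵥ a) / 2 ≠ 0 := by simpa using ha0
    -- Twisted conjugation by a vector `a` is the reflection in its orthogonal hyperplane. The
    -- constant is half of `a ⬝ᵥ a`, and the determinant `-1` records that `a` is odd.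
    refine ⟨unitaryReflection a ((a ⬝ᵥ a) / 2), unitaryReflection_mem _ hc ?_, fun v => ?_, ?_⟩
    · rw [star_trivial, star_trivial]
      ring
    · rw [← ha, involute_ι, unitaryReflection_mulVec, map_sub, map_smul, sub_mul, smul_mul_assoc,
        ι_mul_self, neg_mul, ι_mul_ι_swap a v, star_trivial, Algebra.smul_def, ← map_mul (algebraMap ℝ _)]
      have : ((a ⬝ᵥ a) / 2)⁻¹ * (a ⬝ᵥ v) * -(a ⬝ᵥ a) = -2 * (a ⬝ᵥ v) := by
        field_simp
      rw [this]
      abel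
    · rw [← ha, involute_ι, det_unitaryReflection, star_trivial]
      have : 1 - ((a ⬝ᵥ a) / 2)⁻¹ * (a ⬝ᵥ a) = -1 := by
        field_simp
        ring
      rw [this, neg_one_smul]
  | one => exact ⟨1, one_mem _, by simp, by simp⟩
  | mul x y _ _ hx hy =>
    obtain ⟨A, hA, h1, h2⟩ := hx
    obtain ⟨B, hB, h3, h4⟩ := hy
    refine ⟨A * B, mul_mem hA hB, fun v => ?_, ?_⟩
    · rw [Units.val_mul, map_mul, mul_assoc, h3, ← mul_assoc, h1, mulVec_mulVec, mul_assoc]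
    · rw [Units.val_mul, map_mul, h2, h4, smul_mul_smul, det_mul]
  | inv x _ hx =>
    obtain ⟨A, hA, h1, h2⟩ := hx
    have hdet : A.det * A.det = 1 := (Unitary.mem_iff.1 (det_of_mem_unitary hA)).1
    have hinv : involute ((x⁻¹ : (CliffordAlgebra (cliffordForm m))ˣ) : CliffordAlgebra (cliffordForm m)) *
        involute (x : CliffordAlgebra (cliffordForm m)) = 1 := by
      rw [← map_mul, Units.inv_mul, map_one]
    refine ⟨star A, Unitary.star_mem hA, fun v => ?_, ?_⟩
    · have h3 := h1 (star A *ᵥ v)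
      rw [mulVec_mulVec, mem_unitaryGroup_iff.1 hA, one_mulVec] at h3
      have h4 := congrArg (fun y => involute ((x⁻¹ : (CliffordAlgebra (cliffordForm m))ˣ) :
        CliffordAlgebra (cliffordForm m)) * y * ((x⁻¹ : (CliffordAlgebra (cliffordForm m))ˣ) :
        CliffordAlgebra (cliffordForm m))) h3
      rw [← mul_assoc, hinv, one_mul, mul_assoc, mul_assoc, Units.mul_inv, mul_one] at h4
      exact h4.symm
    · have h3 : (x : CliffordAlgebra (cliffordForm m)) = A.det • involute (x : CliffordAlgebra _) := by
        rw [h2, smul_smul, hdet, one_smul]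
      have h4 : (star A).det = A.det := by
        rw [star_eq_conjTranspose, det_conjTranspose, star_trivial]
      rw [h4]
      refine Eq.trans (b := involute ((x⁻¹ : (CliffordAlgebra (cliffordForm m))ˣ) : CliffordAlgebra (cliffordForm m)) *
            ((x : CliffordAlgebra (cliffordForm m)) * ((x⁻¹ : (CliffordAlgebra (cliffordForm m))ˣ) :
              CliffordAlgebra (cliffordForm m)))) (by rw [Units.mul_inv, mul_one]) ?_
      refine (congrArg (fun y => involute ((x⁻¹ : (CliffordAlgebra (cliffordForm m))ˣ) :
        CliffordAlgebra (cliffordForm m)) * (y * ((x⁻¹ : (CliffordAlgebra (cliffordForm m))ˣ) :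
        CliffordAlgebra (cliffordForm m)))) h3).trans ?_
      rw [smul_mul_assoc, mul_smul_comm, ← mul_assoc, hinv, one_mul]

theorem spin_mul_inv (s : Spin m) : (s : CliffordAlgebra (cliffordForm m)) *
    ((s⁻¹ : Spin m) : CliffordAlgebra (cliffordForm m)) = 1 := by
  exact congrArg Subtype.val (mul_inv_cancel s)

theorem spin_inv_mul (s : Spin m) : ((s⁻¹ : Spin m) : CliffordAlgebra (cliffordForm m)) *
    (s : CliffordAlgebra (cliffordForm m)) = 1 := by
  exact congrArg Subtype.val (inv_mul_cancel s)

theorem spinVec_eq {s : Spin m} {v w : Fin m → ℝ}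
    (h : (s : CliffordAlgebra (cliffordForm m)) * ι (cliffordForm m) v = ι (cliffordForm m) w * s) :
    spinVec s v = w := by
  apply ι_injective (cliffordForm m)
  rw [ι_spinVec, h, mul_assoc, spin_mul_inv, mul_one]

theorem spin_mul_ι (s : Spin m) (v : Fin m → ℝ) :
    (s : CliffordAlgebra (cliffordForm m)) * ι (cliffordForm m) v =
      ι (cliffordForm m) (spinVec s v) * s := by
  rw [ι_spinVec, mul_assoc, spin_inv_mul, mul_one]

theorem spinCover_mulVec (s : Spin m) (v : Fin m → ℝ) : spinCover s *ᵥ v = spinVec s v := by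
  symm
  apply spinVec_eq
  have h (i : Fin m) : (s : CliffordAlgebra (cliffordForm m)) * ι (cliffordForm m) (Pi.single i 1) =
      ι (cliffordForm m) ((spinCover s).col i) * s := spin_mul_ι s _
  have hv : v = ∑ i, v i • Pi.single i (1 : ℝ) := by
    ext j
    simp [Finset.sum_apply, Pi.single_apply]
  rw [mulVec_eq_sum]
  conv_lhs => rw [hv]
  simp only [map_sum, map_smul, Finset.mul_sum, Finset.sum_mul, mul_smul_comm, smul_mul_assoc, h,
    op_smul_eq_smul]
  rfl

theorem spinCover_eq_of_forall {s : Spin m} {A : Matrix (Fin m) (Fin m) ℝ}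
    (h : ∀ v, (s : CliffordAlgebra (cliffordForm m)) * ι (cliffordForm m) v =
      ι (cliffordForm m) (A *ᵥ v) * s) : spinCover s = A := by
  apply ext_of_mulVec_single
  intro i
  rw [spinCover_mulVec]
  exact spinVec_eq (h _)

/-- For an even element `involute s = s`, and this is also `det A • s`; as `s ≠ 0`, the determinant
is `1`. -/
theorem spinCover_mem (s : Spin m) : spinCover s ∈ specialOrthogonalGroup (Fin m) ℝ := by
  obtain ⟨A, hA, h1, h2⟩ := exists_matrix_of_mem_lipschitzGroup
    (spinGroup.units_mem_lipschitzGroup (x := spinGroup.toUnits s) s.2)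
  have h3 : involute (s : CliffordAlgebra (cliffordForm m)) = s := spinGroup.involute_eq s.2
  change ∀ v, involute (s : CliffordAlgebra (cliffordForm m)) * _ = _ at h1
  change involute (s : CliffordAlgebra (cliffordForm m)) = A.det • (s : CliffordAlgebra _) at h2
  rw [h3] at h1 h2
  rw [spinCover_eq_of_forall h1, mem_specialOrthogonalGroup_iff]
  refine ⟨hA, ?_⟩
  have h4 : (A.det - 1) • (s : CliffordAlgebra (cliffordForm m)) = 0 := by
    rw [sub_smul, ← h2, one_smul, sub_self]
  have h5 : (s : CliffordAlgebra (cliffordForm m)) ≠ 0 := by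
    intro h
    have := spin_mul_inv s
    rw [h, zero_mul] at this
    exact zero_ne_one this
  rcases smul_eq_zero.1 h4 with h | h
  · linarith
  · exact absurd h h5

/-- The covering `λ : Spin(m) → SO(m)`. -/
def spinHom (m : ℕ) : Spin m →* SO m where
  toFun s := ⟨spinCover s, spinCover_mem s⟩
  map_one' := Subtype.ext (spinCover_eq_of_forall fun v => by simp)
  map_mul' s t := Subtype.ext (spinCover_eq_of_forall fun v => by
    change (s : CliffordAlgebra (cliffordForm m)) *
      (t : CliffordAlgebra (cliffordForm m)) * _ = ι _ ((spinCover s * spinCover t) *ᵥ v) *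
      ((s : CliffordAlgebra (cliffordForm m)) * (t : CliffordAlgebra (cliffordForm m)))
    rw [← mulVec_mulVec, spinCover_mulVec, spinCover_mulVec, mul_assoc, spin_mul_ι, ← mul_assoc,
      spin_mul_ι, mul_assoc])

theorem coe_spinHom (s : Spin m) : (spinHom m s).1 = spinCover s := rfl

/-- An element of the kernel is even and commutes with all vectors, hence is a scalar `r`; unitarity
gives `r * r = 1`. -/
theorem spin_eq_one_or_neg_one {s : Spin m} (hs : spinHom m s = 1) :
    (s : CliffordAlgebra (cliffordForm m)) = 1 ∨ (s : CliffordAlgebra (cliffordForm m)) = -1 := by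
  have h1 (v) : (s : CliffordAlgebra (cliffordForm m)) * ι (cliffordForm m) v =
      ι (cliffordForm m) v * s := by
    rw [spin_mul_ι, ← spinCover_mulVec, ← coe_spinHom, hs]
    congr 2
    exact one_mulVec v
  have h2 : involute (s : CliffordAlgebra (cliffordForm m)) = s := spinGroup.involute_eq s.2
  obtain ⟨r, hr⟩ := eq_algebraMap_of_contractLeft_eq_zero (cliffordForm m)
    (s : CliffordAlgebra (cliffordForm m)) fun d => by
      -- The polar form is `-2` times the dot product, so it represents every functional.
      obtain ⟨v, rfl⟩ : ∃ v, d = (cliffordForm m).polarBilin v := by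
        refine ⟨fun i => (-2)⁻¹ * d (Pi.single i 1), ?_⟩
        apply LinearMap.pi_ext'
        intro i
        ext
        simp [polar_cliffordForm]
      rw [contractLeft_polarBilin, h2, h1, sub_self]
  have h3 := spinGroup.star_mul_self_of_mem s.2
  rw [hr, star_algebraMap, ← map_mul, ← map_one (algebraMap ℝ _),
    (FaithfulSMul.algebraMap_injective ℝ (CliffordAlgebra (cliffordForm m))).eq_iff] at h3
  rcases mul_self_eq_one_iff.1 h3 with h | h <;> rw [hr, h]
  · left; simp
  · right; simp

/-- A vector of length one is a unit of the Clifford algebra. -/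
def vecUnit (a : Fin m → ℝ) (ha : a ⬝ᵥ a = 1) : (CliffordAlgebra (cliffordForm m))ˣ where
  val := ι (cliffordForm m) a
  inv := -ι (cliffordForm m) a
  val_inv := by rw [mul_neg, ι_mul_self, ha]; simp
  inv_val := by rw [neg_mul, ι_mul_self, ha]; simp

/-- The product of two vectors of length one, as an element of the spin group. -/
def spinPair (a b : Fin m → ℝ) (ha : a ⬝ᵥ a = 1) (hb : b ⬝ᵥ b = 1) : Spin m :=
  ⟨ι (cliffordForm m) a * ι (cliffordForm m) b, by
    have hpin (a : Fin m → ℝ) (ha : a ⬝ᵥ a = 1) : ι (cliffordForm m) a ∈ pinGroup (cliffordForm m) := by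
      change ((vecUnit a ha : (CliffordAlgebra (cliffordForm m))ˣ) : CliffordAlgebra (cliffordForm m)) ∈ _
      rw [pinGroup.units_mem_iff]
      refine ⟨Subgroup.subset_closure ⟨a, rfl⟩, ?_⟩
      rw [Unitary.mem_iff]
      simp only [vecUnit, star_ι, neg_mul, mul_neg, ι_mul_self, ha, map_neg, map_one, neg_neg,
        and_self]
    exact ⟨mul_mem (hpin a ha) (hpin b hb), ι_mul_ι_mem_evenOdd_zero _ a b⟩⟩

theorem coe_spinPair (a b : Fin m → ℝ) (ha : a ⬝ᵥ a = 1) (hb : b ⬝ᵥ b = 1) :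
    (spinPair a b ha hb : CliffordAlgebra (cliffordForm m)) =
      ι (cliffordForm m) a * ι (cliffordForm m) b := rfl

/-- Each unit vector moved past `v` reflects it and costs a sign; in a product of two the signs
cancel. -/
theorem ι_mul_ι_unitaryReflection {a : Fin m → ℝ} (ha : a ⬝ᵥ a = 1) (v : Fin m → ℝ) :
    ι (cliffordForm m) a * ι (cliffordForm m) v =
      -(ι (cliffordForm m) (unitaryReflection a (1 / 2) *ᵥ v) * ι (cliffordForm m) a) := by
  rw [unitaryReflection_mulVec, star_trivial, map_sub, map_smul, sub_mul, smul_mul_assoc,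
    ι_mul_self, ha, ι_mul_ι_swap a v, Algebra.smul_def, ← map_mul (algebraMap ℝ _)]
  norm_num
  abel

theorem spinCover_spinPair (a b : Fin m → ℝ) (ha : a ⬝ᵥ a = 1) (hb : b ⬝ᵥ b = 1) :
    spinCover (spinPair a b ha hb) = unitaryReflection a (1 / 2) * unitaryReflection b (1 / 2) := by
  apply spinCover_eq_of_forall
  intro v
  rw [coe_spinPair, mul_assoc, ι_mul_ι_unitaryReflection hb, mul_neg, ← mul_assoc,
    ι_mul_ι_unitaryReflection ha, mulVec_mulVec, neg_mul, neg_neg, mul_assoc]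

end Spin
end

noncomputable section

open Matrix CliffordAlgebra Topology

/-! ### The topology of the spin group -/

section SpinTopology

instance CliffordAlgebra.finite_cliffordForm (m : ℕ) :
    Module.Finite ℝ (CliffordAlgebra (cliffordForm m)) := by
  have : Invertible (2 : ℝ) := invertibleOfNonzero two_ne_zero
  have := Module.Finite.of_basis (Pi.basisFun ℝ (Fin m)).ExteriorAlgebra
  exact Module.Finite.equiv (equivExterior (cliffordForm m)).symm

/-- The canonical topology of the Clifford algebra. -/
abbrev cliffordTopology (m : ℕ) : TopologicalSpace (CliffordAlgebra (cliffordForm m)) :=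
  moduleTopology ℝ _

attribute [local instance] cliffordTopology

theorem isModuleTopology_clifford (m : ℕ) :
    IsModuleTopology ℝ (CliffordAlgebra (cliffordForm m)) := ⟨rfl⟩

attribute [local instance] isModuleTopology_clifford

theorem isTopologicalRing_clifford (m : ℕ) :
    IsTopologicalRing (CliffordAlgebra (cliffordForm m)) :=
  IsModuleTopology.isTopologicalRing ℝ _

attribute [local instance] isTopologicalRing_clifford

theorem continuous_of_clifford {m : ℕ} {V : Type*} [AddCommGroup V] [Module ℝ V] [TopologicalSpace V]
    [IsTopologicalAddGroup V] [ContinuousSMul ℝ V]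
    (f : CliffordAlgebra (cliffordForm m) →ₗ[ℝ] V) : Continuous f :=
  IsModuleTopology.continuous_of_linearMap f

theorem continuous_ι (m : ℕ) : Continuous (ι (cliffordForm m)) :=
  IsModuleTopology.continuous_of_linearMap _

theorem t2Space_clifford (m : ℕ) : T2Space (CliffordAlgebra (cliffordForm m)) :=
  T2Space.of_injective_continuous (Module.finBasis ℝ _).equivFun.injective
    (continuous_of_clifford (Module.finBasis ℝ (CliffordAlgebra (cliffordForm m))).equivFun.toLinearMap)

attribute [local instance] t2Space_clifford

variable {m : ℕ}

theorem Spin.isInducing_val (m : ℕ) :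
    IsInducing (Subtype.val : Spin m → CliffordAlgebra (cliffordForm m)) := ⟨rfl⟩

theorem Spin.continuous_val (m : ℕ) :
    Continuous (Subtype.val : Spin m → CliffordAlgebra (cliffordForm m)) :=
  (Spin.isInducing_val m).continuous

instance Spin.instT2Space (m : ℕ) : T2Space (Spin m) :=
  T2Space.of_injective_continuous Subtype.val_injective (Spin.continuous_val m)

theorem Spin.continuous_inv_val (m : ℕ) :
    Continuous fun s : Spin m => ((s⁻¹ : Spin m) : CliffordAlgebra (cliffordForm m)) := by
  have h : Continuous fun x : CliffordAlgebra (cliffordForm m) => star x :=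
    continuous_of_clifford ((reverse (Q := cliffordForm m)).comp
      (involute (Q := cliffordForm m)).toLinearMap)
  exact h.comp (Spin.continuous_val m)

instance Spin.instIsTopologicalGroup (m : ℕ) : IsTopologicalGroup (Spin m) where
  continuous_mul := by
    rw [(Spin.isInducing_val m).continuous_iff]
    have h := Spin.continuous_val m
    exact (h.comp continuous_fst).mul (h.comp continuous_snd)
  continuous_inv := by
    rw [(Spin.isInducing_val m).continuous_iff]
    exact Spin.continuous_inv_val m

/-- The definition uses `Function.invFun`. A linear left inverse of `ι` gives the same values and is
continuous for the module topology. -/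
theorem continuous_spinVec (v : Fin m → ℝ) : Continuous fun s : Spin m => spinVec s v := by
  obtain ⟨g, hg⟩ := (ι (cliffordForm m)).exists_leftInverse_of_injective
    (LinearMap.ker_eq_bot.2 (ι_injective _))
  have h (s : Spin m) : spinVec s v = g ((s : CliffordAlgebra (cliffordForm m)) *
      ι (cliffordForm m) v * ((s⁻¹ : Spin m) : CliffordAlgebra (cliffordForm m))) := by
    rw [← ι_spinVec]
    exact (LinearMap.congr_fun hg _).symm
  simp_rw [h]
  exact (continuous_of_clifford g).comp
    (((Spin.continuous_val m).mul continuous_const).mul (Spin.continuous_inv_val m))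

theorem continuous_spinHom (m : ℕ) : Continuous (spinHom m) := by
  refine Continuous.subtype_mk (f := fun s : Spin m => spinCover s) ?_ _
  refine continuous_matrix fun i j => ?_
  exact (continuous_apply i).comp (continuous_spinVec _)

theorem continuous_spinPair {X : Type*} [TopologicalSpace X] {a b : X → Fin m → ℝ}
    (ha : ∀ x, a x ⬝ᵥ a x = 1) (hb : ∀ x, b x ⬝ᵥ b x = 1) (hac : Continuous a)
    (hbc : Continuous b) : Continuous fun x => spinPair (a x) (b x) (ha x) (hb x) := by
  rw [(Spin.isInducing_val m).continuous_iff]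
  exact ((continuous_ι m).comp hac).mul ((continuous_ι m).comp hbc)

/-! ### The inclusion of `Spin(m)` in `Spin(m+1)` -/

/-- The inclusion `v ↦ (0, v)`, as an isometry of quadratic forms. -/
def consIsometry (m : ℕ) : cliffordForm m →qᵢ cliffordForm (m + 1) where
  toFun v := Fin.cons 0 v
  map_add' v w := by
    ext i
    refine Fin.cases ?_ (fun i => ?_) i <;> simp
  map_smul' r v := by
    ext i
    refine Fin.cases ?_ (fun i => ?_) i <;> simp
  map_app' v := by
    change cliffordForm (m + 1) (Fin.cons 0 v) = _
    rw [cliffordForm_apply, cliffordForm_apply]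
    simp [dotProduct, Fin.sum_univ_succ]

theorem consIsometry_apply (v : Fin m → ℝ) : consIsometry m v = Fin.cons 0 v := rfl

theorem map_star_clifford (x : CliffordAlgebra (cliffordForm m)) :
    CliffordAlgebra.map (consIsometry m) (star x) = star (CliffordAlgebra.map (consIsometry m) x) := by
  induction x using CliffordAlgebra.induction with
  | algebraMap r => rw [star_algebraMap, AlgHom.commutes, star_algebraMap]
  | ι v => rw [star_ι, map_neg, map_apply_ι, star_ι]
  | mul x y hx hy => rw [star_mul, map_mul, hx, hy, map_mul, star_mul]
  | add x y hx hy => rw [star_add, map_add, hx, hy, map_add, star_add]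

theorem map_mem_spinGroup {x : CliffordAlgebra (cliffordForm m)}
    (hx : x ∈ spinGroup (cliffordForm m)) :
    CliffordAlgebra.map (consIsometry m) x ∈ spinGroup (cliffordForm (m + 1)) := by
  obtain ⟨⟨⟨u, hu, rfl⟩, h2⟩, h3⟩ := hx
  refine ⟨⟨⟨Units.map (CliffordAlgebra.map (consIsometry m)).toMonoidHom u, ?_, rfl⟩, ?_⟩, ?_⟩
  · have : lipschitzGroup (cliffordForm m) ≤ (lipschitzGroup (cliffordForm (m + 1))).comap
        (Units.map (CliffordAlgebra.map (consIsometry m)).toMonoidHom) := by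
      unfold lipschitzGroup
      rw [Subgroup.closure_le]
      rintro y ⟨v, hv⟩
      refine Subgroup.subset_closure ⟨consIsometry m v, ?_⟩
      rw [← map_apply_ι, hv]
      rfl
    exact this hu
  · have h2' := Unitary.mem_iff.1 h2
    change CliffordAlgebra.map (consIsometry m) (u : CliffordAlgebra (cliffordForm m)) ∈ unitary _
    change star (u : CliffordAlgebra (cliffordForm m)) * u = 1 ∧
      (u : CliffordAlgebra (cliffordForm m)) * star (u : CliffordAlgebra (cliffordForm m)) = 1 at h2'
    rw [Unitary.mem_iff, ← map_star_clifford, ← map_mul, ← map_mul, h2'.1, h2'.2, map_one]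
    exact ⟨rfl, rfl⟩
  · change _ ∈ evenOdd (cliffordForm (m + 1)) 0
    change (u : CliffordAlgebra (cliffordForm m)) ∈ evenOdd (cliffordForm m) 0 at h3
    change CliffordAlgebra.map (consIsometry m) (u : CliffordAlgebra (cliffordForm m)) ∈ _
    generalize (u : CliffordAlgebra (cliffordForm m)) = y at h3
    induction y, h3 using even_induction with
    | algebraMap r =>
      rw [AlgHom.commutes]
      exact one_le_evenOdd_zero _ (Submodule.algebraMap_mem r)
    | add x y hx hy hx' hy' =>
      rw [map_add]
      exact Submodule.add_mem _ hx' hy'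
    | ι_mul_ι_mul v w x hx hx' =>
      rw [map_mul, map_mul, map_apply_ι, map_apply_ι]
      have := evenOdd_mul_le (cliffordForm (m + 1)) 0 0
        (Submodule.mul_mem_mul (ι_mul_ι_mem_evenOdd_zero _ (consIsometry m v) (consIsometry m w)) hx')
      simpa using this

/-- The inclusion of `Spin(m)` in `Spin(m+1)`. -/
def spinEmb (m : ℕ) : Spin m →* Spin (m + 1) where
  toFun s := ⟨CliffordAlgebra.map (consIsometry m) s, map_mem_spinGroup s.2⟩
  map_one' := Subtype.ext (by simp)
  map_mul' s t := Subtype.ext (by simp)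

theorem coe_spinEmb (s : Spin m) : (spinEmb m s : CliffordAlgebra (cliffordForm (m + 1))) =
    CliffordAlgebra.map (consIsometry m) s := rfl

theorem continuous_spinEmb (m : ℕ) : Continuous (spinEmb m) := by
  rw [(Spin.isInducing_val (m + 1)).continuous_iff]
  exact (continuous_of_clifford (CliffordAlgebra.map (consIsometry m)).toLinearMap).comp
    (Spin.continuous_val m)

/-- The new basis vector anticommutes with the included vectors, hence commutes with the included
even elements. This is why `Spin(m)` fixes it in `spinHom_spinEmb`. -/
theorem ι_single_zero_mul_map (x : CliffordAlgebra (cliffordForm m)) :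
    CliffordAlgebra.map (consIsometry m) (involute x) * ι (cliffordForm (m + 1)) (Pi.single 0 1) =
      ι (cliffordForm (m + 1)) (Pi.single 0 1) * CliffordAlgebra.map (consIsometry m) x := by
  induction x using CliffordAlgebra.induction with
  | algebraMap r => rw [AlgHom.commutes, AlgHom.commutes, Algebra.commutes]
  | ι v =>
    rw [involute_ι, map_neg, map_apply_ι, ι_mul_ι_swap (Pi.single 0 1)]
    simp [consIsometry_apply]
  | mul x y hx hy => rw [map_mul, map_mul, map_mul, mul_assoc, hy, ← mul_assoc, hx, mul_assoc]
  | add x y hx hy => rw [map_add, map_add, map_add, add_mul, mul_add, hx, hy]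

theorem spinHom_spinEmb (s : Spin m) : spinHom (m + 1) (spinEmb m s) = blockSO m (spinHom m s) := by
  apply Subtype.ext
  apply spinCover_eq_of_forall
  intro v
  obtain ⟨a, w, rfl⟩ : ∃ (a : ℝ) (w : Fin m → ℝ), v = Fin.cons a w :=
    ⟨v 0, Fin.tail v, (Fin.cons_self_tail v).symm⟩
  have hsplit (a : ℝ) (w : Fin m → ℝ) : (Fin.cons a w : Fin (m + 1) → ℝ) =
      a • Pi.single 0 1 + consIsometry m w := by
    rw [consIsometry_apply]
    ext i
    refine Fin.cases ?_ (fun i => ?_) i <;> simp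
  have h1 : involute (s : CliffordAlgebra (cliffordForm m)) = s := spinGroup.involute_eq s.2
  have h2 := ι_single_zero_mul_map (s : CliffordAlgebra (cliffordForm m))
  rw [h1] at h2
  change _ = ι _ (unitBlock (spinCover s) *ᵥ _) * _
  rw [unitBlock_mulVec_cons, hsplit, hsplit, coe_spinEmb, map_add, map_add, map_smul, mul_add,
    add_mul, mul_smul_comm, smul_mul_assoc, h2, ← map_apply_ι, ← map_apply_ι, ← map_mul,
    ← map_mul, spinCover_mulVec, spin_mul_ι]

/-- The element `-1` of the spin group. -/
def spinNeg (k : ℕ) : Spin (k + 1) :=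
  spinPair (Pi.single 0 1) (Pi.single 0 1) (by simp) (by simp)

theorem coe_spinNeg (k : ℕ) : (spinNeg k : CliffordAlgebra (cliffordForm (k + 1))) = -1 := by
  rw [spinNeg, coe_spinPair, ι_mul_self]
  simp

theorem clifford_neg_one_ne_one : (-1 : CliffordAlgebra (cliffordForm m)) ≠ 1 := by
  intro h
  have h2 : algebraMap ℝ (CliffordAlgebra (cliffordForm m)) (-1) = algebraMap ℝ _ 1 := by
    simpa using h
  have := FaithfulSMul.algebraMap_injective ℝ (CliffordAlgebra (cliffordForm m)) h2
  norm_num at this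

theorem spinNeg_ne_one (k : ℕ) : spinNeg k ≠ 1 := by
  intro h
  apply clifford_neg_one_ne_one (m := k + 1)
  rw [← coe_spinNeg, h]
  rfl

theorem spinHom_eq_one_iff {k : ℕ} {s : Spin (k + 1)} :
    spinHom (k + 1) s = 1 ↔ s = 1 ∨ s = spinNeg k := by
  constructor
  · intro h
    rcases spin_eq_one_or_neg_one h with h | h
    · left
      exact Subtype.ext h
    · right
      exact Subtype.ext (h.trans (coe_spinNeg k).symm)
  · rintro (rfl | rfl)
    · exact map_one _
    · apply Subtype.ext
      apply spinCover_eq_of_forall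
      intro v
      rw [coe_spinNeg]
      simp

theorem spinHom_eq_iff {k : ℕ} {s t : Spin (k + 1)} :
    spinHom (k + 1) s = spinHom (k + 1) t ↔ s = t ∨ s = t * spinNeg k := by
  constructor
  · intro h
    have h1 : spinHom (k + 1) (t⁻¹ * s) = 1 := by rw [map_mul, map_inv, h, inv_mul_cancel]
    rcases spinHom_eq_one_iff.1 h1 with h2 | h2
    · exact Or.inl (inv_mul_eq_one.1 h2).symm
    · exact Or.inr (inv_mul_eq_iff_eq_mul.1 h2)
  · rintro (rfl | rfl)
    · rfl
    · rw [map_mul, spinHom_eq_one_iff.2 (Or.inr rfl), mul_one]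

theorem spinEmb_injective (m : ℕ) : Function.Injective (spinEmb m) := by
  rw [injective_iff_map_eq_one]
  intro s hs
  have h1 : spinHom m s = 1 := by
    apply blockSO_injective
    rw [← spinHom_spinEmb, hs, map_one, map_one]
  rcases spin_eq_one_or_neg_one h1 with h | h
  · exact Subtype.ext h
  · exfalso
    have h2 := congrArg Subtype.val hs
    rw [coe_spinEmb, h, map_neg, map_one] at h2
    exact clifford_neg_one_ne_one h2

/-! ### Surjectivity of the covering, and compactness of the spin group -/

theorem unitaryReflection_smul {ι : Type*} [DecidableEq ι] {r : ℝ} (hr : r ≠ 0) (a : ι → ℝ) (c : ℝ) :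
    unitaryReflection (r • a) (r * r * c) = unitaryReflection a c := by
  rw [unitaryReflection, unitaryReflection, StarModule.star_smul, smul_vecMulVec, vecMulVec_smul, smul_smul,
    smul_smul, star_trivial]
  congr 2
  field_simp

/-- A rotor is a product of two reflections, and a reflection depends only on the line of its
vector. Dividing `x + y` by its length `√(2 * (1 + y ⬝ᵥ x))` lifts the rotor to the spin group. -/
theorem exists_spinPair_eq_rotor {x y : Fin m → ℝ} (hx : x ⬝ᵥ x = 1) (hy : y ⬝ᵥ y = 1)
    (h : 0 < 1 + y ⬝ᵥ x) :
    ∃ ha, spinCover (spinPair ((√(2 * (1 + y ⬝ᵥ x)))⁻¹ • (x + y)) x ha hx) = rotor x y := by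
  have h2 : √(2 * (1 + y ⬝ᵥ x)) * √(2 * (1 + y ⬝ᵥ x)) = 2 * (1 + y ⬝ᵥ x) :=
    Real.mul_self_sqrt (by linarith)
  have h3 : (√(2 * (1 + y ⬝ᵥ x)))⁻¹ ≠ 0 := by
    apply inv_ne_zero
    intro h0
    rw [h0] at h2
    linarith
  have h4 := rotor_aux (𝕜 := ℝ) (by simpa using hx) (by simpa using hy)
  simp only [star_trivial] at h4
  refine ⟨?_, ?_⟩
  · rw [smul_dotProduct, dotProduct_smul, h4, smul_smul, ← mul_inv, h2, smul_eq_mul]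
    field_simp
    ring
  · rw [spinCover_spinPair, rotor]
    congr 1
    rw [← unitaryReflection_smul h3 (x + y)]
    congr 1
    rw [← mul_inv, h2, star_trivial]
    field_simp

theorem exists_spinPair_mulVec_single (k : ℕ) {y : Fin (k + 2) → ℝ} (hy : y ⬝ᵥ y = 1) :
    ∃ a b ha hb, spinCover (spinPair a b ha hb) *ᵥ Pi.single 0 1 = y := by
  have hx : (Pi.single 0 1 : Fin (k + 2) → ℝ) ⬝ᵥ Pi.single 0 1 = 1 := by simp
  by_cases h : 0 < 1 + y ⬝ᵥ (Pi.single 0 1 : Fin (k + 2) → ℝ)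
  · obtain ⟨ha, h'⟩ := exists_spinPair_eq_rotor hx hy h
    refine ⟨_, _, ha, hx, ?_⟩
    rw [h', rotor_mulVec (by simp)]
    rw [star_trivial]
    exact h.ne'
  -- A unit vector whose first coordinate is at most `-1` has no other coordinates.
  · have hy' : y = -Pi.single 0 1 := by
      have hsum : y 0 * y 0 + ∑ i : Fin (k + 1), y i.succ * y i.succ = 1 := by
        rw [← hy]
        exact (Fin.sum_univ_succ fun i => y i * y i).symm
      have hnn : ∀ i ∈ Finset.univ, 0 ≤ (fun i : Fin (k + 1) => y i.succ * y i.succ) i :=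
        fun i _ => mul_self_nonneg _
      have h0 : y 0 ≤ -1 := by
        simp at h
        linarith
      have hs0 : ∑ i : Fin (k + 1), y i.succ * y i.succ = 0 :=
        le_antisymm (by nlinarith) (Finset.sum_nonneg hnn)
      have hi := (Finset.sum_eq_zero_iff_of_nonneg hnn).1 hs0
      have h00 : y 0 = -1 := by nlinarith
      ext i
      refine Fin.cases ?_ (fun i => ?_) i
      · simp [h00]
      · simpa using hi i (Finset.mem_univ i)
    -- The reflection in the first basis vector gives the sign; the one in the second basis vector
    -- leaves it and corrects the parity.
    refine ⟨Pi.single 1 1, Pi.single 0 1, by simp, by simp, ?_⟩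
    rw [spinCover_spinPair, ← mulVec_mulVec, unitaryReflection_half_mulVec_self (by simp), mulVec_neg,
      unitaryReflection_mulVec, hy']
    simp

theorem mulVec_single_dotProduct_self {k : ℕ} (A : SO (k + 1)) :
    (A.1 *ᵥ Pi.single 0 1) ⬝ᵥ (A.1 *ᵥ Pi.single 0 1) = 1 := by
  have h2 : A.1ᵀ * A.1 = 1 := (mem_orthogonalGroup_iff' (Fin (k + 1)) ℝ).1
    (mem_specialOrthogonalGroup_iff.1 A.2).1
  rw [dotProduct_mulVec, ← mulVec_transpose, mulVec_mulVec, h2, one_mulVec]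
  simp

theorem mem_range_blockSO_of_mulVec {k : ℕ} {A : SO (k + 1)}
    (h : A.1 *ᵥ Pi.single 0 1 = Pi.single 0 1) : A ∈ Set.range (blockSO k) := by
  obtain ⟨B, hB⟩ := exists_eq_unitBlock (mem_specialOrthogonalGroup_iff.1 A.2).1 h
  exact mem_range_blockSO hB

/-- This reduces `SO(k+2)` to `SO(k+1)`, and drives the inductions for surjectivity and compactness.
-/
theorem exists_spinPair_mul_blockSO (k : ℕ) (A : SO (k + 2)) :
    ∃ a b ha hb B, A = spinHom _ (spinPair a b ha hb) * blockSO (k + 1) B := by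
  obtain ⟨a, b, ha, hb, h⟩ := exists_spinPair_mulVec_single k (mulVec_single_dotProduct_self A)
  have h1 : ((spinHom _ (spinPair a b ha hb))⁻¹ * A).1 *ᵥ Pi.single 0 1 = Pi.single 0 1 := by
    have h2 := congrArg Subtype.val (inv_mul_cancel (spinHom _ (spinPair a b ha hb)))
    change ((spinHom _ (spinPair a b ha hb))⁻¹).1 * spinCover (spinPair a b ha hb) = 1 at h2
    change (((spinHom _ (spinPair a b ha hb))⁻¹).1 * A.1) *ᵥ _ = _
    rw [← mulVec_mulVec, ← h, mulVec_mulVec, h2, one_mulVec]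
  obtain ⟨B, hB⟩ := mem_range_blockSO_of_mulVec h1
  exact ⟨a, b, ha, hb, B, by rw [hB, mul_inv_cancel_left]⟩

theorem SO.eq_one_of_fin_one (A : SO 1) : A = 1 := by
  have h := (mem_specialOrthogonalGroup_iff.1 A.2).2
  rw [det_fin_one] at h
  apply Subtype.ext
  ext i j
  rw [Subsingleton.elim i 0, Subsingleton.elim j 0, h]
  rfl

theorem spinHom_surjective (k : ℕ) : Function.Surjective (spinHom (k + 1)) := by
  induction k with
  | zero =>
    intro A
    exact ⟨1, (map_one _).trans (SO.eq_one_of_fin_one A).symm⟩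
  | succ k ih =>
    intro A
    obtain ⟨a, b, ha, hb, B, rfl⟩ := exists_spinPair_mul_blockSO k A
    obtain ⟨s, rfl⟩ := ih B
    exact ⟨spinPair a b ha hb * spinEmb _ s, by rw [map_mul, spinHom_spinEmb]⟩

theorem map_spinNeg (k : ℕ) : spinEmb (k + 1) (spinNeg k) = spinNeg (k + 1) := by
  apply Subtype.ext
  rw [coe_spinEmb, coe_spinNeg, coe_spinNeg, map_neg, map_one]

/-- The preimage of the stabilizer is all of `Spin(k+1)`, since both lifts of a rotation differ by
`-1`, which already lies there. -/
theorem mem_range_spinEmb {k : ℕ} {p : Spin (k + 2)}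
    (h : spinCover p *ᵥ Pi.single 0 1 = Pi.single 0 1) : p ∈ Set.range (spinEmb (k + 1)) := by
  obtain ⟨B, hB⟩ := mem_range_blockSO_of_mulVec (A := spinHom _ p) h
  obtain ⟨s, rfl⟩ := spinHom_surjective k B
  rw [← spinHom_spinEmb, eq_comm, spinHom_eq_iff] at hB
  rcases hB with rfl | rfl
  · exact ⟨s, rfl⟩
  · exact ⟨s * spinNeg k, by rw [map_mul, map_spinNeg]⟩

theorem isCompact_dotProduct_self_eq_one (ι : Type*) [Fintype ι] :
    IsCompact {a : ι → ℝ | a ⬝ᵥ a = 1} := by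
  refine (isCompact_univ_pi fun _ : ι => isCompact_Icc (a := (-1 : ℝ)) (b := 1)).of_isClosed_subset
    ?_ ?_
  · refine isClosed_eq ?_ continuous_const
    simp only [dotProduct]
    fun_prop
  · intro a ha i _
    have h1 : a i * a i ≤ 1 := by
      have ha' : ∑ j, a j * a j = 1 := ha
      rw [← ha']
      exact Finset.single_le_sum (f := fun j => a j * a j) (fun j _ => mul_self_nonneg _)
        (Finset.mem_univ i)
    constructor <;> nlinarith

/-- `Spin(1)` is contained in `{1, -1}`, and `Spin(k+2)` is a continuous image of two spheres times
`Spin(k+1)`. -/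
theorem compactSpace_spin (k : ℕ) : CompactSpace (Spin (k + 1)) := by
  induction k with
  | zero =>
    have : Finite (Spin (0 + 1)) := by
      apply Set.finite_univ_iff.1
      apply Set.Finite.subset (Set.toFinite {1, spinNeg 0})
      intro s _
      exact spinHom_eq_one_iff.1 (SO.eq_one_of_fin_one _)
    infer_instance
  | succ k ih =>
    let S := {a : Fin (k + 2) → ℝ | a ⬝ᵥ a = 1}
    have : CompactSpace S := isCompact_iff_compactSpace.1 (isCompact_dotProduct_self_eq_one _)
    let f : (S × S) × Spin (k + 1) → Spin (k + 2) :=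
      fun q => spinPair q.1.1.1 q.1.2.1 q.1.1.2 q.1.2.2 * spinEmb _ q.2
    have hf : Continuous f := by
      refine Continuous.mul ?_ ((continuous_spinEmb _).comp continuous_snd)
      exact continuous_spinPair _ _ (by fun_prop) (by fun_prop)
    have hsurj : Function.Surjective f := by
      intro p
      obtain ⟨a, b, ha, hb, B, hB⟩ := exists_spinPair_mul_blockSO k (spinHom _ p)
      obtain ⟨s, rfl⟩ := spinHom_surjective k B
      rw [← spinHom_spinEmb, ← map_mul, spinHom_eq_iff] at hB
      rcases hB with rfl | rfl
      · exact ⟨((⟨a, ha⟩, ⟨b, hb⟩), s), rfl⟩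
      · refine ⟨((⟨a, ha⟩, ⟨b, hb⟩), s * spinNeg k), ?_⟩
        simp only [f]
        rw [map_mul, map_spinNeg, mul_assoc]
    exact hsurj.compactSpace hf

attribute [instance] compactSpace_spin

theorem isDiscrete_ker_spinHom (k : ℕ) : IsDiscrete ((spinHom (k + 1)).ker : Set (Spin (k + 1))) := by
  apply Set.Finite.isDiscrete
  apply Set.Finite.subset (Set.toFinite {1, spinNeg k})
  intro s hs
  exact spinHom_eq_one_iff.1 hs

/-- Compactness makes the continuous surjection a quotient map; its kernel is finite, hence
discrete. -/
theorem isQuotientCoveringMap_spinHom (k : ℕ) :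
    IsQuotientCoveringMap (spinHom (k + 1)) (spinHom (k + 1)).ker :=
  (IsQuotientMap.of_surjective_continuous (spinHom_surjective k)
    (continuous_spinHom _)).isQuotientCoveringMap_of_isDiscrete_ker_monoidHom
    (isDiscrete_ker_spinHom k)

end SpinTopology

/-! ### The fundamental group of the special orthogonal group -/

section SpinRotation

variable {m : ℕ} {u₁ u₂ : Fin m → ℝ}

/-- The sign of the first coefficient compensates for `u₁ * u₁ = -1`, so that multiplication by `u₁`
on the left yields `cos θ + sin θ u₁ u₂`. -/
theorem spinRotation_aux (h : IsOrthonormalPair u₁ u₂) (θ : ℝ) :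
    (-Real.cos θ • u₁ + Real.sin θ • u₂) ⬝ᵥ (-Real.cos θ • u₁ + Real.sin θ • u₂) = 1 := by
  have h' : u₂ ⬝ᵥ u₁ = 0 := by rw [dotProduct_comm, h.ortho]
  simp only [add_dotProduct, dotProduct_add, smul_dotProduct, dotProduct_smul, h.fst, h.snd,
    h.ortho, h', smul_eq_mul]
  linear_combination Real.cos_sq_add_sin_sq θ

/-- The element `cos θ + sin θ u₁ u₂` of the spin group. -/
def spinRotation (h : IsOrthonormalPair u₁ u₂) (θ : ℝ) : Spin m :=
  spinPair u₁ (-Real.cos θ • u₁ + Real.sin θ • u₂) h.fst (spinRotation_aux h θ)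

theorem coe_spinRotation (h : IsOrthonormalPair u₁ u₂) (θ : ℝ) :
    (spinRotation h θ : CliffordAlgebra (cliffordForm m)) =
      algebraMap ℝ _ (Real.cos θ) + Real.sin θ • (ι (cliffordForm m) u₁ * ι (cliffordForm m) u₂) := by
  rw [spinRotation, coe_spinPair, map_add, map_smul, map_smul, mul_add, mul_smul_comm,
    mul_smul_comm, ι_mul_self, h.fst, Algebra.smul_def, ← map_mul]
  simp

/-- The covering doubles angles, so half a turn upstairs lies over a full turn. -/
theorem spinCover_spinRotation (h : IsOrthonormalPair u₁ u₂) (θ : ℝ) :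
    spinCover (spinRotation h θ) = planeRot u₁ u₂ (Circle.exp (2 * θ)) := by
  rw [spinRotation, spinCover_spinPair, unitaryReflection, unitaryReflection, planeRot, star_trivial,
    star_trivial, mul_sub, sub_mul, sub_mul, one_mul, mul_one, one_mul, smul_mul_smul,
    vecMulVec_mul_vecMulVec, dotProduct_add, dotProduct_smul, dotProduct_smul, h.fst, h.ortho,
    Circle.coe_exp]
  have h1 : (Complex.exp (((2 * θ : ℝ) : ℂ) * Complex.I)).re = 2 * Real.cos θ ^ 2 - 1 := by
    rw [Complex.exp_ofReal_mul_I_re, Real.cos_two_mul]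
  have h2 : (Complex.exp (((2 * θ : ℝ) : ℂ) * Complex.I)).im = 2 * Real.sin θ * Real.cos θ := by
    rw [Complex.exp_ofReal_mul_I_im, Real.sin_two_mul]
  have h3 : Real.sin θ * Real.sin θ = 1 - Real.cos θ ^ 2 := by
    rw [← Real.sin_sq_add_cos_sq θ]
    ring
  rw [h1, h2]
  simp only [add_vecMulVec, vecMulVec_add, smul_vecMulVec, vecMulVec_smul, smul_add, smul_sub,
    smul_smul, smul_eq_mul, h3]
  norm_num
  match_scalars <;> ring_nf

theorem continuous_spinRotation (h : IsOrthonormalPair u₁ u₂) : Continuous (spinRotation h) :=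
  continuous_spinPair (fun _ => h.fst) (spinRotation_aux h) (by fun_prop) (by fun_prop)

/-- The lift of the full turn that starts at `1` ends at `-1`, so its monodromy is not trivial. -/
theorem loopClass_planeRotLoop_ne_one (h : IsOrthonormalPair u₁ u₂) :
    loopClass (planeRotLoop h) ≠ 1 := by
  obtain ⟨k, rfl⟩ : ∃ k, m = k + 1 := by
    refine ⟨m - 1, ?_⟩
    rcases m with _ | m
    · have := h.fst
      simp at this
    · simp
  intro hone
  let Γ : Path (1 : Spin (k + 1)) (spinNeg k) :=
    { toFun := fun t => spinRotation h (Real.pi * t)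
      continuous_toFun := (continuous_spinRotation h).comp (by fun_prop)
      source' := Subtype.ext (by rw [coe_spinRotation]; simp)
      target' := Subtype.ext (by rw [coe_spinRotation, coe_spinNeg]; simp) }
  have hcov := (isQuotientCoveringMap_spinHom k).isCoveringMap
  let e : spinHom (k + 1) ⁻¹' {1} := ⟨1, map_one _⟩
  let e' : spinHom (k + 1) ⁻¹' {1} := ⟨spinNeg k, spinHom_eq_one_iff.2 (Or.inr rfl)⟩
  have h1 : hcov.monodromy (loopClass (planeRotLoop h)) e = e' := by
    refine hcov.monodromy_eq_of_map_eq (.mk Γ) ?_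
    change Path.Homotopic.Quotient.mk _ = Path.Homotopic.Quotient.mk _
    refine congrArg Path.Homotopic.Quotient.mk (Path.ext (funext fun t => Subtype.ext ?_))
    change spinCover (spinRotation h (Real.pi * t)) = planeRot u₁ u₂ (Circle.exp (2 * Real.pi * t))
    rw [spinCover_spinRotation, mul_assoc]
  have h2 : hcov.monodromy (loopClass (planeRotLoop h)) e = e := by
    rw [hone]
    exact congrFun hcov.monodromy_refl e
  exact spinNeg_ne_one k (congrArg Subtype.val (h1.symm.trans h2))

theorem nonempty_fundamentalGroup_SO_mulEquiv (hm : 3 ≤ m) :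
    Nonempty (FundamentalGroup (SO m) 1 ≃* Multiplicative (ZMod 2)) := by
  obtain ⟨u₁, u₂, h, -, hgen⟩ := exists_planeRotLoop_generator hm
  have hcard : Nat.card (FundamentalGroup (SO m) 1) = 2 := by
    rw [Nat.card_eq_two_iff]
    exact ⟨1, _, (loopClass_planeRotLoop_ne_one h).symm, Set.eq_univ_of_forall hgen⟩
  have : Fact (Nat.Prime 2) := ⟨Nat.prime_two⟩
  exact ⟨mulEquivOfPrimeCardEq (p := 2) hcard (by simp)⟩

end SpinRotation
end

noncomputable section

open Matrix Topology

/-! ### Tangent vectors of the sphere, seen in the ambient space -/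

section SphereTangent

variable {E : Type*} [NormedAddCommGroup E] [InnerProductSpace ℝ E] {m : ℕ}
  [Fact (finrank ℝ E = m + 1)]

theorem inclDeriv_injective (x : sphere (0 : E) 1) : Function.Injective (inclDeriv (m := m) x) :=
  injective_mvfderiv_subtypeVal_sphere x

theorem inner_inclDeriv (x : sphere (0 : E) 1) (w : TangentSpace (𝓡 m) x) :
    ⟪(x : E), inclDeriv x w⟫ = 0 := by
  have h : inclDeriv x w ∈ (inclDeriv (m := m) x).range := ⟨w, rfl⟩
  rw [show (inclDeriv (m := m) x).range = (ℝ ∙ (x : E))ᗮ from range_mvfderiv_subtypeVal x] at h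
  exact Submodule.mem_orthogonal_singleton_iff_inner_right.1 h

theorem exists_inclDeriv_eq (x : sphere (0 : E) 1) {w : E} (hw : ⟪(x : E), w⟫ = 0) :
    ∃ v : TangentSpace (𝓡 m) x, inclDeriv x v = w := by
  have h : w ∈ (ℝ ∙ (x : E))ᗮ := Submodule.mem_orthogonal_singleton_iff_inner_right.2 hw
  rw [← show (inclDeriv (m := m) x).range = (ℝ ∙ (x : E))ᗮ from range_mvfderiv_subtypeVal x] at h
  exact h

/-- Chain rule for the two sides of `incl ∘ f = T ∘ incl`, the linear map being its own derivative.
-/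
theorem inclDeriv_mfderiv_of_linear (T : E →L[ℝ] E) {f : sphere (0 : E) 1 → sphere (0 : E) 1}
    (hf : ∀ x, (f x : E) = T x) (x : sphere (0 : E) 1) (w : TangentSpace (𝓡 m) x) :
    inclDeriv (m := m) (f x) (mfderiv (𝓡 m) (𝓡 m) f x w) = T (inclDeriv x w) := by
  have hcoe : ContMDiff (𝓡 m) 𝓘(ℝ, E) 1 ((↑) : sphere (0 : E) 1 → E) := contMDiff_coe_sphere
  have hT : ContMDiff (𝓡 m) 𝓘(ℝ, E) 1 (fun y : sphere (0 : E) 1 => T y) :=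
    T.contDiff.contMDiff.comp hcoe
  have hfs : ContMDiff (𝓡 m) (𝓡 m) 1 f := by
    have h := hT.codRestrict_sphere (n := m) (fun y => by rw [← hf]; exact (f y).2)
    exact h.congr fun y => Subtype.ext (hf y)
  have h1 : inclDeriv (m := m) (f x) (mfderiv (𝓡 m) (𝓡 m) f x w) =
      mvfderiv (𝓡 m) (((↑) : sphere (0 : E) 1 → E) ∘ f) x w :=
    (mfderiv_comp_apply x ((hcoe (f x)).mdifferentiableAt one_ne_zero)
      ((hfs x).mdifferentiableAt one_ne_zero) w).symm
  have h2 : ((↑) : sphere (0 : E) 1 → E) ∘ f = T ∘ ((↑) : sphere (0 : E) 1 → E) := funext hf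
  have h3 : mvfderiv (𝓡 m) (T ∘ ((↑) : sphere (0 : E) 1 → E)) x w =
      mvfderiv 𝓘(ℝ, E) (T : E → E) (x : E) (inclDeriv x w) :=
    mfderiv_comp_apply x (g := (T : E → E)) T.differentiableAt.mdifferentiableAt
      ((hcoe x).mdifferentiableAt one_ne_zero) w
  have h4 : mvfderiv 𝓘(ℝ, E) (T : E → E) (x : E) = T := by
    unfold mvfderiv
    rw [mfderiv_eq_fderiv, T.fderiv]
    rfl
  rw [h1, h2, h3]
  exact congrArg (fun S : E →L[ℝ] E => S (inclDeriv x w)) h4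

/-- `isotropy` is transported along an equality of base points; seen in the ambient space, the
transport disappears. -/
theorem inclDeriv_eqRec {F : Type*} [AddCommGroup F] [TopologicalSpace F] [Module ℝ F]
    {y z : sphere (0 : E) 1} (h : y = z) (f : F →L[ℝ] TangentSpace (𝓡 m) y) (w : F) :
    inclDeriv z ((Eq.rec (motive := fun y _ => F →L[ℝ] TangentSpace (𝓡 m) y) f h :
      F →L[ℝ] TangentSpace (𝓡 m) z) w) = inclDeriv y (f w) := by
  subst h
  rfl

end SphereTangent

/-! ### The isotropy representation -/

/-- The isometry of `ℂ^k` given by a unitary matrix. -/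
def unitaryIsometry {k : ℕ} (g : U k) : CSpace k →ₗᵢ[ℝ] CSpace k where
  toFun x := WithLp.toLp 2 (g.1 *ᵥ x.ofLp)
  map_add' x y := by
    rw [WithLp.ofLp_add, mulVec_add, WithLp.toLp_add]
  map_smul' r x := by
    rw [WithLp.ofLp_smul, mulVec_smul, WithLp.toLp_smul]
    rfl
  norm_map' := norm_unitary_mulVec g

theorem unitaryIsometry_apply {k : ℕ} (g : U k) (x : CSpace k) :
    unitaryIsometry g x = WithLp.toLp 2 (g.1 *ᵥ x.ofLp) := rfl

theorem unitaryIsometry_mul {k : ℕ} (g h : U k) (x : CSpace k) :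
    unitaryIsometry (g * h) x = unitaryIsometry g (unitaryIsometry h x) := by
  simp only [unitaryIsometry_apply, mulVec_mulVec]
  rfl

theorem inclDeriv_mfderiv_smul {n : ℕ} (g : U (n + 1)) (x : CSphere n)
    (w : TangentSpace (𝓡 (2 * n + 1)) x) :
    inclDeriv (g • x) (mfderiv (𝓡 (2 * n + 1)) (𝓡 (2 * n + 1)) (fun y : CSphere n => g • y) x w) =
      unitaryIsometry g (inclDeriv x w) :=
  inclDeriv_mfderiv_of_linear (unitaryIsometry g).toContinuousLinearMap
    (f := fun y : CSphere n => g • y) (fun _ => rfl) x w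

theorem inclDeriv_isotropy {n : ℕ} (A : U n) (w : TangentSpace (𝓡 (2 * n + 1)) (basePt n)) :
    inclDeriv (basePt n) (isotropy n A w) =
      unitaryIsometry (blockEmb n A) (inclDeriv (basePt n) w) := by
  rw [← inclDeriv_mfderiv_smul]
  exact inclDeriv_eqRec (blockEmb_smul_basePt A) _ w

theorem unitaryIsometry_blockEmb_zero {n : ℕ} (A : U n) (x : CSpace (n + 1)) :
    (unitaryIsometry (blockEmb n A) x).ofLp 0 = x.ofLp 0 := by
  change (unitBlock A.1 *ᵥ x.ofLp) 0 = _
  rw [← Fin.cons_self_tail x.ofLp, unitBlock_mulVec_cons]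
  simp

theorem unitaryIsometry_blockEmb_succ {n : ℕ} (A : U n) (x : CSpace (n + 1)) (i : Fin n) :
    (unitaryIsometry (blockEmb n A) x).ofLp i.succ = (A.1 *ᵥ Fin.tail x.ofLp) i := by
  change (unitBlock A.1 *ᵥ x.ofLp) i.succ = _
  conv_lhs => rw [← Fin.cons_self_tail x.ofLp, unitBlock_mulVec_cons]
  simp

theorem inner_basePt {n : ℕ} (x : CSpace (n + 1)) :
    ⟪(basePt n : CSpace (n + 1)), x⟫ = (x.ofLp 0).re := by
  rw [PiLp.inner_apply, Fin.sum_univ_succ]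
  simp [basePt, Complex.inner]

/-- A tangent vector at the base point is given by its last `n` coordinates, and the imaginary part
of the first one. -/
def tangentCoordinates (n : ℕ) :
    TangentSpace (𝓡 (2 * n + 1)) (basePt n) →ₗ[ℝ] (Fin n → ℂ) × ℝ where
  toFun w := (Fin.tail (inclDeriv (basePt n) w).ofLp, ((inclDeriv (basePt n) w).ofLp 0).im)
  map_add' w w' := by
    rw [map_add]
    refine Prod.ext (funext fun i => ?_) ?_ <;> simp [Fin.tail]
  map_smul' r w := by
    rw [map_smul]
    refine Prod.ext (funext fun i => ?_) ?_ <;> simp [Fin.tail]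

theorem tangentCoordinates_bijective (n : ℕ) : Function.Bijective (tangentCoordinates n) := by
  constructor
  · rw [injective_iff_map_eq_zero]
    intro w hw
    apply inclDeriv_injective
    rw [map_zero]
    have h0 := inner_inclDeriv (basePt n) w
    rw [inner_basePt] at h0
    ext i
    refine Fin.cases ?_ (fun i => ?_) i
    · exact Complex.ext h0 (congrArg Prod.snd hw)
    · exact congrFun (congrArg Prod.fst hw) i
  · rintro ⟨z, t⟩
    obtain ⟨w, hw⟩ := exists_inclDeriv_eq (m := 2 * n + 1) (basePt n)
      -- Tangency at the base point means that the first coordinate has real part zero.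
      (w := WithLp.toLp 2 (Fin.cons (t * Complex.I) z)) (by rw [inner_basePt]; simp)
    refine ⟨w, ?_⟩
    change (Fin.tail (inclDeriv (basePt n) w).ofLp, ((inclDeriv (basePt n) w).ofLp 0).im) = _
    rw [hw]
    simp

theorem exists_linearEquiv_isotropy (n : ℕ) :
    ∃ L : TangentSpace (𝓡 (2 * n + 1)) (basePt n) ≃ₗ[ℝ] (Fin n → ℂ) × ℝ,
      ∀ (A : U n) (w : TangentSpace (𝓡 (2 * n + 1)) (basePt n)),
        L (isotropy n A w) = (A.1.mulVec (L w).1, (L w).2) := by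
  refine ⟨.ofBijective _ (tangentCoordinates_bijective n), fun A w => ?_⟩
  change (Fin.tail (inclDeriv (basePt n) (isotropy n A w)).ofLp,
    ((inclDeriv (basePt n) (isotropy n A w)).ofLp 0).im) = _
  rw [inclDeriv_isotropy, unitaryIsometry_blockEmb_zero]
  refine Prod.ext (funext fun i => ?_) rfl
  exact unitaryIsometry_blockEmb_succ A _ i

/-! ### Transitivity and the stabilizer -/

theorem star_dotProduct_coe_sphere {k : ℕ} (x : sphere (0 : CSpace k) 1) :
    star x.1.ofLp ⬝ᵥ x.1.ofLp = 1 :=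
  star_dotProduct_self_eq_one (norm_eq_of_mem_sphere x)

theorem isPretransitive_sphere (n : ℕ) : MulAction.IsPretransitive (U (n + 1)) (CSphere n) where
  exists_smul_eq x y := by
    have hx := star_dotProduct_coe_sphere x
    have hy := star_dotProduct_coe_sphere y
    obtain ⟨g, hg⟩ : ∃ g : U (n + 1), g.1 *ᵥ x.1.ofLp = y.1.ofLp := by
      -- Where the rotor to `y` is undefined, the negative of the rotor to `-y` serves.
      by_cases h : 1 + star y.1.ofLp ⬝ᵥ x.1.ofLp = 0
      · have h' : 1 + star (-y.1.ofLp) ⬝ᵥ x.1.ofLp ≠ 0 := by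
          rw [star_neg, neg_dotProduct, ← sub_eq_add_neg, eq_neg_of_add_eq_zero_right h]
          norm_num
        refine ⟨-⟨_, rotor_mem hx (by simpa using hy) h'⟩, ?_⟩
        change (-rotor _ _) *ᵥ _ = _
        rw [neg_mulVec, rotor_mulVec hx h', neg_neg]
      · exact ⟨⟨_, rotor_mem hx hy h⟩, rotor_mulVec hx h⟩
    exact ⟨g, Subtype.ext (congrArg (WithLp.toLp 2) hg)⟩

theorem range_blockEmb (n : ℕ) :
    (blockEmb n).range = MulAction.stabilizer (U (n + 1)) (basePt n) := by
  ext g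
  constructor
  · rintro ⟨A, rfl⟩
    exact blockEmb_smul_basePt A
  · intro h
    have h' : g.1 *ᵥ Pi.single 0 1 = Pi.single 0 1 :=
      congrArg (fun x : CSphere n => x.1.ofLp) (MulAction.mem_stabilizer_iff.1 h)
    obtain ⟨A, hA⟩ := exists_eq_unitBlock g.2 h'
    exact mem_range_blockEmb hA

end

noncomputable section

open Matrix Topology

/-! ### Oriented orthonormal frames and orthonormal bases of the ambient space -/

section Frames

variable {E : Type*} [NormedAddCommGroup E] [InnerProductSpace ℝ E] {m : ℕ}
  [Fact (finrank ℝ E = m + 1)] {o : Orientation ℝ E (Fin (m + 1))}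

namespace FrameBundle

theorem ext_of_toAmbient {F G : FrameBundle o} (h : F.pt = G.pt)
    (h' : ∀ j, F.toAmbient j = G.toAmbient j) : F = G := by
  obtain ⟨x, v, hv⟩ := F
  obtain ⟨y, w, hw⟩ := G
  obtain rfl : x = y := h
  obtain rfl : v = w := funext fun j => inclDeriv_injective x (h' j)
  rfl

theorem orthonormal_cons (F : FrameBundle o) :
    Orthonormal ℝ (Fin.cons (F.pt : E) F.toAmbient : Fin (m + 1) → E) := by
  rw [orthonormal_iff_ite]
  intro i j
  have h := orthonormal_iff_ite.1 F.isFrame.1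
  refine Fin.cases ?_ (fun i => ?_) i <;> refine Fin.cases ?_ (fun j => ?_) j
  · simp
  · simpa [toAmbient, (Fin.succ_ne_zero _).symm] using inner_inclDeriv F.pt (F.vec j)
  · rw [real_inner_comm]
    simpa [toAmbient, Fin.succ_ne_zero] using inner_inclDeriv F.pt (F.vec i)
  · simpa [toAmbient] using h i j

/-- The orthonormal basis of the ambient space which consists of the base point of a frame and of
the vectors of the frame. -/
def basis (F : FrameBundle o) : OrthonormalBasis (Fin (m + 1)) ℝ E :=
  (basisOfOrthonormalOfCardEqFinrank F.orthonormal_cons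
    (by rw [(Fact.out : finrank ℝ E = m + 1), Fintype.card_fin])).toOrthonormalBasis
    (by rw [coe_basisOfOrthonormalOfCardEqFinrank]; exact F.orthonormal_cons)

theorem coe_basis (F : FrameBundle o) : ⇑F.basis = Fin.cons (F.pt : E) F.toAmbient := by
  rw [basis, Basis.coe_toOrthonormalBasis, coe_basisOfOrthonormalOfCardEqFinrank]

@[simp] theorem basis_zero (F : FrameBundle o) : F.basis 0 = F.pt := by rw [coe_basis]; rfl
@[simp] theorem basis_succ (F : FrameBundle o) (j : Fin m) : F.basis j.succ = F.toAmbient j := by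
  rw [coe_basis]; rfl

theorem volumeForm_basis_pos (F : FrameBundle o) : 0 < o.volumeForm F.basis := by
  rw [coe_basis]
  exact F.isFrame.2

theorem basis_injective : Function.Injective (basis (o := o)) := by
  intro F G h
  refine ext_of_toAmbient (Subtype.ext ?_) fun j => ?_
  · rw [← basis_zero, ← basis_zero, h]
  · rw [← basis_succ, ← basis_succ, h]

/-- With `basis_injective`, frames of the sphere are the same as positive orthonormal bases of `E`.
-/
theorem exists_basis_eq (b : OrthonormalBasis (Fin (m + 1)) ℝ E) (hb : 0 < o.volumeForm b) :
    ∃ F : FrameBundle o, F.basis = b := by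
  have hort (j : Fin m) : ⟪b 0, b j.succ⟫ = 0 := b.inner_eq_zero (Fin.succ_ne_zero _).symm
  have hx : b 0 ∈ sphere (0 : E) 1 := by simp
  choose v hv using fun j => exists_inclDeriv_eq (m := m) ⟨b 0, hx⟩ (hort j)
  have hcons : (Fin.cons (b 0) (fun j => inclDeriv ⟨b 0, hx⟩ (v j)) : Fin (m + 1) → E) = b := by
    ext i
    refine Fin.cases ?_ (fun i => ?_) i
    · rfl
    · simp [hv]
  refine ⟨⟨⟨b 0, hx⟩, v, ?_, ?_⟩, ?_⟩
  · simp_rw [hv]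
    exact b.orthonormal.comp _ (Fin.succ_injective _)
  · rw [hcons]
    exact hb
  · apply DFunLike.coe_injective
    rw [coe_basis]
    exact hcons

end FrameBundle

theorem volumeForm_orthonormalBasis_pos_iff (b : OrthonormalBasis (Fin (m + 1)) ℝ E) :
    0 < o.volumeForm b ↔ b.toBasis.orientation = o := by
  constructor
  · intro h
    by_contra hb
    have h1 := b.toBasis.det_self
    rw [b.coe_toBasis] at h1
    rw [o.volumeForm_robust_neg b hb, AlternatingMap.neg_apply, h1] at h
    norm_num at h
  · intro hb
    have h1 := b.toBasis.det_self
    rw [b.coe_toBasis] at h1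
    rw [o.volumeForm_robust b hb, h1]
    exact one_pos

end Frames

/-! ### Matrices of linear isometries in orthonormal bases -/

section IsometryMatrix

variable {E : Type*} [NormedAddCommGroup E] [InnerProductSpace ℝ E] {m : ℕ}

/-- The matrix of a linear isometry in an orthonormal basis. -/
def isometryMatrix (b : OrthonormalBasis (Fin (m + 1)) ℝ E) (T : E →ₗᵢ[ℝ] E) :
    Matrix (Fin (m + 1)) (Fin (m + 1)) ℝ :=
  LinearMap.toMatrix b.toBasis b.toBasis T.toLinearMap

theorem isometryMatrix_apply (b : OrthonormalBasis (Fin (m + 1)) ℝ E) (T : E →ₗᵢ[ℝ] E)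
    (i j : Fin (m + 1)) : isometryMatrix b T i j = ⟪b i, T (b j)⟫ := by
  rw [isometryMatrix, LinearMap.toMatrix_apply]
  simp [OrthonormalBasis.repr_apply_apply]

theorem isometryMatrix_mem (b : OrthonormalBasis (Fin (m + 1)) ℝ E) (T : E →ₗᵢ[ℝ] E) :
    isometryMatrix b T ∈ orthogonalGroup (Fin (m + 1)) ℝ := by
  rw [mem_orthogonalGroup_iff']
  ext j k
  simp only [mul_apply, transpose_apply, isometryMatrix_apply]
  simp_rw [real_inner_comm (T (b j))]
  rw [b.sum_inner_mul_inner, T.inner_map_map, b.inner_eq_ite, one_apply]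

end IsometryMatrix

/-! ### Unitary matrices as rotations -/

/-- The real determinant of a complex linear map is the squared modulus of its complex determinant.
-/
theorem det_unitaryIsometry {k : ℕ} (g : U k) :
    LinearMap.det (unitaryIsometry g).toLinearMap = 1 := by
  have h1 : (unitaryIsometry g).toLinearMap = (toLpLin 2 2 g.1).restrictScalars ℝ := rfl
  rw [h1, LinearMap.det_restrictScalars, toLpLin_eq_toLin, LinearMap.det_toLin,
    Algebra.norm_complex_apply]
  have h2 := (Unitary.mem_iff.1 (det_of_mem_unitary g.2)).1
  have h3 : ((Complex.normSq g.1.det : ℝ) : ℂ) = 1 := by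
    rw [Complex.normSq_eq_conj_mul_self]
    exact h2
  exact_mod_cast h3

section Rotations

variable {n : ℕ}

/-- The rotation which a unitary matrix defines, in an orthonormal basis of the real Euclidean space
`ℂ^(n+1)`. -/
def unitaryRotation (b : OrthonormalBasis (Fin (2 * n + 1 + 1)) ℝ (CSpace (n + 1))) :
    U (n + 1) →* SO (2 * n + 1 + 1) where
  toFun g := ⟨isometryMatrix b (unitaryIsometry g), mem_specialOrthogonalGroup_iff.2
    ⟨isometryMatrix_mem _ _, by rw [isometryMatrix, LinearMap.det_toMatrix, det_unitaryIsometry]⟩⟩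
  map_one' := by
    apply Subtype.ext
    have h : (unitaryIsometry (1 : U (n + 1))).toLinearMap = LinearMap.id := by
      ext x : 1
      change WithLp.toLp 2 ((1 : Matrix _ _ ℂ) *ᵥ x.ofLp) = x
      rw [one_mulVec]
    change LinearMap.toMatrix _ _ (unitaryIsometry (1 : U (n + 1))).toLinearMap = 1
    rw [h, LinearMap.toMatrix_id]
  map_mul' g h := by
    apply Subtype.ext
    have h1 : (unitaryIsometry (g * h)).toLinearMap =
        (unitaryIsometry g).toLinearMap ∘ₗ (unitaryIsometry h).toLinearMap :=
      LinearMap.ext (unitaryIsometry_mul g h)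
    change LinearMap.toMatrix _ _ (unitaryIsometry (g * h)).toLinearMap = _ * _
    rw [h1, LinearMap.toMatrix_comp _ b.toBasis]
    rfl

theorem unitaryRotation_apply (b : OrthonormalBasis (Fin (2 * n + 1 + 1)) ℝ (CSpace (n + 1)))
    (g : U (n + 1)) (i j : Fin (2 * n + 1 + 1)) :
    (unitaryRotation b g).1 i j = ⟪b i, unitaryIsometry g (b j)⟫ :=
  isometryMatrix_apply _ _ _ _

theorem continuous_unitaryRotation
    (b : OrthonormalBasis (Fin (2 * n + 1 + 1)) ℝ (CSpace (n + 1))) :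
    Continuous (unitaryRotation b) := by
  refine Continuous.subtype_mk (f := fun g => (unitaryRotation b g).1) ?_ _
  refine continuous_matrix fun i j => ?_
  simp only [unitaryRotation_apply, unitaryIsometry_apply]
  refine continuous_const.inner ?_
  refine (PiLp.continuous_toLp 2 _).comp ?_
  exact continuous_subtype_val.matrix_mulVec continuous_const

theorem unitaryIsometry_blockEmb_basePt (A : U n) :
    unitaryIsometry (blockEmb n A) (basePt n).1 = (basePt n).1 :=
  congrArg Subtype.val (blockEmb_smul_basePt A)

variable {o : Orientation ℝ (CSpace (n + 1)) (Fin (2 * n + 1 + 1))} {F : FrameBundle o}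

/-- The base point is the first vector of `F.basis` and is fixed by the block matrix. -/
theorem exists_blockSO_eq_unitaryRotation (hF : F.pt = basePt n) (A : U n) :
    ∃ B : SO (2 * n + 1), blockSO _ B = unitaryRotation F.basis (blockEmb n A) := by
  apply mem_range_blockSO_of_mulVec
  rw [mulVec_single_one]
  ext i
  rw [col_apply, unitaryRotation_apply, F.basis_zero, hF, unitaryIsometry_blockEmb_basePt, ← hF,
    ← F.basis_zero, F.basis.inner_eq_ite]
  simp [Pi.single_apply]

/-- The isotropy representation, in a frame at the base point. -/
def isotropyHom (hF : F.pt = basePt n) : U n →* SO (2 * n + 1) where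
  toFun A := (exists_blockSO_eq_unitaryRotation hF A).choose
  map_one' := by
    apply blockSO_injective
    rw [(exists_blockSO_eq_unitaryRotation hF _).choose_spec, map_one, map_one, map_one]
  map_mul' A B := by
    apply blockSO_injective
    have h (C : U n) := (exists_blockSO_eq_unitaryRotation hF C).choose_spec
    refine (h (A * B)).trans ?_
    rw [map_mul (blockSO _), h A, h B, map_mul, map_mul]

theorem blockSO_isotropyHom (hF : F.pt = basePt n) (A : U n) :
    blockSO _ (isotropyHom hF A) = unitaryRotation F.basis (blockEmb n A) :=
  (exists_blockSO_eq_unitaryRotation hF A).choose_spec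

theorem continuous_isotropyHom (hF : F.pt = basePt n) : Continuous (isotropyHom hF) := by
  rw [(blockSO_isInducing _).continuous_iff]
  have h : blockSO _ ∘ isotropyHom hF = unitaryRotation F.basis ∘ blockEmb n :=
    funext (blockSO_isotropyHom hF)
  rw [h]
  exact (continuous_unitaryRotation _).comp (blockEmb_isInducing n).continuous

theorem isotropyHom_apply (hF : F.pt = basePt n) (A : U n) (i j : Fin (2 * n + 1)) :
    (isotropyHom hF A).1 i j =
      ⟪F.toAmbient i, unitaryIsometry (blockEmb n A) (F.toAmbient j)⟫ := by
  rw [← F.basis_succ, ← F.basis_succ, ← unitaryRotation_apply, ← blockSO_isotropyHom hF]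
  rfl

theorem unitaryIsometry_toAmbient (hF : F.pt = basePt n) (A : U n) (j : Fin (2 * n + 1)) :
    unitaryIsometry (blockEmb n A) (F.toAmbient j) =
      ∑ i, (isotropyHom hF A).1 i j • F.toAmbient i := by
  have h0 : ⟪(F.pt : CSpace (n + 1)), unitaryIsometry (blockEmb n A) (F.toAmbient j)⟫ = 0 := by
    rw [← F.basis_zero, ← F.basis_succ, ← unitaryRotation_apply, ← blockSO_isotropyHom hF]
    rfl
  rw [← F.basis.sum_repr' (unitaryIsometry (blockEmb n A) (F.toAmbient j)), Fin.sum_univ_succ]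
  simp only [F.basis_zero, F.basis_succ, h0, zero_smul, zero_add, isotropyHom_apply]

/-- The coordinates, in a frame at the base point, of the tangent vector `(0, w)`. -/
def frameCoordinates (F : FrameBundle o) (w : Fin n → ℂ) (i : Fin (2 * n + 1)) : ℝ :=
  ⟪F.toAmbient i, (WithLp.toLp 2 (Fin.cons 0 w) : CSpace (n + 1))⟫

theorem inner_toLp_cons_zero (x : CSpace (n + 1)) (w : Fin n → ℂ) :
    ⟪x, WithLp.toLp 2 (Fin.cons 0 w)⟫ = (star w ⬝ᵥ Fin.tail x.ofLp).re := by
  rw [PiLp.inner_apply, Fin.sum_univ_succ]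
  simp [dotProduct, Complex.inner, Fin.tail, mul_comm]

theorem star_dotProduct_tail_toAmbient (F : FrameBundle o) (w : Fin n → ℂ) (i : Fin (2 * n + 1)) :
    star w ⬝ᵥ Fin.tail (F.toAmbient i).ofLp =
      frameCoordinates F w i + frameCoordinates F (Complex.I • w) i * Complex.I := by
  rw [frameCoordinates, frameCoordinates, inner_toLp_cons_zero, inner_toLp_cons_zero]
  apply Complex.ext <;> simp [StarModule.star_smul]

/-- Parseval in `F.basis`; the vectors `(0, w)` have no component along the base point. -/
theorem frameCoordinates_dotProduct (hF : F.pt = basePt n) (w w' : Fin n → ℂ) :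
    frameCoordinates F w ⬝ᵥ frameCoordinates F w' = (star w ⬝ᵥ w').re := by
  have h := F.basis.sum_inner_mul_inner (WithLp.toLp 2 (Fin.cons 0 w))
    (WithLp.toLp 2 (Fin.cons 0 w'))
  rw [Fin.sum_univ_succ, F.basis_zero, hF, inner_basePt] at h
  simp only [F.basis_succ, Fin.cons_zero, Complex.zero_re, mul_zero, zero_add] at h
  have h' : ⟪(WithLp.toLp 2 (Fin.cons 0 w) : CSpace (n + 1)), WithLp.toLp 2 (Fin.cons 0 w')⟫ =
      (star w ⬝ᵥ w').re := by
    rw [real_inner_comm, inner_toLp_cons_zero, Fin.tail_cons]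
  rw [← h', ← h]
  exact Finset.sum_congr rfl fun i _ => by rw [real_inner_comm]; rfl

theorem isOrthonormalPair_frameCoordinates (hF : F.pt = basePt n) {w : Fin n → ℂ}
    (hw : star w ⬝ᵥ w = 1) :
    IsOrthonormalPair (frameCoordinates F w) (frameCoordinates F (Complex.I • w)) where
  fst := by rw [frameCoordinates_dotProduct hF, hw, Complex.one_re]
  snd := by
    rw [frameCoordinates_dotProduct hF, StarModule.star_smul, smul_dotProduct, dotProduct_smul, hw]
    simp
  ortho := by
    rw [frameCoordinates_dotProduct hF, dotProduct_smul, hw]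
    simp

/-- Multiplication by `z` on the complex line of `w` is the rotation by `z` of the real plane with
orthonormal basis `w`, `i w`. -/
theorem isotropyHom_lineRotHom (hF : F.pt = basePt n) {w : Fin n → ℂ} (hw : star w ⬝ᵥ w = 1)
    (z : Circle) :
    isotropyHom hF (lineRotHom w hw z) = planeRotHom (isOrthonormalPair_frameCoordinates hF hw) z := by
  apply Subtype.ext
  ext i j
  -- The increment is `(z - 1) (star w ⬝ᵥ x) w`, with `x` the tail of the frame vector; the real and
  -- imaginary parts of the product are the frame coordinates of `w` and `i w`.
  have h1 : unitaryIsometry (blockEmb n (lineRotHom w hw z)) (F.toAmbient j) = F.toAmbient j +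
      ((((z : ℂ).re - 1) * frameCoordinates F w j - (z : ℂ).im * frameCoordinates F (Complex.I • w) j) •
        (WithLp.toLp 2 (Fin.cons 0 w) : CSpace (n + 1)) +
      ((z : ℂ).im * frameCoordinates F w j + ((z : ℂ).re - 1) * frameCoordinates F (Complex.I • w) j) •
        (WithLp.toLp 2 (Fin.cons 0 (Complex.I • w)) : CSpace (n + 1))) := by
    ext k
    refine Fin.cases ?_ (fun k => ?_) k
    · rw [unitaryIsometry_blockEmb_zero]
      simp
    · have h0 := star_dotProduct_tail_toAmbient F w j
      rw [unitaryIsometry_blockEmb_succ]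
      change (lineRot w (z : ℂ) *ᵥ _) k = _
      rw [lineRot, add_mulVec, one_mulVec, smul_mulVec, vecMulVec_mulVec, h0]
      apply Complex.ext
      · simp [Fin.tail]
        ring
      · simp [Fin.tail]
        ring
  rw [isotropyHom_apply, h1, inner_add_right, inner_add_right, real_inner_smul_right,
    real_inner_smul_right]
  have h2 : ⟪F.toAmbient i, F.toAmbient j⟫ = (1 : Matrix _ _ ℝ) i j := by
    rw [one_apply]
    exact orthonormal_iff_ite.1 F.isFrame.1 i j
  rw [h2]
  change _ = planeRot _ _ (z : ℂ) i j
  simp only [planeRot, Matrix.add_apply, Matrix.smul_apply, Matrix.sub_apply, vecMulVec_apply,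
    smul_eq_mul]
  change _ + (_ * frameCoordinates F w i + _ * frameCoordinates F (Complex.I • w) i) = _
  ring

/-- The induced map on fundamental groups sends generators to generators. -/
theorem zpowers_mapOfEq_isotropyHom (hn : 1 ≤ n) (hF : F.pt = basePt n)
    {g : FundamentalGroup (U n) 1} (hg : Subgroup.zpowers g = ⊤) :
    Subgroup.zpowers (FundamentalGroup.mapOfEq
      (⟨isotropyHom hF, continuous_isotropyHom hF⟩ : C(U n, SO (2 * n + 1)))
      (map_one (isotropyHom hF)) g) = ⊤ := by
  obtain ⟨e⟩ := nonempty_fundamentalGroup_SO_mulEquiv (m := 2 * n + 1) (by omega)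
  have hcard : Nat.card (FundamentalGroup (SO (2 * n + 1)) 1) = 2 := by
    rw [Nat.card_congr e.toEquiv]
    simp
  have : Fact (Nat.Prime 2) := ⟨Nat.prime_two⟩
  -- In a group of order two every nontrivial element generates. If the image of the generator `g`
  -- were trivial, so would be the image of the loop of line rotations, which is a full turn.
  refine zpowers_eq_top_of_prime_card hcard fun hone => ?_
  obtain ⟨w, hw, -⟩ := exists_mapOfEq_lineRotHom_surjective hn
  apply loopClass_planeRotLoop_ne_one (isOrthonormalPair_frameCoordinates hF hw)
  have hall : ∀ p : FundamentalGroup (U n) 1, FundamentalGroup.mapOfEq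
      (⟨isotropyHom hF, continuous_isotropyHom hF⟩ : C(U n, SO (2 * n + 1)))
      (map_one (isotropyHom hF)) p = 1 := by
    intro p
    obtain ⟨k, rfl⟩ := Subgroup.mem_zpowers_iff.1 (hg ▸ Subgroup.mem_top p)
    rw [map_zpow, hone, _root_.one_zpow]
  rw [← hall (FundamentalGroup.mapOfEq ⟨lineRotHom w hw, continuous_lineRotHom w hw⟩
    (map_one (lineRotHom w hw)) (loopClass circleLoop)),
    mapOfEq_loopClass, mapOfEq_loopClass]
  refine congrArg loopClass (Path.ext (funext fun t => ?_))
  exact (isotropyHom_lineRotHom hF hw _).symm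

end Rotations

theorem exists_isotropyHom {n : ℕ} (hn : 1 ≤ n)
    (o : Orientation ℝ (CSpace (n + 1)) (Fin (2 * n + 1 + 1)))
    (v : Fin (2 * n + 1) → TangentSpace (𝓡 (2 * n + 1)) (basePt n))
    (hv : IsOrientedFrame o (basePt n) v) :
    ∃ (σ : U n →* SO (2 * n + 1)) (hσ : Continuous σ),
      (∀ A j, isotropy n A (v j) = ∑ i, (σ A).1 i j • v i) ∧
      ∀ g : FundamentalGroup (U n) 1, Subgroup.zpowers g = ⊤ →
        Subgroup.zpowers (FundamentalGroup.mapOfEq ⟨σ, hσ⟩ (map_one σ) g) = ⊤ := by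
  let F : FrameBundle o := ⟨basePt n, v, hv⟩
  have hF : F.pt = basePt n := rfl
  refine ⟨isotropyHom hF, continuous_isotropyHom hF, fun A j => ?_,
    fun g => zpowers_mapOfEq_isotropyHom hn hF⟩
  apply inclDeriv_injective
  rw [inclDeriv_isotropy, map_sum]
  simp only [map_smul]
  exact unitaryIsometry_toAmbient hF A j
end

noncomputable section

open Matrix Topology

/-! ### Principal bundles of topological groups with local sections -/

/-- The fibres of `π` are the cosets of `j`, so each `p` over `U` is uniquely `s (π p) * j t`, and
`t` is its coordinate. -/
theorem exists_trivialization_of_section {P G B : Type*} [Group P] [TopologicalSpace P]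
    [IsTopologicalGroup P] [Group G] [TopologicalSpace G] [TopologicalSpace B] {j : G →* P}
    (hj : IsInducing j) (hinj : Function.Injective j) {π : P → B} (hπ : Continuous π)
    (hπj : ∀ p q, π p = π q ↔ p⁻¹ * q ∈ Set.range j) {U : Set B} (hU : IsOpen U) {s : B → P}
    (hs : ContinuousOn s U) (hsπ : ∀ y ∈ U, π (s y) = y) :
    ∃ e : Bundle.Trivialization G π, e.baseSet = U ∧
      ∀ p t, π p ∈ U → (e (p * j t)).2 = (e p).2 * t := by
  let g : P → G := fun p => Function.invFun j ((s (π p))⁻¹ * p)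
  have hg : ∀ p, π p ∈ U → j (g p) = (s (π p))⁻¹ * p := fun p hp =>
    Function.invFun_eq ((hπj _ _).1 (hsπ _ hp))
  have hπmul : ∀ p t, π (p * j t) = π p := fun p t =>
    ((hπj _ _).2 ⟨t, by rw [inv_mul_cancel_left]⟩).symm
  have hgc : ContinuousOn g (π ⁻¹' U) := by
    rw [hj.continuousOn_iff]
    refine ContinuousOn.congr (f := fun p => (s (π p))⁻¹ * p) ?_ hg
    exact ((hs.comp hπ.continuousOn (fun _ h => h)).inv).mul continuousOn_id
  have hgs : ∀ y ∈ U, ∀ t, g (s y * j t) = t := by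
    intro y hy t
    apply hinj
    have hy' : π (s y * j t) = y := (hπmul _ _).trans (hsπ y hy)
    rw [hg _ (hy'.symm ▸ hy), hy', inv_mul_cancel_left]
  let e : Bundle.Trivialization G π :=
    { toFun := fun p => (π p, g p)
      invFun := fun q => s q.1 * j q.2
      source := π ⁻¹' U
      target := U ×ˢ Set.univ
      map_source' := fun p hp => ⟨hp, trivial⟩
      map_target' := fun q hq => by
        rw [Set.mem_preimage, hπmul, hsπ _ hq.1]
        exact hq.1
      left_inv' := fun p hp => by
        rw [hg p hp, mul_inv_cancel_left]
      right_inv' := fun q hq => Prod.ext ((hπmul _ _).trans (hsπ _ hq.1)) (hgs _ hq.1 _)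
      open_source := hU.preimage hπ
      open_target := hU.prod isOpen_univ
      continuousOn_toFun := hπ.continuousOn.prodMk hgc
      continuousOn_invFun := (hs.comp continuousOn_fst (fun q hq => hq.1)).mul
        (hj.continuous.comp continuous_snd).continuousOn
      baseSet := U
      open_baseSet := hU
      source_eq := rfl
      target_eq := rfl
      proj_toFun := fun _ _ => rfl }
  refine ⟨e, rfl, fun p t hp => ?_⟩
  change g (p * j t) = g p * t
  apply hinj
  rw [hg _ ((hπmul p t).symm ▸ hp), hπmul, map_mul, hg p hp, mul_assoc]

/-! ### Frames and rotations -/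

section FrameHomeomorph

variable {E : Type*} [NormedAddCommGroup E] [InnerProductSpace ℝ E] {m : ℕ}
  [Fact (finrank ℝ E = m + 1)] {o : Orientation ℝ E (Fin (m + 1))}
  {b : OrthonormalBasis (Fin (m + 1)) ℝ E}

theorem exists_frame_of_rotation (hb : b.toBasis.orientation = o) (A : SO (m + 1)) :
    ∃ F : FrameBundle o, ∀ j, F.basis j = ∑ i, A.1 i j • b i := by
  let w : Fin (m + 1) → E := fun j => ∑ i, A.1 i j • b i
  have hA : A.1ᵀ * A.1 = 1 := (mem_orthogonalGroup_iff' (Fin (m + 1)) ℝ).1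
    (mem_specialOrthogonalGroup_iff.1 A.2).1
  have hw : Orthonormal ℝ w := by
    rw [orthonormal_iff_ite]
    intro j k
    simp only [w]
    rw [b.orthonormal.inner_sum, ← one_apply, ← hA, mul_apply]
    simp
  let b' : OrthonormalBasis (Fin (m + 1)) ℝ E :=
    (basisOfOrthonormalOfCardEqFinrank hw
      (by rw [(Fact.out : finrank ℝ E = m + 1), Fintype.card_fin])).toOrthonormalBasis
      (by rw [coe_basisOfOrthonormalOfCardEqFinrank]; exact hw)
  have hb' : ⇑b' = w := by
    simp only [b']
    rw [Basis.coe_toOrthonormalBasis, coe_basisOfOrthonormalOfCardEqFinrank]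
  have hmat : b.toBasis.toMatrix w = A.1 := by
    ext i j
    rw [Basis.toMatrix_apply, b.coe_toBasis_repr_apply, b.repr_apply_apply]
    simp only [w]
    rw [b.orthonormal.inner_right_fintype]
  have hpos : 0 < o.volumeForm b' := by
    rw [o.volumeForm_robust b hb, hb', Basis.det_apply, hmat,
      (mem_specialOrthogonalGroup_iff.1 A.2).2]
    exact one_pos
  obtain ⟨F, hF⟩ := FrameBundle.exists_basis_eq b' hpos
  exact ⟨F, fun j => by rw [hF, hb']⟩

theorem toMatrix_basis_mem (hb : b.toBasis.orientation = o) (F : FrameBundle o) :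
    b.toBasis.toMatrix F.basis ∈ specialOrthogonalGroup (Fin (m + 1)) ℝ := by
  refine mem_specialOrthogonalGroup_iff.2 ⟨b.toMatrix_orthonormalBasis_mem_orthogonal _, ?_⟩
  have h := (volumeForm_orthonormalBasis_pos_iff F.basis).1 F.volumeForm_basis_pos
  exact b.det_to_matrix_orthonormalBasis_of_same_orientation F.basis (hb.trans h.symm)

/-- Given a positively oriented orthonormal basis of the ambient space, the frames of the sphere are
the rotations. -/
def frameEquiv (hb : b.toBasis.orientation = o) : SO (m + 1) ≃ FrameBundle o where
  toFun A := (exists_frame_of_rotation hb A).choose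
  invFun F := ⟨b.toBasis.toMatrix F.basis, toMatrix_basis_mem hb F⟩
  left_inv A := by
    apply Subtype.ext
    ext i j
    change b.toBasis.toMatrix (exists_frame_of_rotation hb A).choose.basis i j = _
    rw [Basis.toMatrix_apply, b.coe_toBasis_repr_apply, b.repr_apply_apply,
      (exists_frame_of_rotation hb A).choose_spec, b.orthonormal.inner_right_fintype]
  right_inv F := by
    apply FrameBundle.basis_injective
    apply DFunLike.ext
    intro j
    rw [(exists_frame_of_rotation hb _).choose_spec]
    conv_rhs => rw [← b.sum_repr (F.basis j)]
    rfl

theorem basis_frameEquiv (hb : b.toBasis.orientation = o) (A : SO (m + 1)) (j : Fin (m + 1)) :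
    (frameEquiv hb A).basis j = ∑ i, A.1 i j • b i :=
  (exists_frame_of_rotation hb A).choose_spec j

theorem coe_pt_frameEquiv (hb : b.toBasis.orientation = o) (A : SO (m + 1)) :
    ((frameEquiv hb A).pt : E) = ∑ i, A.1 i 0 • b i := by
  rw [← basis_frameEquiv hb, FrameBundle.basis_zero]

theorem toAmbient_frameEquiv (hb : b.toBasis.orientation = o) (A : SO (m + 1)) (j : Fin m) :
    (frameEquiv hb A).toAmbient j = ∑ i, A.1 i j.succ • b i := by
  rw [← basis_frameEquiv hb, FrameBundle.basis_succ]

theorem basis_frameEquiv_mul (hb : b.toBasis.orientation = o) (A B : SO (m + 1))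
    (j : Fin (m + 1)) :
    (frameEquiv hb (A * B)).basis j = ∑ l, B.1 l j • (frameEquiv hb A).basis l := by
  simp only [basis_frameEquiv, Finset.smul_sum]
  rw [Finset.sum_comm]
  refine Finset.sum_congr rfl fun i _ => ?_
  change ((A.1 * B.1) i j) • _ = _
  rw [mul_apply, Finset.sum_smul]
  refine Finset.sum_congr rfl fun l _ => ?_
  rw [smul_smul, mul_comm]

theorem continuous_SO_apply (k : ℕ) (i j : Fin k) : Continuous fun A : SO k => A.1 i j :=
  (continuous_apply_apply i j).comp continuous_subtype_val

namespace FrameBundle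

theorem continuous_pt_toAmbient : Continuous fun F : FrameBundle o => (F.pt, F.toAmbient) :=
  continuous_induced_dom

theorem continuous_pt : Continuous fun F : FrameBundle o => F.pt :=
  continuous_fst.comp continuous_pt_toAmbient

theorem continuous_toAmbient (j : Fin m) : Continuous fun F : FrameBundle o => F.toAmbient j :=
  (continuous_apply j).comp (continuous_snd.comp continuous_pt_toAmbient)

end FrameBundle

/-- `frameEquiv` is a homeomorphism. -/
def frameHomeomorph (hb : b.toBasis.orientation = o) : SO (m + 1) ≃ₜ FrameBundle o where
  toEquiv := frameEquiv hb
  continuous_toFun := by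
    refine continuous_induced_rng.2 (.prodMk (Continuous.subtype_mk
      (f := fun A => ((frameEquiv hb A).pt : E)) ?_ _) (continuous_pi fun j => ?_))
    · simp only [coe_pt_frameEquiv]
      exact continuous_finsetSum _ fun i _ => (continuous_SO_apply _ i 0).smul continuous_const
    · change Continuous fun A => (frameEquiv hb A).toAmbient j
      simp only [toAmbient_frameEquiv]
      exact continuous_finsetSum _ fun i _ => (continuous_SO_apply _ i _).smul continuous_const
  continuous_invFun := by
    refine Continuous.subtype_mk (f := fun F : FrameBundle o => b.toBasis.toMatrix F.basis) ?_ _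
    refine continuous_matrix fun i j => ?_
    simp only [Basis.toMatrix_apply, b.coe_toBasis_repr_apply, b.repr_apply_apply]
    refine continuous_const.inner ?_
    refine Fin.cases ?_ (fun j => ?_) j
    · simp only [FrameBundle.basis_zero]
      exact continuous_subtype_val.comp FrameBundle.continuous_pt
    · simp only [FrameBundle.basis_succ]
      exact FrameBundle.continuous_toAmbient j

/-- Right multiplication by a block matrix keeps the first column, which is the base point, and
mixes the others. -/
theorem isRotationBy_frameEquiv (hb : b.toBasis.orientation = o) (A : SO (m + 1)) (B : SO m) :
    (frameEquiv hb A).IsRotationBy B.1 (frameEquiv hb (A * blockSO m B)) := by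
  have h := basis_frameEquiv_mul hb A (blockSO m B)
  simp only [Fin.sum_univ_succ, FrameBundle.basis_zero, FrameBundle.basis_succ] at h
  constructor
  · have h0 := h 0
    rw [FrameBundle.basis_zero] at h0
    apply Subtype.ext
    rw [h0]
    simp [blockSO]
  · intro j
    have hj := h j.succ
    rw [FrameBundle.basis_succ] at hj
    rw [hj]
    simp [blockSO]

theorem pt_frameEquiv_eq_iff (hb : b.toBasis.orientation = o) (A B : SO (m + 1)) :
    (frameEquiv hb A).pt = (frameEquiv hb B).pt ↔ A.1 *ᵥ Pi.single 0 1 = B.1 *ᵥ Pi.single 0 1 := by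
  rw [Subtype.ext_iff, coe_pt_frameEquiv, coe_pt_frameEquiv, mulVec_single_one, mulVec_single_one]
  constructor
  · intro h
    ext i
    have h' := congrArg (fun x => ⟪b i, x⟫) h
    simp only [b.orthonormal.inner_right_fintype] at h'
    exact h'
  · intro h
    refine Finset.sum_congr rfl fun i _ => ?_
    rw [show A.1 i 0 = B.1 i 0 from congrFun h i]

end FrameHomeomorph
end

noncomputable section

open Matrix Topology

/-! ### The spin structure of the sphere -/

section Existence

/-- The normalized lift of the rotor from `x` to `y` is continuous in `y` away from `-x`. -/
theorem exists_local_section_spinCover {m : ℕ} {x : Fin m → ℝ} (hx : x ⬝ᵥ x = 1) :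
    ∃ s : (Fin m → ℝ) → Spin m, ContinuousOn s {y | y ⬝ᵥ y = 1 ∧ 0 < 1 + y ⬝ᵥ x} ∧
      ∀ y, y ⬝ᵥ y = 1 → 0 < 1 + y ⬝ᵥ x → spinCover (s y) *ᵥ x = y := by
  classical
  let V := {y : Fin m → ℝ | y ⬝ᵥ y = 1 ∧ 0 < 1 + y ⬝ᵥ x}
  let a : (Fin m → ℝ) → Fin m → ℝ := fun y => (√(2 * (1 + y ⬝ᵥ x)))⁻¹ • (x + y)
  have ha (y) (hy : y ∈ V) : a y ⬝ᵥ a y = 1 := (exists_spinPair_eq_rotor hx hy.1 hy.2).1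
  refine ⟨fun y => if hy : y ∈ V then spinPair (a y) x (ha y hy) hx else 1, ?_, fun y h h' => ?_⟩
  · rw [continuousOn_iff_continuous_domRestrict]
    have hval : Continuous fun y : V => y.1 := continuous_subtype_val
    have hdot : Continuous fun y : V => y.1 ⬝ᵥ x := hval.dotProduct continuous_const
    have hac : Continuous fun y : V => a y.1 := by
      have hsqrt : Continuous fun y : V => √(2 * (1 + y.1 ⬝ᵥ x)) :=
        Real.continuous_sqrt.comp (continuous_const.mul (continuous_const.add hdot))
      exact (hsqrt.inv₀ fun y => (Real.sqrt_pos.2 (mul_pos two_pos y.2.2)).ne').smul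
        (continuous_const.add hval)
    have h := continuous_spinPair (fun y : V => ha y.1 y.2) (fun _ => hx) hac continuous_const
    refine h.congr fun y => ?_
    change _ = if hy : y.1 ∈ V then spinPair (a y.1) x (ha y.1 hy) hx else 1
    rw [dif_pos y.2]
  · have hy : y ∈ V := ⟨h, h'⟩
    change spinCover (dite _ _ _) *ᵥ x = y
    rw [dif_pos hy, (exists_spinPair_eq_rotor hx h h').2, rotor_mulVec (by simpa using hx)]
    rw [star_trivial]
    exact h'.ne'

theorem coordinates_dotProduct {E : Type*} [NormedAddCommGroup E] [InnerProductSpace ℝ E]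
    {ι : Type*} [Fintype ι] (b : OrthonormalBasis ι ℝ E) (x y : E) :
    (b.repr x).ofLp ⬝ᵥ (b.repr y).ofLp = ⟪x, y⟫ := by
  rw [← b.repr.inner_map_map, EuclideanSpace.inner_eq_star_dotProduct, star_trivial, dotProduct_comm]

variable {E : Type*} [NormedAddCommGroup E] [InnerProductSpace ℝ E] {k : ℕ}
  [Fact (finrank ℝ E = k + 1 + 1)] {o : Orientation ℝ E (Fin (k + 1 + 1))}
  {b : OrthonormalBasis (Fin (k + 1 + 1)) ℝ E}

/-- The map from the spin group to the frame bundle of the sphere. -/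
def spinFrame (hb : b.toBasis.orientation = o) (p : Spin (k + 1 + 1)) : FrameBundle o :=
  frameHomeomorph hb (spinHom _ p)

theorem isCoveringMap_spinFrame (hb : b.toBasis.orientation = o) :
    IsCoveringMap (spinFrame hb) :=
  (isQuotientCoveringMap_spinHom (k + 1)).isCoveringMap.homeomorph_comp (frameHomeomorph hb)

/-- The points of `Spin(k+2)` over one point of the sphere form a left coset of the stabilizer,
which is `Spin(k+1)`. -/
theorem pt_spinFrame_eq_iff (hb : b.toBasis.orientation = o) (p q : Spin (k + 1 + 1)) :
    (spinFrame hb p).pt = (spinFrame hb q).pt ↔ p⁻¹ * q ∈ Set.range (spinEmb (k + 1)) := by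
  have hmul (r : Spin (k + 1 + 1)) : spinCover (p⁻¹ * r) *ᵥ Pi.single 0 1 =
      (spinHom _ p)⁻¹.1 *ᵥ (spinCover r *ᵥ Pi.single 0 1) := by
    have h := congrArg Subtype.val (map_mul (spinHom (k + 1 + 1)) p⁻¹ r)
    rw [map_inv] at h
    rw [mulVec_mulVec]
    exact congrArg (fun M => M *ᵥ _) h
  refine (pt_frameEquiv_eq_iff hb _ _).trans ⟨fun h => ?_, ?_⟩
  · change spinCover p *ᵥ _ = spinCover q *ᵥ _ at h
    apply mem_range_spinEmb
    rw [hmul, ← h, ← hmul, inv_mul_cancel]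
    exact (congrArg (fun M : SO (k + 1 + 1) => M.1 *ᵥ Pi.single 0 1) (map_one (spinHom _))).trans
      (one_mulVec _)
  · rintro ⟨s, hs⟩
    obtain rfl : q = p * spinEmb _ s := by rw [hs, mul_inv_cancel_left]
    have h1 := congrArg (fun M : SO (k + 1 + 1) => M.1 *ᵥ Pi.single 0 1)
      (map_mul (spinHom _) p (spinEmb _ s))
    refine Eq.trans ?_ h1.symm
    rw [spinHom_spinEmb]
    change _ = (_ * unitBlock _) *ᵥ _
    rw [← mulVec_mulVec]
    congr 1
    have h2 : (Pi.single 0 1 : Fin (k + 1 + 1) → ℝ) = Fin.cons 1 0 := by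
      ext i
      refine Fin.cases ?_ (fun i => ?_) i <;> simp
    rw [h2, unitBlock_mulVec_cons, mulVec_zero]

theorem coe_pt_spinFrame (hb : b.toBasis.orientation = o) (p : Spin (k + 1 + 1)) (y : E)
    (h : spinCover p *ᵥ Pi.single 0 1 = (b.repr y).ofLp) : ((spinFrame hb p).pt : E) = y := by
  rw [← b.sum_repr y]
  refine (coe_pt_frameEquiv hb _).trans (Finset.sum_congr rfl fun i _ => ?_)
  rw [← h, mulVec_single_one]
  rfl

theorem exists_trivialization_spinFrame (hb : b.toBasis.orientation = o) (x : sphere (0 : E) 1) :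
    ∃ e : Bundle.Trivialization (Spin (k + 1)) (fun p => (spinFrame hb p).pt),
      x ∈ e.baseSet ∧ ∀ p s, (spinFrame hb p).pt ∈ e.baseSet →
        (e (p * spinEmb (k + 1) s)).2 = (e p).2 * s := by
  have hnorm (y : sphere (0 : E) 1) : (b.repr y.1).ofLp ⬝ᵥ (b.repr y.1).ofLp = 1 := by
    rw [coordinates_dotProduct, real_inner_self_eq_norm_sq, norm_eq_of_mem_sphere, one_pow]
  obtain ⟨a, a', ha, ha', hp⟩ := exists_spinPair_mulVec_single k (hnorm x)
  obtain ⟨s, hs, hsx⟩ := exists_local_section_spinCover (hnorm x)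
  let U : Set (sphere (0 : E) 1) := {y | 0 < 1 + ⟪y.1, x.1⟫}
  have hU : IsOpen U := isOpen_lt continuous_const (by fun_prop)
  have hπ : Continuous fun p => (spinFrame hb p).pt :=
    FrameBundle.continuous_pt.comp (isCoveringMap_spinFrame hb).continuous
  have hemb : IsClosedEmbedding (spinEmb (k + 1)) :=
    (continuous_spinEmb _).isClosedEmbedding (spinEmb_injective _)
  have hcoord : Continuous fun y : sphere (0 : E) 1 => (b.repr y.1).ofLp :=
    (PiLp.continuous_ofLp 2 _).comp (b.repr.continuous.comp continuous_subtype_val)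
  have hmem (y : sphere (0 : E) 1) (hy : y ∈ U) : 0 < 1 + (b.repr y.1).ofLp ⬝ᵥ (b.repr x.1).ofLp := by
    rw [coordinates_dotProduct]
    exact hy
  obtain ⟨e, heU, he⟩ := exists_trivialization_of_section (j := spinEmb (k + 1))
    hemb.isInducing (spinEmb_injective _) hπ (pt_spinFrame_eq_iff hb) hU
    -- The pair takes the first basis vector to `x`, and the local section then takes `x` to `y`.
    (s := fun y => s (b.repr y.1).ofLp * spinPair a a' ha ha')
    ((hs.comp hcoord.continuousOn (fun y hy => ⟨hnorm y, hmem y hy⟩)).mul continuousOn_const)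
    (fun y hy => by
      apply Subtype.ext
      apply coe_pt_spinFrame
      have h := congrArg (fun M : SO (k + 1 + 1) => M.1 *ᵥ Pi.single 0 1)
        (map_mul (spinHom _) (s (b.repr y.1).ofLp) (spinPair a a' ha ha'))
      refine h.trans ?_
      change (spinCover _ * spinCover _) *ᵥ _ = _
      rw [← mulVec_mulVec, hp, hsx _ (hnorm y) (hmem y hy)])
  refine ⟨e, ?_, fun p t hp => he p t (heU ▸ hp)⟩
  rw [heU]
  change 0 < 1 + ⟪x.1, x.1⟫
  rw [real_inner_self_eq_norm_sq, norm_eq_of_mem_sphere]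
  norm_num

theorem preimage_spinFrame (hb : b.toBasis.orientation = o) (p : Spin (k + 1 + 1)) :
    spinFrame hb ⁻¹' {spinFrame hb p} = {p, p * spinNeg _} := by
  ext q
  refine Iff.trans ?_ spinHom_eq_iff
  exact (frameHomeomorph hb).injective.eq_iff

/-- The total space is `Spin(k+2)`, lifted to the universe at hand, with right multiplication by
`Spin(k+1)`. -/
theorem nonempty_spinStructure (o : Orientation ℝ E (Fin (k + 1 + 1))) :
    Nonempty (SpinStructure.{u} o) := by
  let b := o.finOrthonormalBasis (Nat.succ_pos _) Fact.out
  have hb : b.toBasis.orientation = o := o.finOrthonormalBasis_orientation _ _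
  have hcov : IsCoveringMap (spinFrame hb ∘ Homeomorph.ulift.{u}) :=
    (isCoveringMap_spinFrame hb).comp_homeomorph _
  refine ⟨{
    P := ULift.{u} (Spin (k + 1 + 1))
    act := fun p s => ⟨p.down * spinEmb _ s⟩
    act_one := fun p => by rw [map_one, mul_one]
    act_mul := fun p s t => by rw [map_mul, mul_assoc]
    continuous_act := continuous_uliftUp.comp ((continuous_uliftDown.comp continuous_fst).mul
      ((continuous_spinEmb _).comp continuous_snd))
    Λ := spinFrame hb ∘ Homeomorph.ulift.{u}
    isCoveringMap := hcov
    two_sheets := fun F => ?_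
    principal := fun x => ?_
    compat := fun p s => ?_ }⟩
  · obtain ⟨A, rfl⟩ := (frameHomeomorph hb).surjective F
    obtain ⟨p, rfl⟩ := spinHom_surjective _ A
    rw [Set.preimage_comp]
    change (Homeomorph.ulift.{u} ⁻¹' (spinFrame hb ⁻¹' {spinFrame hb p})).ncard = 2
    rw [preimage_spinFrame, ← Homeomorph.image_symm, Set.ncard_image_of_injective _
      (Homeomorph.injective _), Set.ncard_pair]
    intro h
    exact spinNeg_ne_one _ (mul_eq_left.1 h.symm)
  · obtain ⟨e, hx, he⟩ := exists_trivialization_spinFrame hb x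
    exact ⟨e.compHomeomorph Homeomorph.ulift.{u}, hx, fun p s hp => he p.down s hp⟩
  · have h := isRotationBy_frameEquiv hb (spinHom _ p.down) (spinHom _ s)
    rw [← spinHom_spinEmb, ← map_mul] at h
    exact h

end Existence
end

noncomputable section

open Matrix Topology CliffordAlgebra

/-! ### Invariant spin structures do not exist -/

section SpinStructure

variable {E : Type*} [NormedAddCommGroup E] [InnerProductSpace ℝ E]

/-! ### `Spin(m)` acts simply transitively on the fibres of a spin structure -/

section Fibers

variable {m : ℕ} [Fact (finrank ℝ E = m + 1)] {o : Orientation ℝ E (Fin (m + 1))}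
  (S : SpinStructure.{u} o)

theorem SpinStructure.act_left_cancel (p : S.P) {s t : Spin m} (h : S.act p s = S.act p t) :
    s = t := by
  obtain ⟨e, hx, he⟩ := S.principal (S.Λ p).pt
  have h' := he p s hx
  rw [h, he p t hx] at h'
  exact (mul_left_cancel h').symm

theorem SpinStructure.exists_act_eq {p q : S.P} (h : (S.Λ q).pt = (S.Λ p).pt) :
    ∃ s, q = S.act p s := by
  obtain ⟨e, hx, he⟩ := S.principal (S.Λ p).pt
  refine ⟨(e p).2⁻¹ * (e q).2, ?_⟩
  have hact := (S.compat p ((e p).2⁻¹ * (e q).2)).1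
  have hq : q ∈ e.source := e.mem_source.2 (h ▸ hx)
  have ha : S.act p ((e p).2⁻¹ * (e q).2) ∈ e.source := e.mem_source.2 (hact ▸ hx)
  refine e.injOn hq ha (show e q = e _ from Prod.ext ?_ ?_)
  · rw [e.coe_fst hq, e.coe_fst ha, hact, h]
  · rw [he p _ hx, mul_inv_cancel_left]

theorem SpinStructure.Λ_surjective : Function.Surjective S.Λ := by
  intro F
  have h : (S.Λ ⁻¹' {F}).Nonempty := by
    apply Set.nonempty_of_ncard_ne_zero
    rw [S.two_sheets]
    exact two_ne_zero
  exact h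

end Fibers

theorem FrameBundle.exists_pt_eq {k : ℕ} [Fact (finrank ℝ E = k + 1 + 1)]
    (o : Orientation ℝ E (Fin (k + 1 + 1))) (x : sphere (0 : E) 1) :
    ∃ F : FrameBundle o, F.pt = x := by
  let b := o.finOrthonormalBasis (Nat.succ_pos _) Fact.out
  have hb : b.toBasis.orientation = o := o.finOrthonormalBasis_orientation _ _
  have hx : (b.repr x.1).ofLp ⬝ᵥ (b.repr x.1).ofLp = 1 := by
    rw [coordinates_dotProduct, real_inner_self_eq_norm_sq, norm_eq_of_mem_sphere, one_pow]
  obtain ⟨a, a', ha, ha', hp⟩ := exists_spinPair_mulVec_single k hx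
  exact ⟨_, Subtype.ext (coe_pt_spinFrame hb _ _ hp)⟩

end SpinStructure

/-! ### The obstruction: an involution whose lifts square to `-1` -/

section Noninvariance

theorem spinRotation_pi_div_two_mul_self {m : ℕ} {u₁ u₂ : Fin m → ℝ} (h : IsOrthonormalPair u₁ u₂) :
    (spinRotation h (Real.pi / 2) : CliffordAlgebra (cliffordForm m)) *
      spinRotation h (Real.pi / 2) = -1 := by
  have h1 : (spinRotation h (Real.pi / 2) : CliffordAlgebra (cliffordForm m)) =
      ι (cliffordForm m) u₁ * ι (cliffordForm m) u₂ := by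
    rw [coe_spinRotation]
    simp
  have h2 : ι (cliffordForm m) u₁ * ι (cliffordForm m) u₁ = -1 := by
    rw [ι_mul_self, h.fst]
    simp
  have h3 : ι (cliffordForm m) u₂ * ι (cliffordForm m) u₂ = -1 := by
    rw [ι_mul_self, h.snd]
    simp
  have h4 : ι (cliffordForm m) u₂ * ι (cliffordForm m) u₁ =
      -(ι (cliffordForm m) u₁ * ι (cliffordForm m) u₂) := by
    rw [ι_mul_ι_swap, dotProduct_comm, h.ortho]
    simp
  rw [h1, mul_assoc, ← mul_assoc (ι _ u₂), h4, neg_mul, mul_assoc, h3, mul_neg, ← mul_assoc, mul_neg,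
    mul_one, neg_neg, h2]

/-- The two lifts of a half turn are `u₁ u₂` and its negative, and both square to `-1`. -/
theorem mul_self_ne_one_of_spinHom_eq {k : ℕ} {u₁ u₂ : Fin (k + 1) → ℝ} (h : IsOrthonormalPair u₁ u₂)
    {s : Spin (k + 1)} (hs : spinHom _ s = planeRotHom h (Circle.exp Real.pi)) : s * s ≠ 1 := by
  have hr : spinHom _ (spinRotation h (Real.pi / 2)) = planeRotHom h (Circle.exp Real.pi) := by
    apply Subtype.ext
    refine (spinCover_spinRotation h _).trans ?_
    rw [mul_div_cancel₀ _ two_ne_zero]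
    rfl
  have h2 : (s : CliffordAlgebra (cliffordForm (k + 1))) * s = -1 := by
    rw [← spinRotation_pi_div_two_mul_self h]
    rcases spinHom_eq_iff.1 (hs.trans hr.symm) with rfl | rfl
    · rfl
    · change (_ * (spinNeg k : CliffordAlgebra (cliffordForm (k + 1)))) *
        (_ * (spinNeg k : CliffordAlgebra (cliffordForm (k + 1)))) = _
      rw [coe_spinNeg]
      simp
  intro h1
  apply clifford_neg_one_ne_one (m := k + 1)
  rw [← h2]
  exact congrArg Subtype.val h1

/-- An involution in the stabilizer would move `p` within its fibre to `p · s`, where `s` lies over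
a half turn. Since `φ` is multiplicative and commutes with the right action, `p · (s * s) = p`,
which is impossible. -/
theorem not_isInvariant {n : ℕ} (hn : 1 ≤ n)
    {o : Orientation ℝ (CSpace (n + 1)) (Fin (2 * n + 1 + 1))} (S : SpinStructure.{u} o) :
    ¬ S.IsInvariant (U (n + 1)) := by
  rintro ⟨φ, h1, hmul, hact, hΛ⟩
  obtain ⟨w, hw, -⟩ := exists_mapOfEq_lineRotHom_surjective hn
  obtain ⟨F, hF⟩ := FrameBundle.exists_pt_eq o (basePt n)
  obtain ⟨p, rfl⟩ := S.Λ_surjective F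
  -- As `exp(iπ) = -1`, this multiplies `w` by `-1` and is an involution.
  let A := lineRotHom w hw (Circle.exp Real.pi)
  have hA : blockEmb n A * blockEmb n A = 1 := by
    have hc : Circle.exp Real.pi * Circle.exp Real.pi = 1 := by
      rw [← Circle.exp_add, ← two_mul, Circle.exp_two_pi]
    rw [← map_mul, ← map_mul, hc, map_one, map_one]
  obtain ⟨hpt, hvec⟩ := hΛ (blockEmb n A) p
  obtain ⟨s, hs⟩ := S.exists_act_eq (p := p) (q := φ (blockEmb n A) p)
    (by rw [hpt, hF]; exact blockEmb_smul_basePt A)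
  -- Both sides are the image of the frame `Λ p` under `A`: through the right action by `s`, and
  -- through the differential.
  have hamb (j) : ∑ i, spinCover s i j • (S.Λ p).toAmbient i =
      ∑ i, (isotropyHom hF A).1 i j • (S.Λ p).toAmbient i := by
    rw [← (S.compat p s).2 j, ← hs, hvec, ← unitaryIsometry_toAmbient hF]
    exact inclDeriv_mfderiv_smul _ _ _
  have hsA : spinHom _ s = isotropyHom hF A := by
    apply Subtype.ext
    ext i j
    have h := congrArg (fun x => ⟪(S.Λ p).toAmbient i, x⟫) (hamb j)
    have hort : Orthonormal ℝ (S.Λ p).toAmbient := (S.Λ p).isFrame.1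
    simp only [hort.inner_right_fintype] at h
    exact h
  refine mul_self_ne_one_of_spinHom_eq (isOrthonormalPair_frameCoordinates hF hw)
    (hsA.trans (isotropyHom_lineRotHom hF hw _)) ?_
  apply S.act_left_cancel p
  rw [S.act_one, S.act_mul, ← hs, ← hact, ← hs, ← hmul, hA, h1]

end Noninvariance
end

theorem mainTheorem5 (n : ℕ) (hn : 1 ≤ n) :
    -- the action is transitive, and `U(n)` is the stabilizer of the base point
    (MulAction.IsPretransitive (U (n + 1)) (CSphere n) ∧
      Function.Injective (blockEmb n) ∧
      (blockEmb n).range = MulAction.stabilizer (U (n + 1)) (basePt n)) ∧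
    -- for either orientation, spin structures exist and none of them is `U(n+1)`-invariant
    (∀ o : Orientation ℝ (CSpace (n + 1)) (Fin (2 * n + 1 + 1)),
      Nonempty (SpinStructure.{u} o) ∧
        ∀ S : SpinStructure.{u} o, ¬ S.IsInvariant (U (n + 1))) ∧
    -- the isotropy representation is the sum of the real form of the standard representation of
    -- `U(n)` on `ℂ^n` and of the trivial representation on `ℝ`
    (∃ L : TangentSpace (𝓡 (2 * n + 1)) (basePt n) ≃ₗ[ℝ] (Fin n → ℂ) × ℝ,
      ∀ (A : U n) (w : TangentSpace (𝓡 (2 * n + 1)) (basePt n)),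
        L (isotropy n A w) = (A.1.mulVec (L w).1, (L w).2)) ∧
    -- the two fundamental groups
    Nonempty (FundamentalGroup (U n) 1 ≃* Multiplicative ℤ) ∧
    Nonempty (FundamentalGroup (SO (2 * n + 1)) 1 ≃* Multiplicative (ZMod 2)) ∧
    -- in any oriented orthonormal basis `v` of the tangent space, the isotropy representation is a
    -- continuous homomorphism `σ` to `SO(2n+1)` and sends generators to generators
    ∀ (o : Orientation ℝ (CSpace (n + 1)) (Fin (2 * n + 1 + 1)))
      (v : Fin (2 * n + 1) → TangentSpace (𝓡 (2 * n + 1)) (basePt n)),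
      IsOrientedFrame o (basePt n) v →
      ∃ (σ : U n →* SO (2 * n + 1)) (hσ : Continuous σ),
        (∀ A j, isotropy n A (v j) = ∑ i, (σ A).1 i j • v i) ∧
        ∀ g : FundamentalGroup (U n) 1, Subgroup.zpowers g = ⊤ →
          Subgroup.zpowers (FundamentalGroup.mapOfEq ⟨σ, hσ⟩ (map_one σ) g) = ⊤ := by
  refine ⟨⟨isPretransitive_sphere n, (blockEmb_injective n), range_blockEmb n⟩,
    fun o => ⟨nonempty_spinStructure o, not_isInvariant hn⟩, exists_linearEquiv_isotropy n,
    nonempty_fundamentalGroup_U_mulEquiv hn,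
    nonempty_fundamentalGroup_SO_mulEquiv (by omega), exists_isotropyHom hn⟩
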